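/- Let $K$ be a field of characteristic zero containing a primitive fifth root of unity $\zeta$ (for example $K=\mathbb{Q}(\zeta)\subset\mathbb{C}$ or $K=\mathbb{C}$), and put $\omega=-\zeta^2-\zeta^3$. Let $W\subset \mathrm{GL}_3(K)$ be the Coxeter group of type $H_3$ generated by $$g_1=\begin{pmatrix}1&0&0\\0&1&1\\0&0&-1\end{pmatrix},\quad g_2=\begin{pmatrix}-1&0&0\\ \omega&1&0\\0&0&1\end{pmatrix},\quad g_3=\begin{pmatrix}1&\omega&0\\0&-1&0\\0&1&1\end{pmatrix},$$ acting from the right on row vectors in $V^*\cong K^3$, where $V=K^3$. Let $\Phi$ be the set of roots, i.e. the union of the $W$-orbits of the three standard basis vectors, and let $$\mathcal{A}=\{v^\perp \mid v\in \Phi\cup (1,-\zeta^2,0)\cdot W\},$$ where $v^\perp\subset V$ is the kernel of the linear form $v$. Conventions. An arrangement is a finite set of hyperplanes (kernels of nonzero linear forms $\alpha_H$) in a finite-dimensional $K$-vector space $V$; let $S=S(V^*)$ and $Q(\mathcal{B})=\prod_{H\in\mathcal{B}}\alpha_H$. An arrangement $\mathcal{B}$ is free if $D(\mathcal{B})=\{\theta\in\mathrm{Der}_K(S)\mid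 \theta(Q(\mathcal{B}))\in Q(\mathcal{B})S\}$ is a free $S$-module, and then $\exp\mathcal{B}$ denotes the multiset of polynomial degrees of a homogeneous basis. For a hyperplane $H\in\mathcal{B}$ put $\mathcal{B}^H=\{H\cap H'\mid H'\in\mathcal{B}\setminus\{H\}\}$, an arrangement in $H$. The characteristic polynomial is $\chi_{\mathcal{B}}(t)=\sum_{X}\mu(V,X)t^{\dim X}$, where $X$ runs over all intersections of elements of $\mathcal{B}$ (including $V$), ordered by reverse inclusion, and $\mu$ is the Möbius function. The class of recursively free arrangements over $K$ is the smallest class that contains all empty arrangements and such that, for every arrangement $\mathcal{B}$ and $H\in\mathcal{B}$ with $\mathcal{B}^H$ in the class: if $\mathcal{B}\setminus\{H\}$ is in the class and $\exp\mathcal{B}^H\subset\exp(\mathcal{B}\setminus\{H\})$, then $\mathcal{B}$ is in the class; and if $\mathcal{B}$ is in the class and $\exp\mathcal{B}^H\subset\exp\mathcal{B}$, then $\mathcal{B}\setminus\{H\}$ is in the class. For $H\in\mathcal{B}$, say that the triple $(\mathcal{B},\mathcal{B}\setminus\{H\},\mathcal{B}^H)$ has compatible exponents if $\mathcal{B}^H$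 is free and $\mathcal{B}$ is free with $\exp\mathcal{B}^H\subset\exp\mathcal{B}$, or $\mathcal{B}^H$ is free and $\mathcal{B}\setminus\{H\}$ is free with $\exp\mathcal{B}^H\subset\exp(\mathcal{B}\setminus\{H\})$. Theorem. $\mathcal{A}$ is an arrangement of exactly $27$ planes: $15$ planes $v^\perp$ with $v\in\Phi$ and $12$ planes $v^\perp$ with $v\in(1,-\zeta^2,0)\cdot W$. It is free with exponents $\{\{1,11,15\}\}$ and $\chi_{\mathcal{A}}(t)=(t-1)(t-11)(t-15)$, but it is not recursively free. Moreover, for no $H\in\mathcal{A}$ does the triple $(\mathcal{A},\mathcal{A}\setminus\{H\},\mathcal{A}^H)$ have compatible exponents, and for no plane $H\notin\mathcal{A}$ does the triple $(\mathcal{A}\cup\{H\},\mathcal{A},(\mathcal{A}\cup\{H\})^H)$ have compatible exponents. -/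

import Mathlib

universe u v

/-- A (central) hyperplane of `V`: the kernel of a nonzero linear form. -/
def IsHyperplane {K : Type v} {V : Type u} [Field K] [AddCommGroup V] [Module K V]
    (H : Submodule K V) : Prop :=
  ∃ α : Module.Dual K V, α ≠ 0 ∧ LinearMap.ker α = H

/-- An arrangement of hyperplanes in `V`: a finite set of hyperplanes. -/
@[ext]
structure Arrangement (K : Type v) (V : Type u) [Field K] [AddCommGroup V] [Module K V] where
  planes : Finset (Submodule K V)
  isHyperplane : ∀ H ∈ planes, IsHyperplane H

namespace Arrangement

section Basic

variable {K : Type v} {V : Type u} [Field K] [AddCommGroup V] [Module K V]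

/-- The empty arrangement in `V`. -/
def empty (K : Type v) (V : Type u) [Field K] [AddCommGroup V] [Module K V] :
    Arrangement K V where
  planes := ∅
  isHyperplane := fun H hH => absurd hH (Finset.notMem_empty H)

open Classical in
/-- The arrangement `A ∪ {H}`. -/
noncomputable def add (A : Arrangement K V) (H : Submodule K V) (hH : IsHyperplane H) :
    Arrangement K V where
  planes := insert H A.planes
  isHyperplane := by
    intro H' h
    rcases Finset.mem_insert.1 h with rfl | h
    · exact hH
    · exact A.isHyperplane H' h

open Classical in
/-- The deletion `A' = A \ {H}`. -/
noncomputable def delete (A : Arrangement K V) (H : Submodule K V) : Arrangement K V where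
  planes := A.planes.erase H
  isHyperplane := fun H' h => A.isHyperplane H' (Finset.mem_of_mem_erase h)

open Classical in
/-- The restriction `A^X = {X ∩ H | H ∈ A, X ⊄ H}`, an arrangement in the vector space `X`;
for `X = H ∈ A` this is `A''`. -/
noncomputable def restrict (A : Arrangement K V) (X : Submodule K V) : Arrangement K X where
  planes := (A.planes.filter (fun H => ¬ X ≤ H)).image (fun H => H.comap X.subtype)
  isHyperplane := by
    intro Y hY
    obtain ⟨H, hH, rfl⟩ := Finset.mem_image.1 hY
    obtain ⟨hA, hX⟩ := Finset.mem_filter.1 hH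
    obtain ⟨α, -, rfl⟩ := A.isHyperplane H hA
    refine ⟨α.comp X.subtype, fun h0 => hX fun x hx => ?_, LinearMap.ker_comp _ _⟩
    exact LinearMap.congr_fun h0 ⟨x, hx⟩

/-! ### Derivations, freeness and exponents -/

/-- The ring `S = S(V^*)` of polynomial functions on `V`. -/
abbrev PolyRing (K : Type v) (V : Type u) [Field K] [AddCommGroup V] [Module K V] :=
  SymmetricAlgebra K (Module.Dual K V)

/-- The module `Der(S)` of `K`-derivations of `S`. -/
abbrev Der (K : Type v) (V : Type u) [Field K] [AddCommGroup V] [Module K V] :=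
  Derivation K (PolyRing K V) (PolyRing K V)

/-- A linear form `α_H` with kernel `H`; it is unique up to a nonzero scalar. -/
noncomputable def form (A : Arrangement K V) (H : {H // H ∈ A.planes}) : Module.Dual K V :=
  Classical.choose (A.isHyperplane H.1 H.2)

theorem form_ne_zero (A : Arrangement K V) (H : {H // H ∈ A.planes}) : A.form H ≠ 0 :=
  (Classical.choose_spec (A.isHyperplane H.1 H.2)).1

theorem ker_form (A : Arrangement K V) (H : {H // H ∈ A.planes}) :
    LinearMap.ker (A.form H) = H.1 :=
  (Classical.choose_spec (A.isHyperplane H.1 H.2)).2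

/-- The defining polynomial `Q(A) = ∏_{H ∈ A} α_H`. -/
noncomputable def definingPoly (A : Arrangement K V) : PolyRing K V :=
  ∏ H ∈ A.planes.attach, SymmetricAlgebra.ι K (Module.Dual K V) (A.form H)

/-- The module `D(A) = {θ ∈ Der(S) | θ(Q(A)) ∈ Q(A) S}` of `A`-derivations. -/
noncomputable def derivations (A : Arrangement K V) : Submodule (PolyRing K V) (Der K V) where
  carrier := {θ | A.definingPoly ∣ θ A.definingPoly}
  zero_mem' := dvd_zero _
  add_mem' := fun ha hb => dvd_add ha hb
  smul_mem' := fun c _ h => Dvd.dvd.mul_left h c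

/-- `A` is free if `D(A)` is a free `S`-module. -/
def IsFree (A : Arrangement K V) : Prop :=
  Module.Free (PolyRing K V) A.derivations

/-- `θ` is homogeneous of polynomial degree `p`: it is nonzero and maps every linear form on `V`
(equivalently, each coordinate `x_k`) into `S_p`, the span of the `p`-fold products of linear
forms. -/
def IsHomogeneousOfDegree (θ : Der K V) (p : ℕ) : Prop :=
  θ ≠ 0 ∧ ∀ α : Module.Dual K V,
    θ (SymmetricAlgebra.ι K (Module.Dual K V) α) ∈
      (LinearMap.range (SymmetricAlgebra.ι K (Module.Dual K V))) ^ p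

/-- `A` is free and `exp A = E`: there is a homogeneous basis `θ_1, …, θ_r` of `D(A)`,
`r = dim V`, whose multiset of polynomial degrees is `E`. -/
def HasExponents (A : Arrangement K V) (E : Multiset ℕ) : Prop :=
  ∃ (θ : Module.Basis (Fin (Module.finrank K V)) (PolyRing K V) A.derivations)
    (d : Fin (Module.finrank K V) → ℕ),
    (∀ i, IsHomogeneousOfDegree (θ i : Der K V) (d i)) ∧
      E = Finset.univ.val.map d

/-- `A` and `B` are free and `exp A ⊂ exp B` (inclusion of multisets; the arrangements may live
in different vector spaces). -/
def ExpSubset {W : Type u} [AddCommGroup W] [Module K W]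
    (A : Arrangement K W) (B : Arrangement K V) : Prop :=
  ∃ E F : Multiset ℕ, A.HasExponents E ∧ B.HasExponents F ∧ E ≤ F

/-- The triple `(A, A \ {H}, A^H)` has compatible exponents: `exp A^H ⊂ exp A` or
`exp A^H ⊂ exp (A \ {H})`, the two arrangements concerned being free. -/
def CompatibleTriple (A : Arrangement K V) (H : Submodule K V) : Prop :=
  ExpSubset (A.restrict H) A ∨ ExpSubset (A.restrict H) (A.delete H)

/-! ### Intersection lattice and characteristic polynomial -/

open Classical in
/-- The set `L(A)` of all intersections of elements of `A`, including the empty one, `V`. -/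
noncomputable def lattice (A : Arrangement K V) : Finset (Submodule K V) :=
  A.planes.powerset.image (fun B => B.inf id)

theorem top_mem_lattice (A : Arrangement K V) : (⊤ : Submodule K V) ∈ A.lattice := by
  classical
  exact Finset.mem_image.2 ⟨∅, Finset.empty_mem_powerset _, Finset.inf_empty⟩

/-- `L(A)` as a poset, ordered by reverse inclusion; its least element is `V`. -/
abbrev LatticePoset (A : Arrangement K V) := {X // X ∈ A.lattice}ᵒᵈ

open Classical in
/-- The finite poset `L(A)` has finite intervals. -/
noncomputable instance (A : Arrangement K V) : LocallyFiniteOrder A.LatticePoset :=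
  Fintype.toLocallyFiniteOrder

open Classical in
/-- The Möbius function `X ↦ μ(V, X)` of `L(A)`. -/
noncomputable def moebius (A : Arrangement K V) (X : {X // X ∈ A.lattice}) : ℤ :=
  IncidenceAlgebra.mu ℤ (α := A.LatticePoset)
    (OrderDual.toDual ⟨⊤, A.top_mem_lattice⟩) (OrderDual.toDual X)

/-- The characteristic polynomial `χ_A(t) = ∑_{X ∈ L(A)} μ(V, X) t^{dim X}`. -/
noncomputable def charPoly (A : Arrangement K V) : Polynomial ℤ :=
  ∑ X ∈ A.lattice.attach,
    Polynomial.C (A.moebius X) * Polynomial.X ^ Module.finrank K X.1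

end Basic

/-- The class of recursively free arrangements over `K`: the smallest class of arrangements (in
finite-dimensional vector spaces) that contains the empty ones and is closed under the addition
and the deletion step. -/
inductive RecursivelyFree (K : Type v) [Field K] :
    ∀ (V : Type u) [AddCommGroup V] [Module K V], Arrangement K V → Prop
  | empty (V : Type u) [AddCommGroup V] [Module K V] [FiniteDimensional K V] :
      RecursivelyFree K V (Arrangement.empty K V)
  | addition (V : Type u) [AddCommGroup V] [Module K V] (A : Arrangement K V)
      (H : Submodule K V) (hH : H ∈ A.planes)
      (hrestrict : RecursivelyFree K H (A.restrict H))
      (hdelete : RecursivelyFree K V (A.delete H))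
      (hexp : ExpSubset (A.restrict H) (A.delete H)) :
      RecursivelyFree K V A
  | deletion (V : Type u) [AddCommGroup V] [Module K V] (A : Arrangement K V)
      (H : Submodule K V) (hH : H ∈ A.planes)
      (hrestrict : RecursivelyFree K H (A.restrict H))
      (hA : RecursivelyFree K V A)
      (hexp : ExpSubset (A.restrict H) A) :
      RecursivelyFree K V (A.delete H)

end Arrangement

/-! ### The arrangement of 27 planes -/

namespace H3

section Group

variable {K : Type v} [Field K]

/-- `ω = -ζ² - ζ³`. -/
def omega (ζ : K) : K := -ζ ^ 2 - ζ ^ 3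

/-- The matrix of the first generating reflection. -/
def m1 : Matrix (Fin 3) (Fin 3) K := !![1, 0, 0; 0, 1, 1; 0, 0, -1]

/-- The matrix of the second generating reflection. -/
def m2 (ζ : K) : Matrix (Fin 3) (Fin 3) K := !![-1, 0, 0; omega ζ, 1, 0; 0, 0, 1]

/-- The matrix of the third generating reflection. -/
def m3 (ζ : K) : Matrix (Fin 3) (Fin 3) K := !![1, omega ζ, 0; 0, -1, 0; 0, 1, 1]

theorem m1_mul_self : (m1 : Matrix (Fin 3) (Fin 3) K) * m1 = 1 := by
  ext i j
  fin_cases i <;> fin_cases j <;> simp [m1, Matrix.mul_apply, Fin.sum_univ_three]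

theorem m2_mul_self (ζ : K) : m2 ζ * m2 ζ = 1 := by
  ext i j
  fin_cases i <;> fin_cases j <;> simp [m2, Matrix.mul_apply, Fin.sum_univ_three]

theorem m3_mul_self (ζ : K) : m3 ζ * m3 ζ = 1 := by
  ext i j
  fin_cases i <;> fin_cases j <;> simp [m3, Matrix.mul_apply, Fin.sum_univ_three]

/-- The generator `g₁` as an invertible matrix. -/
def g1 : GL (Fin 3) K := ⟨m1, m1, m1_mul_self, m1_mul_self⟩

/-- The generator `g₂` as an invertible matrix. -/
def g2 (ζ : K) : GL (Fin 3) K := ⟨m2 ζ, m2 ζ, m2_mul_self ζ, m2_mul_self ζ⟩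

/-- The generator `g₃` as an invertible matrix. -/
def g3 (ζ : K) : GL (Fin 3) K := ⟨m3 ζ, m3 ζ, m3_mul_self ζ, m3_mul_self ζ⟩

/-- The Coxeter group `W` of type `H₃`. -/
def W (ζ : K) : Subgroup (GL (Fin 3) K) := Subgroup.closure {g1, g2 ζ, g3 ζ}

/-- The orbit `v · W` of a row vector `v ∈ V^* = K³`. -/
def orbit (ζ : K) (v : Fin 3 → K) : Set (Fin 3 → K) :=
  {w | ∃ g ∈ W ζ, w = Matrix.vecMul v (g : Matrix (Fin 3) (Fin 3) K)}

/-- The roots of `W`, the union of the orbits of the standard basis vectors. These are the positive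
roots and their negatives, so they have the same kernels as the positive roots. -/
def roots (ζ : K) : Set (Fin 3 → K) := {w | ∃ i : Fin 3, w ∈ orbit ζ (Pi.single i 1)}

/-- The plane `v^⊥`, the kernel of the linear form on `K³` with coefficient vector `v`. -/
def perp (v : Fin 3 → K) : Submodule K (Fin 3 → K) :=
  LinearMap.ker (dotProductEquiv K (Fin 3) v)

/-- The reflecting planes `v^⊥`, `v` a root. -/
def rootPlanes (ζ : K) : Set (Submodule K (Fin 3 → K)) := perp '' roots ζ

/-- The planes `v^⊥` with `v` in the orbit of `(1, -ζ², 0)`. -/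
def orbitPlanes (ζ : K) : Set (Submodule K (Fin 3 → K)) := perp '' orbit ζ ![1, -ζ ^ 2, 0]

end Group

end H3

/-! Freeness. In coordinates `(u, y, w)` adapted to an axis of order five, the icosahedral group
preserves the quadratic form `y² + uw` and Klein's invariants `inv2`, `inv6`, `inv10`. Fifteen of
the planes are mirrors; the other twelve are the planes tangent to the cone `y² + uw = 0` along its
twelve special lines. The gradients of `inv6` and `inv10` are tangent to every mirror, hence so is
any combination of them. On a tangent plane the invariants become `δ²`, `-δε⁵` and `ε¹⁰ - 128δ⁵ε⁵`,
so tangency to all twelve planes is one relation between the two coefficients; it has solutions of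
total degrees 11 and 15 (`Klein.vec11`, `Klein.vec15`). With the Euler field the degrees add up to
27 and the determinant is not zero, so Saito's criterion (`LogField.isHomBasis_of_det_ne_zero`)
gives a basis of the logarithmic fields.

Isolation. The last step of any construction of a nonempty recursively free arrangement is a
compatible triple with that arrangement on one side
(`Arrangement.RecursivelyFree.exists_compatibleTriple`). It is therefore enough to exclude
compatible triples, and this needs only the exponents of line arrangements in a plane: for `n > 0`
lines one exponent is at most 1, both are at most `max 1 (n - 1)`, and their sum is at least `n`
(`LogField.exponents_plane`).

If `H ∈ A`, then `A^H` has at most 11 lines. A compatible triple would give two independent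
logarithmic fields of `A \ {H}` of degree at most 10. Multiplied by the form of `H` they are
logarithmic for `A`, of degree at most 11, and they vanish on `H`. As the field of degree 11 is not
radial along `H`, both products are multiples of the Euler field, hence dependent
(`LogField.dependent_of_deletion`).

If `H ∉ A`, then `A` cuts `H` in at least 17 lines, so `A^H` has an exponent of at least 16, which
is not an exponent of `A`. If it were one of `A ∪ {H}`, the other two exponents would be at most 12,
and comparing coefficients of the field of degree 15 would make the field of degree 11 tangent to
`H` (`LogField.false_of_addition`). That is impossible: its restriction would be tangent to 17
lines, hence radial by degree (`LogField.not_X_two_dvd`).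

The combinatorial input is a table of the lines in which planes of `A` meet. The bound 17 says that
for a plane outside `A` the excess multiplicities of the lines it contains add up to at most 10;
this is tested modulo a prime of norm 31, where incidences can only increase
(`H3.sum_weight_linesIn_le`). The same table gives the Möbius function and the characteristic
polynomial. -/

/-! ### Exact arithmetic in `ℤ[ζ]`, so that finite checks can be decided -/

/-- The ring `ℤ[ζ]`, `ζ` a primitive fifth root of unity, in the basis `1, ζ, ζ², ζ³`. -/
@[ext]
structure Cyc where
  c0 : ℤ
  c1 : ℤ
  c2 : ℤ
  c3 : ℤ

namespace Cyc

instance : DecidableEq Cyc := fun _ _ => decidable_of_iff _ Cyc.ext_iff.symm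

instance : Zero Cyc := ⟨⟨0, 0, 0, 0⟩⟩
instance : One Cyc := ⟨⟨1, 0, 0, 0⟩⟩
instance : Add Cyc := ⟨fun x y => ⟨x.c0 + y.c0, x.c1 + y.c1, x.c2 + y.c2, x.c3 + y.c3⟩⟩
instance : Neg Cyc := ⟨fun x => ⟨-x.c0, -x.c1, -x.c2, -x.c3⟩⟩
-- `s4` is the coefficient of `ζ⁴ = -1 - ζ - ζ² - ζ³`; the powers `ζ⁵` and `ζ⁶` are replaced by `1`
-- and `ζ`.
instance : Mul Cyc := ⟨fun x y =>
  let s4 := x.c1 * y.c3 + x.c2 * y.c2 + x.c3 * y.c1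
  ⟨x.c0 * y.c0 + (x.c2 * y.c3 + x.c3 * y.c2) - s4,
   x.c0 * y.c1 + x.c1 * y.c0 + x.c3 * y.c3 - s4,
   x.c0 * y.c2 + x.c1 * y.c1 + x.c2 * y.c0 - s4,
   x.c0 * y.c3 + x.c1 * y.c2 + x.c2 * y.c1 + x.c3 * y.c0 - s4⟩⟩

theorem zero_def : (0 : Cyc) = ⟨0, 0, 0, 0⟩ := rfl
theorem one_def : (1 : Cyc) = ⟨1, 0, 0, 0⟩ := rfl
theorem add_def (x y : Cyc) :
    x + y = ⟨x.c0 + y.c0, x.c1 + y.c1, x.c2 + y.c2, x.c3 + y.c3⟩ := rfl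
theorem neg_def (x : Cyc) : -x = ⟨-x.c0, -x.c1, -x.c2, -x.c3⟩ := rfl
theorem mul_def (x y : Cyc) : x * y =
    ⟨x.c0 * y.c0 + (x.c2 * y.c3 + x.c3 * y.c2) - (x.c1 * y.c3 + x.c2 * y.c2 + x.c3 * y.c1),
     x.c0 * y.c1 + x.c1 * y.c0 + x.c3 * y.c3 - (x.c1 * y.c3 + x.c2 * y.c2 + x.c3 * y.c1),
     x.c0 * y.c2 + x.c1 * y.c1 + x.c2 * y.c0 - (x.c1 * y.c3 + x.c2 * y.c2 + x.c3 * y.c1),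
     x.c0 * y.c3 + x.c1 * y.c2 + x.c2 * y.c1 + x.c3 * y.c0 -
      (x.c1 * y.c3 + x.c2 * y.c2 + x.c3 * y.c1)⟩ := rfl

instance : CommRing Cyc where
  add_assoc x y z := by simp only [add_def, add_assoc]
  zero_add x := by simp [add_def, zero_def]
  add_zero x := by simp [add_def, zero_def]
  add_comm x y := by simp only [add_def, add_comm]
  mul_assoc x y z := by ext <;> simp only [mul_def] <;> ring
  one_mul x := by ext <;> simp [mul_def, one_def]
  mul_one x := by ext <;> simp [mul_def, one_def]
  mul_comm x y := by ext <;> simp only [mul_def] <;> ring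
  left_distrib x y z := by ext <;> simp only [mul_def, add_def] <;> ring
  right_distrib x y z := by ext <;> simp only [mul_def, add_def] <;> ring
  zero_mul x := by ext <;> simp [mul_def, zero_def]
  mul_zero x := by ext <;> simp [mul_def, zero_def]
  neg_add_cancel x := by ext <;> simp [neg_def, add_def, zero_def]
  nsmul := nsmulRec
  zsmul := zsmulRec

/-- Evaluation of an element of `ℤ[ζ]` at a root of the fifth cyclotomic polynomial. -/
def eval {R : Type*} [CommRing R] (z : R) (hz : z ^ 4 + z ^ 3 + z ^ 2 + z + 1 = 0) :
    Cyc →+* R where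
  toFun x := x.c0 + x.c1 * z + x.c2 * z ^ 2 + x.c3 * z ^ 3
  map_one' := by simp [one_def]
  map_zero' := by simp [zero_def]
  map_add' x y := by simp only [add_def]; push_cast; ring
  map_mul' x y := by
    simp only [mul_def]
    push_cast
    -- The multipliers are the quotients by the cyclotomic polynomial of the differences used in
    -- reducing `z⁴`, `z⁵ - 1` and `z⁶ - z`.
    linear_combination (-(x.c1 * y.c3 + x.c2 * y.c2 + x.c3 * y.c1 : R)
      - (x.c2 * y.c3 + x.c3 * y.c2 : R) * (z - 1) - (x.c3 * y.c3 : R) * (z ^ 2 - z)) * hz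

theorem eval_apply {R : Type*} [CommRing R] (z : R) (hz : z ^ 4 + z ^ 3 + z ^ 2 + z + 1 = 0)
    (x : Cyc) : eval z hz x = x.c0 + x.c1 * z + x.c2 * z ^ 2 + x.c3 * z ^ 3 := rfl

end Cyc

theorem IsPrimitiveRoot.sum_pow_five {K : Type*} [Field K] {ζ : K} (hζ : IsPrimitiveRoot ζ 5) :
    ζ ^ 4 + ζ ^ 3 + ζ ^ 2 + ζ + 1 = 0 := by
  have h := hζ.geom_sum_eq_zero (by norm_num)
  simp only [Finset.sum_range_succ, Finset.sum_range_zero] at h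
  linear_combination h

namespace Cyc

variable {K : Type*} [Field K] [CharZero K] {ζ : K}

/-- A relation would be a rational polynomial of degree at most 3 vanishing at `ζ`, whose minimal
polynomial has degree 4. This transfers inequalities decided in `Cyc` to every field `K`. -/
theorem eval_injective (hζ : IsPrimitiveRoot ζ 5) :
    Function.Injective (eval ζ hζ.sum_pow_five) := by
  rw [injective_iff_map_eq_zero]
  intro x hx
  rw [eval_apply] at hx
  open Polynomial in
  set p : ℚ[X] := C (x.c0 : ℚ) + C (x.c1 : ℚ) * X + C (x.c2 : ℚ) * X ^ 2 + C (x.c3 : ℚ) * X ^ 3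
    with hp
  have hev : Polynomial.aeval ζ p = 0 := by
    simp only [hp, map_add, map_mul, Polynomial.aeval_C, Polynomial.aeval_X, map_pow]
    simpa using hx
  have hdeg : p.natDegree ≤ 3 := by rw [hp]; compute_degree
  have hmin : (minpoly ℚ ζ).natDegree = 4 := by
    rw [← Polynomial.cyclotomic_eq_minpoly_rat hζ (by norm_num), Polynomial.natDegree_cyclotomic]
    decide
  have hp0 : p = 0 := by
    by_contra h0
    have := Polynomial.natDegree_le_of_dvd (minpoly.dvd ℚ ζ hev) h0
    omega
  have h (i : ℕ) : p.coeff i = 0 := by rw [hp0]; simp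
  have h0 := h 0; have h1 := h 1; have h2 := h 2; have h3 := h 3
  simp only [hp, Polynomial.coeff_add, Polynomial.coeff_C_mul, Polynomial.coeff_C,
    Polynomial.coeff_X, Polynomial.coeff_X_pow] at h0 h1 h2 h3
  norm_num at h0 h1 h2 h3
  ext <;> assumption

end Cyc

/-! ### Linear forms, logarithmic vector fields and Saito's criterion -/

open MvPolynomial in
/-- The linear form with coefficient vector `a`. -/
noncomputable def linForm {K σ : Type*} [Field K] [Fintype σ] (a : σ → K) : MvPolynomial σ K :=
  ∑ j, C (a j) * X j

namespace LogField

open MvPolynomial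

variable {K σ : Type*} [Field K] [Fintype σ]

/-- The value `∑ a_j q_j` of the vector field `q` on the linear form with coefficients `a`. -/
noncomputable def app (a : σ → K) (q : σ → MvPolynomial σ K) : MvPolynomial σ K :=
  ∑ j, C (a j) * q j

theorem app_X (a : σ → K) : app a X = linForm a := rfl

theorem app_sub (a : σ → K) (q r : σ → MvPolynomial σ K) : app a (q - r) = app a q - app a r := by
  simp [app, mul_sub, Finset.sum_sub_distrib]

theorem app_smul (a : σ → K) (c : MvPolynomial σ K) (q : σ → MvPolynomial σ K) :
    app a (c • q) = c * app a q := by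
  simp [app, Finset.mul_sum, mul_left_comm]

theorem app_homogeneous {a : σ → K} {q : σ → MvPolynomial σ K} {n : ℕ}
    (h : ∀ j, (q j).IsHomogeneous n) : (app a q).IsHomogeneous n :=
  IsHomogeneous.sum _ _ _ fun j _ => (h j).C_mul _

theorem linForm_homogeneous (a : σ → K) : (linForm a).IsHomogeneous 1 :=
  app_homogeneous fun _ => isHomogeneous_X _ _

theorem eval_app (x a : σ → K) (q : σ → MvPolynomial σ K) :
    eval x (app a q) = ∑ j, a j * eval x (q j) := by simp [app]

theorem eval_linForm (x a : σ → K) : eval x (linForm a) = a ⬝ᵥ x := by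
  simp [linForm, dotProduct]

/-- Projection along `v` to the zero set of `linForm a`. -/
noncomputable def proj (a v : σ → K) : MvPolynomial σ K →ₐ[K] MvPolynomial σ K :=
  aeval fun j => X j - C (v j) * linForm a

theorem linForm_dvd_sub_proj (a v : σ → K) (p : MvPolynomial σ K) :
    linForm a ∣ p - proj a v p := by
  rw [← Ideal.mem_span_singleton, ← Ideal.Quotient.eq]
  have : (Ideal.Quotient.mkₐ K (Ideal.span {linForm a})).comp (proj a v) =
      Ideal.Quotient.mkₐ K (Ideal.span {linForm a}) := by
    ext j
    simp only [AlgHom.comp_apply, proj, aeval_X, Ideal.Quotient.mkₐ_eq_mk]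
    rw [Ideal.Quotient.eq, Ideal.mem_span_singleton]
    exact ⟨-C (v j), by ring⟩
  exact (DFunLike.congr_fun this p).symm

theorem proj_linForm {a v : σ → K} (h : a ⬝ᵥ v = 1) : proj a v (linForm a) = 0 := by
  have : ∑ j, C (a j) * (C (v j) * linForm a) = (C (a ⬝ᵥ v) * linForm a : MvPolynomial σ K) := by
    simp [dotProduct, Finset.sum_mul, mul_assoc]
  conv_lhs => rw [linForm]
  simp only [proj, map_sum, map_mul, aeval_X, algHom_C, algebraMap_eq, mul_sub,
    Finset.sum_sub_distrib]
  rw [this, h, C_1, one_mul, linForm, sub_self]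

/-- The projection is the identity modulo the form and kills it, so divisibility by the form becomes
membership in the kernel of a map to a domain. Primality of linear forms follows. -/
theorem linForm_dvd_iff_proj {a v : σ → K} (h : a ⬝ᵥ v = 1) {p : MvPolynomial σ K} :
    linForm a ∣ p ↔ proj a v p = 0 := by
  constructor
  · rintro ⟨c, rfl⟩
    rw [map_mul, proj_linForm h, zero_mul]
  · intro h0
    simpa [h0] using linForm_dvd_sub_proj a v p

theorem exists_dotProduct_eq_one {a : σ → K} (ha : a ≠ 0) : ∃ v, a ⬝ᵥ v = 1 := by
  classical
  obtain ⟨k, hk⟩ := Function.ne_iff.1 ha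
  exact ⟨Pi.single k (a k)⁻¹, by simpa using mul_inv_cancel₀ hk⟩

/-- The projected polynomial takes at `x` the value of `p` at `x - (a ⬝ᵥ x) • v`, a point of the
hyperplane; over an infinite field it is zero once all these values are. -/
theorem linForm_dvd_iff_eval [Infinite K] {a : σ → K} (ha : a ≠ 0) {p : MvPolynomial σ K} :
    linForm a ∣ p ↔ ∀ x, a ⬝ᵥ x = 0 → eval x p = 0 := by
  constructor
  · rintro ⟨c, rfl⟩ x hx
    rw [map_mul, eval_linForm, hx, zero_mul]
  · intro h
    obtain ⟨v, hv⟩ := exists_dotProduct_eq_one ha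
    rw [linForm_dvd_iff_proj hv]
    refine MvPolynomial.funext fun x => ?_
    have h1 : eval x (proj a v p) = eval (x - (a ⬝ᵥ x) • v) p := by
      have : (aeval x).comp (proj a v) = aeval (R := K) (x - (a ⬝ᵥ x) • v) := by
        ext j
        simp [proj, ← eval_linForm, aeval_eq_eval, mul_comm]
      simpa [aeval_eq_eval] using DFunLike.congr_fun this p
    rw [h1, h, map_zero]
    rw [dotProduct_sub, dotProduct_smul, hv, smul_eq_mul, mul_one, sub_self]

theorem linForm_ne_zero {a : σ → K} (ha : a ≠ 0) : linForm a ≠ 0 := by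
  obtain ⟨v, hv⟩ := exists_dotProduct_eq_one ha
  intro h
  have := congrArg (eval v) h
  rw [eval_linForm, hv] at this
  simp at this

theorem not_isUnit_of_homogeneous {σ : Type*} {p : MvPolynomial σ K} {n : ℕ} (h : p.IsHomogeneous n)
    (hn : n ≠ 0) : ¬ IsUnit p := by
  intro hu
  have h1 := hu.map (constantCoeff (R := K) (σ := σ))
  rw [constantCoeff_eq, h.coeff_eq_zero (by simpa using hn.symm)] at h1
  simp at h1

theorem linForm_prime {a : σ → K} (ha : a ≠ 0) : Prime (linForm a) := by
  obtain ⟨v, hv⟩ := exists_dotProduct_eq_one ha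
  refine ⟨linForm_ne_zero ha, not_isUnit_of_homogeneous (linForm_homogeneous a) one_ne_zero, ?_⟩
  intro p q h
  rw [linForm_dvd_iff_proj hv, map_mul, mul_eq_zero] at h
  simpa only [linForm_dvd_iff_proj hv] using h

theorem prod_linForm_dvd {κ : Type*} [Fintype κ] {a : κ → σ → K} (ha : ∀ i, a i ≠ 0)
    (hne : ∀ i j, i ≠ j → ¬ linForm (a i) ∣ linForm (a j)) {p : MvPolynomial σ K}
    (h : ∀ i, linForm (a i) ∣ p) : ∏ i, linForm (a i) ∣ p := by
  refine Fintype.prod_dvd_of_isRelPrime (fun i j hij => ?_) h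
  exact (linForm_prime (ha i)).irreducible.isRelPrime_iff_not_dvd.2 (hne i j hij)

theorem prod_linForm_homogeneous {κ : Type*} [Fintype κ] (a : κ → σ → K) :
    (∏ i, linForm (a i)).IsHomogeneous (Fintype.card κ) := by
  simpa using IsHomogeneous.prod Finset.univ (fun i => linForm (a i)) (fun _ => 1)
    fun i _ => linForm_homogeneous (a i)

theorem prod_linForm_ne_zero {κ : Type*} [Fintype κ] {a : κ → σ → K} (ha : ∀ i, a i ≠ 0) :
    ∏ i, linForm (a i) ≠ 0 :=
  Finset.prod_ne_zero_iff.2 fun i _ => linForm_ne_zero (ha i)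

/-- A nonzero homogeneous polynomial that is divisible by pairwise independent linear forms has at
least their number as degree; in case of equality it is a multiple of their product. -/
theorem card_le_of_linForm_dvd {κ : Type*} [Fintype κ] {a : κ → σ → K} (ha : ∀ i, a i ≠ 0)
    (hne : ∀ i j, i ≠ j → ¬ linForm (a i) ∣ linForm (a j)) {p : MvPolynomial σ K} {n : ℕ}
    (hp : p ≠ 0) (hn : p.IsHomogeneous n) (h : ∀ i, linForm (a i) ∣ p) : Fintype.card κ ≤ n := by
  obtain ⟨c, rfl⟩ := prod_linForm_dvd ha hne h
  have hQ := prod_linForm_ne_zero ha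
  have hc := right_ne_zero_of_mul hp
  have := totalDegree_mul_of_isDomain hQ hc
  rw [hn.totalDegree hp, (prod_linForm_homogeneous a).totalDegree hQ] at this
  omega

theorem exists_C_mul_prod {κ : Type*} [Fintype κ] {a : κ → σ → K} (ha : ∀ i, a i ≠ 0)
    (hne : ∀ i j, i ≠ j → ¬ linForm (a i) ∣ linForm (a j)) {p : MvPolynomial σ K}
    (hp : p ≠ 0) (hn : p.IsHomogeneous (Fintype.card κ)) (h : ∀ i, linForm (a i) ∣ p) :
    ∃ k : K, k ≠ 0 ∧ p = C k * ∏ i, linForm (a i) := by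
  obtain ⟨c, rfl⟩ := prod_linForm_dvd ha hne h
  have hQ := prod_linForm_ne_zero ha
  have hc := right_ne_zero_of_mul hp
  have := totalDegree_mul_of_isDomain hQ hc
  rw [hn.totalDegree hp, (prod_linForm_homogeneous a).totalDegree hQ] at this
  obtain ⟨k, rfl⟩ : ∃ k, c = C k := ⟨_, totalDegree_eq_zero_iff_eq_C.1 (by omega)⟩
  exact ⟨k, fun h0 => hc (by rw [h0, C_0]), mul_comm _ _⟩

/-- The vector field `q` is logarithmic along the zero sets of the forms in `F`. -/
def IsLog (F : Set (σ → K)) (q : σ → MvPolynomial σ K) : Prop :=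
  ∀ a ∈ F, linForm a ∣ app a q

theorem IsLog.mono {F G : Set (σ → K)} (h : F ⊆ G) {q : σ → MvPolynomial σ K} (hq : IsLog G q) :
    IsLog F q := fun a ha => hq a (h ha)

theorem isLog_X (F : Set (σ → K)) : IsLog F X := fun a _ => by rw [app_X]

theorem IsLog.smul {F : Set (σ → K)} {q : σ → MvPolynomial σ K} (hq : IsLog F q)
    (c : MvPolynomial σ K) : IsLog F (c • q) := fun a ha => by
  rw [app_smul]; exact (hq a ha).mul_left c

theorem IsLog.sub {F : Set (σ → K)} {q r : σ → MvPolynomial σ K} (hq : IsLog F q)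
    (hr : IsLog F r) : IsLog F (q - r) := fun a ha => by
  rw [app_sub]; exact dvd_sub (hq a ha) (hr a ha)

/-- The matrix sends the constant vector `a` to a multiple of the form. Applying the adjugate shows
that the form divides `P.det` times each coordinate of `a`, and one coordinate is a unit. -/
theorem linForm_dvd_det [DecidableEq σ] {P : Matrix σ σ (MvPolynomial σ K)} {a : σ → K}
    (ha : a ≠ 0) (h : ∀ i, linForm a ∣ app a (P i)) : linForm a ∣ P.det := by
  obtain ⟨k, hk⟩ := Function.ne_iff.1 ha
  choose g hg using h
  have h1 : P.mulVec (fun j => C (a j)) = linForm a • g := by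
    ext1 i
    rw [Pi.smul_apply, smul_eq_mul, ← hg i]
    simp [Matrix.mulVec, dotProduct, app, mul_comm]
  have h2 : P.det • (fun j => (C (a j) : MvPolynomial σ K)) =
      linForm a • (P.adjugate.mulVec g) := by
    rw [← Matrix.mulVec_smul, ← h1, Matrix.mulVec_mulVec, Matrix.adjugate_mul, Matrix.smul_mulVec,
      Matrix.one_mulVec]
  have h3 := congrFun h2 k
  simp only [Pi.smul_apply, smul_eq_mul] at h3
  have h4 : P.det = P.det * C (a k) * C (a k)⁻¹ := by
    rw [mul_assoc, ← C_mul, mul_inv_cancel₀ hk, C_1, mul_one]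
  rw [h4, h3, mul_assoc]
  exact dvd_mul_right _ _

theorem det_homogeneous [DecidableEq σ] {P : Matrix σ σ (MvPolynomial σ K)} {d : σ → ℕ}
    (h : ∀ i j, (P i j).IsHomogeneous (d i)) : P.det.IsHomogeneous (∑ i, d i) := by
  rw [← Matrix.det_transpose, Matrix.det_apply]
  refine IsHomogeneous.sum _ _ _ fun τ _ => ?_
  have : (∏ i, P.transpose (τ i) i).IsHomogeneous (∑ i, d i) :=
    IsHomogeneous.prod _ _ _ fun i _ => h i (τ i)
  rcases Int.units_eq_one_or (Equiv.Perm.sign τ) with h1 | h1 <;> rw [h1]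
  · simpa using this
  · simpa using this.neg

/-- A homogeneous basis of the module of logarithmic vector fields. -/
structure IsHomBasis {I : Type*} [Fintype I] (F : Set (σ → K)) (p : I → σ → MvPolynomial σ K)
    (d : I → ℕ) : Prop where
  log : ∀ i, IsLog F (p i)
  hom : ∀ i j, (p i j).IsHomogeneous (d i)
  indep : LinearIndependent (MvPolynomial σ K) p
  span : ∀ q, IsLog F q → ∃ c : I → MvPolynomial σ K, q = ∑ i, c i • p i

theorem IsHomBasis.reindex {I J : Type*} [Fintype I] [Fintype J] {F : Set (σ → K)}
    {p : I → σ → MvPolynomial σ K} {d : I → ℕ} (h : IsHomBasis F p d) (e : J ≃ I) :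
    IsHomBasis F (p ∘ e) (d ∘ e) where
  log i := h.log _
  hom i := h.hom _
  indep := h.indep.comp e e.injective
  span q hq := by
    obtain ⟨c, rfl⟩ := h.span q hq
    exact ⟨c ∘ e, (e.sum_comp fun i => c i • p i).symm⟩

/-- Used to replace the coefficients of an expansion in a homogeneous basis by their components of
the right degree. -/
theorem homogeneousComponent_mul_of_homogeneous {p : MvPolynomial σ K} {d : ℕ}
    (hp : p.IsHomogeneous d) (c : MvPolynomial σ K) (m : ℕ) :
    homogeneousComponent m (c * p) =
      if d ≤ m then homogeneousComponent (m - d) c * p else 0 := by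
  have h1 : c * p = ∑ i ∈ Finset.range (c.totalDegree + 1), homogeneousComponent i c * p := by
    rw [← Finset.sum_mul, sum_homogeneousComponent]
  have h2 (i : ℕ) : homogeneousComponent m (homogeneousComponent i c * p) =
      if i + d = m then homogeneousComponent i c * p else 0 := by
    have := homogeneousComponent_of_mem (m := m)
      (((homogeneousComponent_isHomogeneous i c).mul hp : _ ∈ homogeneousSubmodule σ K (i + d)))
    rw [this]
    exact if_congr eq_comm rfl rfl
  rw [h1, map_sum]
  simp only [h2]
  split_ifs with hd
  · rw [Finset.sum_eq_single (m - d)]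
    · rw [if_pos (by omega)]
    · intro i _ hi
      rw [if_neg (by omega)]
    · intro hi
      rw [homogeneousComponent_eq_zero, zero_mul, ite_self]
      have := Finset.mem_range.not.1 hi
      omega
  · exact Finset.sum_eq_zero fun i _ => if_neg (by omega)

/-- A homogeneous logarithmic vector field is a combination with homogeneous coefficients of the
basis elements of at most its degree. -/
theorem IsHomBasis.exists_homogeneous {I : Type*} [Fintype I] {F : Set (σ → K)}
    {p : I → σ → MvPolynomial σ K} {d : I → ℕ} (h : IsHomBasis F p d) {q : σ → MvPolynomial σ K}
    (hq : IsLog F q) {m : ℕ} (hm : ∀ j, (q j).IsHomogeneous m) :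
    ∃ c : I → MvPolynomial σ K, q = ∑ i, c i • p i ∧
      (∀ i, (c i).IsHomogeneous (m - d i)) ∧ ∀ i, m < d i → c i = 0 := by
  obtain ⟨c, hc⟩ := h.span q hq
  refine ⟨fun i => if d i ≤ m then homogeneousComponent (m - d i) (c i) else 0, ?_, ?_, ?_⟩
  · funext j
    have h1 : q j = homogeneousComponent m (q j) := by
      rw [homogeneousComponent_of_mem (m := m) (hm j), if_pos rfl]
    rw [h1, hc]
    simp only [Finset.sum_apply, Pi.smul_apply, smul_eq_mul, map_sum]
    refine Finset.sum_congr rfl fun i _ => ?_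
    rw [homogeneousComponent_mul_of_homogeneous (h.hom i j)]
    split_ifs <;> simp
  · intro i
    dsimp only
    split_ifs
    · exact homogeneousComponent_isHomogeneous _ _
    · exact isHomogeneous_zero _ _ _
  · intro i hi
    exact if_neg (by omega)

/-- Saito's criterion. -/
theorem isHomBasis_of_det_ne_zero [DecidableEq σ] {κ : Type*} [Fintype κ] {a : κ → σ → K}
    (ha : ∀ i, a i ≠ 0) (hne : ∀ i j, i ≠ j → ¬ linForm (a i) ∣ linForm (a j)) {F : Set (σ → K)}
    (haF : ∀ i, a i ∈ F) {p : Matrix σ σ (MvPolynomial σ K)} {d : σ → ℕ}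
    (hlog : ∀ i, IsLog F (p i)) (hom : ∀ i j, (p i j).IsHomogeneous (d i))
    (hdet : p.det ≠ 0) (hd : ∑ i, d i = Fintype.card κ) : IsHomBasis F p d where
  log := hlog
  hom := hom
  indep := Matrix.linearIndependent_rows_of_det_ne_zero hdet
  span q hq := by
    -- The degrees add up to the number of forms, so the determinant is a nonzero constant times
    -- their product.
    obtain ⟨k, hk, hdetk⟩ := exists_C_mul_prod ha hne hdet (hd ▸ det_homogeneous hom)
      fun i => linForm_dvd_det (ha i) fun j => hlog j _ (haF i)
    -- The numerators in Cramer's rule are determinants of logarithmic fields too, hence divisible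
    -- by the product of the forms; the quotients are the coefficients of `q`.
    have h1 (i : σ) : p.det ∣ (p.updateRow i q).det := by
      have : ∏ i, linForm (a i) ∣ (p.updateRow i q).det := by
        refine prod_linForm_dvd ha hne fun l => linForm_dvd_det (ha l) fun j => ?_
        by_cases hij : j = i
        · subst hij; rw [Matrix.updateRow_self]; exact hq _ (haF l)
        · rw [Matrix.updateRow_ne hij]; exact hlog j _ (haF l)
      rw [hdetk]
      exact (IsUnit.mul_left_dvd ((isUnit_iff_ne_zero.2 hk).map C)).2 this
    choose c hc using h1
    refine ⟨c, ?_⟩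
    have h2 : p.transpose.mulVec (p.transpose.cramer q) = p.transpose.det • q :=
      Matrix.mulVec_cramer _ _
    have h3 : p.transpose.cramer q = p.det • c := by
      ext1 i
      rw [Matrix.cramer_apply, Matrix.updateCol_transpose, Matrix.det_transpose, hc]
      rfl
    rw [h3, Matrix.mulVec_smul, Matrix.det_transpose] at h2
    have h4 := smul_right_injective (σ → MvPolynomial σ K) hdet h2
    rw [← h4]
    funext j
    simp [Matrix.mulVec, dotProduct, mul_comm]

end LogField

/-! ### Derivations of the symmetric algebra in coordinates -/

open MvPolynomial in
theorem MvPolynomial.map_range_eq_homogeneousSubmodule_one {K σ M : Type*} [Field K] [Fintype σ]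
    [AddCommGroup M] [Module K M] (f : M →ₗ[K] MvPolynomial σ K)
    (h1 : ∀ x, (f x).IsHomogeneous 1) (h2 : ∀ i, ∃ x, f x = X i) :
    LinearMap.range f = homogeneousSubmodule σ K 1 := by
  apply le_antisymm
  · rintro _ ⟨x, rfl⟩
    exact h1 x
  · rw [homogeneousSubmodule_one_eq_span_X, Submodule.span_le]
    rintro _ ⟨i, rfl⟩
    exact h2 i

/-- If the kernel of a nonzero form is contained in that of another one, they are proportional. -/
theorem Module.Dual.exists_smul_of_ker_le {K V : Type*} [Field K] [AddCommGroup V] [Module K V]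
    {α β : Module.Dual K V} (hα : α ≠ 0) (h : LinearMap.ker α ≤ LinearMap.ker β) :
    ∃ c : K, β = c • α := by
  obtain ⟨v, hv⟩ : ∃ v, α v ≠ 0 := by
    by_contra! h0
    exact hα (LinearMap.ext h0)
  refine ⟨β v / α v, LinearMap.ext fun x => ?_⟩
  have h1 : x - (α x / α v) • v ∈ LinearMap.ker β := h (by simp [hv])
  simp only [LinearMap.mem_ker, map_sub, map_smul, smul_eq_mul, sub_eq_zero] at h1
  rw [h1, LinearMap.smul_apply, smul_eq_mul]
  ring

theorem Module.Dual.ker_eq_of_ker_le {K V : Type*} [Field K] [AddCommGroup V] [Module K V]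
    {α β : Module.Dual K V} (hα : α ≠ 0) (hβ : β ≠ 0)
    (h : LinearMap.ker α ≤ LinearMap.ker β) : LinearMap.ker α = LinearMap.ker β := by
  obtain ⟨c, rfl⟩ := Module.Dual.exists_smul_of_ker_le hα h
  rw [LinearMap.ker_smul _ _ fun hc => hβ (by rw [hc, zero_smul])]

theorem SymmetricAlgebra.ker_le_of_ι_dvd {K V : Type*} [Field K] [AddCommGroup V] [Module K V]
    {α β : Module.Dual K V}
    (h : SymmetricAlgebra.ι K (Module.Dual K V) α ∣ SymmetricAlgebra.ι K (Module.Dual K V) β) :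
    LinearMap.ker α ≤ LinearMap.ker β := by
  intro x hx
  have h1 := map_dvd (SymmetricAlgebra.lift (Module.Dual.eval K V x)) h
  rw [SymmetricAlgebra.lift_ι_apply, SymmetricAlgebra.lift_ι_apply, Module.Dual.eval_apply,
    Module.Dual.eval_apply, LinearMap.mem_ker.1 hx, zero_dvd_iff] at h1
  exact h1

theorem Derivation.prod_dvd {R S ι : Type*} [CommRing R] [CommRing S] [Algebra R S]
    (θ : Derivation R S S) (s : Finset ι) (f : ι → S) (h : ∀ i ∈ s, f i ∣ θ (f i)) :
    ∏ i ∈ s, f i ∣ θ (∏ i ∈ s, f i) := by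
  classical
  induction s using Finset.induction_on with
  | empty => simp
  | insert i s hi ih =>
    rw [Finset.prod_insert hi, Derivation.leibniz, smul_eq_mul, smul_eq_mul]
    refine dvd_add (mul_dvd_mul_left _ (ih fun j hj => h j (Finset.mem_insert_of_mem hj))) ?_
    rw [mul_comm]
    exact mul_dvd_mul_left _ (h i (Finset.mem_insert_self i s))

namespace Arrangement

open MvPolynomial LogField

universe u' v' w'

variable {K : Type v'} {V : Type u'} [Field K] [AddCommGroup V] [Module K V]
  {σ : Type w'} [Fintype σ] [DecidableEq σ]

/-- The coefficients of a linear form with respect to a basis. -/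
noncomputable def coeffs (b : Module.Basis σ K V) (α : Module.Dual K V) : σ → K := fun j => α (b j)

theorem coeffs_ne_zero (b : Module.Basis σ K V) {α : Module.Dual K V} (h : α ≠ 0) :
    coeffs b α ≠ 0 := fun h0 => h (b.ext fun j => congrFun h0 j)

/-- The coefficient vectors of all the linear forms that define planes of an arrangement. -/
def formSet (A : Arrangement K V) (b : Module.Basis σ K V) : Set (σ → K) :=
  {a | ∃ α : Module.Dual K V, α ≠ 0 ∧ LinearMap.ker α ∈ A.planes ∧ a = coeffs b α}

/-- Polynomial functions in coordinates. -/
noncomputable def polyEquiv (b : Module.Basis σ K V) : PolyRing K V ≃ₐ[K] MvPolynomial σ K :=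
  SymmetricAlgebra.equivMvPolynomial b.dualBasis

theorem polyEquiv_ι_coord (b : Module.Basis σ K V) (j : σ) :
    polyEquiv b (SymmetricAlgebra.ι K _ (b.coord j)) = X j := by
  rw [← b.coe_dualBasis]
  exact SymmetricAlgebra.equivMvPolynomial_ι_apply _ _

theorem eq_sum_coord (b : Module.Basis σ K V) (α : Module.Dual K V) :
    α = ∑ j, coeffs b α j • b.coord j := (b.sum_dual_apply_smul_coord α).symm

theorem polyEquiv_ι (b : Module.Basis σ K V) (α : Module.Dual K V) :
    polyEquiv b (SymmetricAlgebra.ι K _ α) = linForm (coeffs b α) := by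
  conv_lhs => rw [eq_sum_coord b α]
  simp [polyEquiv_ι_coord, linForm, smul_eq_C_mul]

theorem ι_prime (b : Module.Basis σ K V) {α : Module.Dual K V} (h : α ≠ 0) :
    Prime (SymmetricAlgebra.ι K (Module.Dual K V) α) := by
  rw [← MulEquiv.prime_iff (polyEquiv b)]
  change Prime (polyEquiv b _)
  rw [polyEquiv_ι]
  exact linForm_prime (coeffs_ne_zero b h)

/-- A derivation in coordinates. -/
noncomputable def toVec (b : Module.Basis σ K V) (θ : Der K V) : σ → MvPolynomial σ K :=
  fun j => polyEquiv b (θ (SymmetricAlgebra.ι K _ (b.coord j)))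

theorem app_toVec (b : Module.Basis σ K V) (θ : Der K V) (α : Module.Dual K V) :
    app (coeffs b α) (toVec b θ) = polyEquiv b (θ (SymmetricAlgebra.ι K _ α)) := by
  conv_rhs => rw [eq_sum_coord b α]
  simp [app, toVec, smul_eq_C_mul]

theorem toVec_add (b : Module.Basis σ K V) (θ η : Der K V) :
    toVec b (θ + η) = toVec b θ + toVec b η := by
  funext j; simp [toVec]

theorem toVec_zero (b : Module.Basis σ K V) : toVec b (0 : Der K V) = 0 := by
  funext j; simp [toVec]

theorem toVec_smul (b : Module.Basis σ K V) (c : PolyRing K V) (θ : Der K V) :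
    toVec b (c • θ) = polyEquiv b c • toVec b θ := by
  funext j; simp [toVec]

theorem toVec_sum (b : Module.Basis σ K V) {I : Type*} (s : Finset I) (θ : I → Der K V) :
    toVec b (∑ i ∈ s, θ i) = ∑ i ∈ s, toVec b (θ i) := by
  classical
  induction s using Finset.induction_on with
  | empty => simp [toVec_zero]
  | insert i s hi ih => rw [Finset.sum_insert hi, Finset.sum_insert hi, toVec_add, ih]

/-- The derivation with given coordinates. -/
noncomputable def ofVec (b : Module.Basis σ K V) (q : σ → MvPolynomial σ K) : Der K V where
  toFun s := (polyEquiv b).symm (mkDerivation K q (polyEquiv b s))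
  map_add' s t := by simp
  map_smul' c s := by simp
  map_one_eq_zero' := by simp
  leibniz' s t := by simp

theorem ofVec_apply (b : Module.Basis σ K V) (q : σ → MvPolynomial σ K) (s : PolyRing K V) :
    ofVec b q s = (polyEquiv b).symm (mkDerivation K q (polyEquiv b s)) := rfl

theorem toVec_ofVec (b : Module.Basis σ K V) (q : σ → MvPolynomial σ K) :
    toVec b (ofVec b q) = q := by
  funext j
  simp [toVec, ofVec_apply, polyEquiv_ι_coord, mkDerivation_X]

/-- A derivation of the symmetric algebra is determined by its values on the linear forms, and these
by its values on the coordinates. -/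
theorem toVec_injective (b : Module.Basis σ K V) : Function.Injective (toVec (K := K) b) := by
  intro θ η h
  have h1 (α : Module.Dual K V) :
      θ (SymmetricAlgebra.ι K _ α) = η (SymmetricAlgebra.ι K _ α) := by
    apply (polyEquiv b).injective
    rw [← app_toVec, ← app_toVec, h]
  ext s
  induction s using SymmetricAlgebra.induction with
  | algebraMap r => simp
  | ι x => exact h1 x
  | mul x y hx hy => simp [hx, hy]
  | add x y hx hy => simp [hx, hy]

/-- `polyEquiv b` carries the span of the linear forms to the homogeneous polynomials of degree 1,
hence its `n`-th power to those of degree `n`. -/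
theorem isHomogeneousOfDegree_iff (b : Module.Basis σ K V) (θ : Der K V) (n : ℕ) :
    IsHomogeneousOfDegree θ n ↔ θ ≠ 0 ∧ ∀ j, (toVec b θ j).IsHomogeneous n := by
  have h1 : (LinearMap.range (SymmetricAlgebra.ι K (Module.Dual K V))).map
      (polyEquiv b).toAlgHom.toLinearMap = homogeneousSubmodule σ K 1 := by
    rw [← LinearMap.range_comp]
    refine map_range_eq_homogeneousSubmodule_one _ (fun α => ?_) fun j => ⟨b.coord j, ?_⟩
    · change (polyEquiv b (SymmetricAlgebra.ι K _ α)).IsHomogeneous 1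
      rw [polyEquiv_ι]
      exact linForm_homogeneous _
    · exact polyEquiv_ι_coord b j
  have h2 (s : PolyRing K V) : s ∈ LinearMap.range (SymmetricAlgebra.ι K (Module.Dual K V)) ^ n ↔
      (polyEquiv b s).IsHomogeneous n := by
    rw [← mem_homogeneousSubmodule, ← homogeneousSubmodule_one_pow, ← h1, ← Submodule.map_pow]
    constructor
    · exact fun hs => Submodule.mem_map_of_mem hs
    · rintro ⟨t, ht, he⟩
      rwa [← (polyEquiv b).injective he]
  unfold IsHomogeneousOfDegree
  simp only [h2, ← app_toVec]
  refine and_congr_right fun _ => ⟨fun h j => ?_, fun h α => app_homogeneous h⟩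
  have := h (b.coord j)
  rwa [app_toVec] at this

/-- By the Leibniz rule, `θ Q ∈ Q S` splits into one condition for each form: the forms are prime,
and none of them divides the product of the others. -/
theorem mem_derivations_iff (A : Arrangement K V) (b : Module.Basis σ K V) (θ : Der K V) :
    θ ∈ A.derivations ↔ IsLog (A.formSet b) (toVec b θ) := by
  classical
  have h0 : IsLog (A.formSet b) (toVec b θ) ↔ ∀ H : {H // H ∈ A.planes},
      SymmetricAlgebra.ι K (Module.Dual K V) (A.form H) ∣
        θ (SymmetricAlgebra.ι K (Module.Dual K V) (A.form H)) := by
    have h1 (α : Module.Dual K V) : linForm (coeffs b α) ∣ app (coeffs b α) (toVec b θ) ↔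
        SymmetricAlgebra.ι K (Module.Dual K V) α ∣ θ (SymmetricAlgebra.ι K _ α) := by
      rw [app_toVec, ← polyEquiv_ι]
      exact map_dvd_iff (polyEquiv b)
    constructor
    · intro h H
      rw [← h1]
      exact h _ ⟨A.form H, A.form_ne_zero H, by rw [A.ker_form]; exact H.2, rfl⟩
    · rintro h _ ⟨α, hα, hker, rfl⟩
      rw [h1]
      obtain ⟨c, hc⟩ := Module.Dual.exists_smul_of_ker_le (A.form_ne_zero ⟨_, hker⟩)
        (A.ker_form ⟨_, hker⟩).le
      have hc0 : c ≠ 0 := fun h0 => hα (by rw [hc, h0, zero_smul])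
      rw [hc, map_smul, Derivation.map_smul, Algebra.smul_def, Algebra.smul_def]
      exact mul_dvd_mul_left _ (h _)
  rw [h0]
  constructor
  · intro hθ H
    have hQ : A.definingPoly = SymmetricAlgebra.ι K (Module.Dual K V) (A.form H) *
        ∏ H' ∈ A.planes.attach.erase H, SymmetricAlgebra.ι K (Module.Dual K V) (A.form H') :=
      (Finset.mul_prod_erase _ _ (Finset.mem_attach _ H)).symm
    have hp := ι_prime b (A.form_ne_zero H)
    have h1 : SymmetricAlgebra.ι K (Module.Dual K V) (A.form H) ∣ θ A.definingPoly :=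
      (Dvd.intro _ hQ.symm).trans hθ
    rw [hQ, Derivation.leibniz, smul_eq_mul, smul_eq_mul,
      dvd_add_right (dvd_mul_right _ _)] at h1
    -- Otherwise the form would divide another factor of `Q`, and two distinct hyperplanes would
    -- coincide.
    refine (hp.dvd_or_dvd h1).resolve_left fun h2 => ?_
    obtain ⟨H', hH', h3⟩ := (Prime.dvd_finsetProd_iff hp _).1 h2
    have h4 := Module.Dual.ker_eq_of_ker_le (A.form_ne_zero _) (A.form_ne_zero _)
      (SymmetricAlgebra.ker_le_of_ι_dvd h3)
    rw [A.ker_form, A.ker_form] at h4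
    exact Finset.ne_of_mem_erase hH' (Subtype.ext h4.symm)
  · intro h
    exact Derivation.prod_dvd θ _ _ fun H _ => h H

theorem toVec_sum_smul {A : Arrangement K V} (b : Module.Basis σ K V) {I : Type*} [Fintype I]
    (c : I → PolyRing K V) (θ : I → A.derivations) :
    toVec b (∑ i, c i • θ i : A.derivations) = ∑ i, polyEquiv b (c i) • toVec b (θ i) := by
  rw [AddSubmonoidClass.coe_finsetSum, toVec_sum]
  exact Finset.sum_congr rfl fun i _ => toVec_smul b _ _

/-- Freeness and exponents in coordinates. -/
theorem hasExponents_iff (A : Arrangement K V) (b : Module.Basis σ K V) (E : Multiset ℕ) :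
    A.HasExponents E ↔ ∃ (p : Fin (Module.finrank K V) → σ → MvPolynomial σ K)
      (d : Fin (Module.finrank K V) → ℕ), IsHomBasis (A.formSet b) p d ∧
        E = Finset.univ.val.map d := by
  constructor
  · rintro ⟨θ, d, hθ, rfl⟩
    refine ⟨fun i => toVec b (θ i), d, ⟨fun i => ?_, fun i => ?_, ?_, fun q hq => ?_⟩, rfl⟩
    · exact (A.mem_derivations_iff b _).1 (θ i).2
    · exact ((isHomogeneousOfDegree_iff b _ _).1 (hθ i)).2
    · rw [Fintype.linearIndependent_iff]
      intro g hg i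
      have h1 : ∑ i, (polyEquiv b).symm (g i) • θ i = 0 := by
        apply Subtype.ext
        apply toVec_injective b
        rw [toVec_sum_smul, Submodule.coe_zero, toVec_zero, ← hg]
        exact Finset.sum_congr rfl fun i _ => by rw [AlgEquiv.apply_symm_apply]
      have h2 := Fintype.linearIndependent_iffₛ.1 θ.linearIndependent _ 0
        (h1.trans (by simp)) i
      rw [← (polyEquiv b).apply_symm_apply (g i), h2, Pi.zero_apply, map_zero]
    · have hm : ofVec b q ∈ A.derivations := by
        rw [A.mem_derivations_iff b, toVec_ofVec]
        exact hq
      refine ⟨fun i => polyEquiv b (θ.repr ⟨_, hm⟩ i), ?_⟩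
      rw [← toVec_sum_smul, θ.sum_repr]
      exact (toVec_ofVec b q).symm
  · rintro ⟨p, d, hp, rfl⟩
    have hm (i) : ofVec b (p i) ∈ A.derivations := by
      rw [A.mem_derivations_iff b, toVec_ofVec]
      exact hp.log i
    let θ (i : Fin (Module.finrank K V)) : A.derivations := ⟨_, hm i⟩
    have hθ (i) : toVec b (θ i) = p i := toVec_ofVec b (p i)
    have hli : LinearIndependent (PolyRing K V) θ := by
      rw [Fintype.linearIndependent_iffₛ]
      intro f g hfg i
      have h1 := toVec_sum_smul b f θ
      rw [hfg, toVec_sum_smul] at h1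
      simp only [hθ] at h1
      exact (polyEquiv b).injective (Fintype.linearIndependent_iffₛ.1 hp.indep _ _ h1.symm i)
    have hsp : ⊤ ≤ Submodule.span (PolyRing K V) (Set.range θ) := by
      intro η _
      obtain ⟨c, hc⟩ := hp.span _ ((A.mem_derivations_iff b η).1 η.2)
      have : η = ∑ i, (polyEquiv b).symm (c i) • θ i := by
        apply Subtype.ext
        apply toVec_injective b
        rw [toVec_sum_smul, hc]
        exact Finset.sum_congr rfl fun i _ => by rw [AlgEquiv.apply_symm_apply, hθ]
      rw [this]
      exact Submodule.sum_mem _ fun i _ =>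
        Submodule.smul_mem _ _ (Submodule.subset_span ⟨i, rfl⟩)
    refine ⟨Module.Basis.mk hli hsp, d, fun i => ?_, rfl⟩
    rw [Module.Basis.mk_apply, isHomogeneousOfDegree_iff b]
    refine ⟨fun h0 => hp.indep.ne_zero i ?_, fun j => by rw [hθ]; exact hp.hom i j⟩
    rw [← hθ, h0, toVec_zero]

theorem HasExponents.isFree {A : Arrangement K V} {E : Multiset ℕ} (h : A.HasExponents E) :
    A.IsFree := by
  obtain ⟨θ, -⟩ := h
  exact Module.Free.of_basis θ

end Arrangement

/-! ### Exponents of arrangements of lines in a plane -/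

namespace LogField

open MvPolynomial

variable {K : Type*} [Field K]

/-- The only consequence of independence needed in the comparisons below: no relation between two
members of a basis. -/
theorem pair_indep {M I N : Type*} [CommRing M] [AddCommGroup N] [Module M N] {p : I → N}
    (h : LinearIndependent M p) {i j : I} (hij : i ≠ j) {s t : M} (hst : s • p i = t • p j) :
    s = 0 ∧ t = 0 := by
  classical
  have h1 := linearIndependent_iff'.1 h {i, j} (fun x => if x = i then s else -t) (by
    rw [Finset.sum_pair hij, if_pos rfl, if_neg hij.symm, hst, neg_smul, add_neg_cancel])
  have h2 := h1 i (by simp)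
  have h3 := h1 j (by simp)
  rw [if_pos rfl] at h2
  rw [if_neg hij.symm, neg_eq_zero] at h3
  exact ⟨h2, h3⟩

theorem pderiv_linForm {σ : Type*} [Fintype σ] (a : σ → K) (j : σ) :
    pderiv j (linForm a) = C (a j) := by
  classical
  simp [linForm, pderiv_X, Pi.single_apply]

section Plane

variable {κ : Type*} [Fintype κ] {a : κ → Fin 2 → K}

/-- The vector field that annihilates the defining polynomial. -/
noncomputable def rotated (Q : MvPolynomial (Fin 2) K) : Fin 2 → MvPolynomial (Fin 2) K :=
  ![pderiv 1 Q, -pderiv 0 Q]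

/-- With `Q = α R`, the field maps `α` to the Jacobian determinant of `α` and `Q`, which is `α`
times that of `α` and `R`. -/
theorem isLog_rotated {F : Set (Fin 2 → K)} (hF : ∀ f ∈ F, ∃ i, ∃ c : K, c ≠ 0 ∧ f = c • a i) :
    IsLog F (rotated (∏ i, linForm (a i))) := by
  classical
  intro f hf
  obtain ⟨i, c, hc, rfl⟩ := hF f hf
  have hQ : ∏ i, linForm (a i) = linForm (a i) * ∏ j ∈ Finset.univ.erase i, linForm (a j) :=
    (Finset.mul_prod_erase _ _ (Finset.mem_univ i)).symm
  have h1 : linForm (c • a i) = C c * linForm (a i) := by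
    simp [linForm, mul_add, mul_assoc]
  rw [h1]
  refine ((isUnit_iff_ne_zero.2 hc).map C).mul_left_dvd.2 ?_
  rw [hQ]
  set R := ∏ j ∈ Finset.univ.erase i, linForm (a j)
  refine ⟨C c * (C (a i 0) * pderiv 1 R - C (a i 1) * pderiv 0 R), ?_⟩
  simp only [app, rotated, Fin.sum_univ_two, Pi.smul_apply, smul_eq_mul, Matrix.cons_val_zero,
    Matrix.cons_val_one, Derivation.leibniz, pderiv_linForm, C_mul]
  ring

theorem rotated_homogeneous {Q : MvPolynomial (Fin 2) K} {n : ℕ} (h : Q.IsHomogeneous n)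
    (j : Fin 2) : (rotated Q j).IsHomogeneous (n - 1) := by
  fin_cases j
  · exact h.pderiv
  · exact h.pderiv.neg

/-- The Euler field has degree 1 and the rotated gradient of `Q` degree `n - 1`; since they are
independent, expanding them bounds the degrees from above. The lower bound for the sum holds because
all `n` forms divide the determinant of the basis. -/
theorem exponents_plane [CharZero K] (ha : ∀ i, a i ≠ 0)
    (hne : ∀ i j, i ≠ j → ¬ linForm (a i) ∣ linForm (a j)) {F : Set (Fin 2 → K)}
    (haF : ∀ i, a i ∈ F) (hF : ∀ f ∈ F, ∃ i, ∃ c : K, c ≠ 0 ∧ f = c • a i)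
    (hn : Fintype.card κ ≠ 0)
    {p : Fin 2 → Fin 2 → MvPolynomial (Fin 2) K} {d : Fin 2 → ℕ} (h : IsHomBasis F p d) :
    (∃ i, d i ≤ 1) ∧ (∀ i, d i ≤ max 1 (Fintype.card κ - 1)) ∧ Fintype.card κ ≤ d 0 + d 1 := by
  set n := Fintype.card κ with hn_def
  set Q := ∏ i, linForm (a i) with hQ_def
  have hQ : Q.IsHomogeneous n := prod_linForm_homogeneous a
  have hQ0 : Q ≠ 0 := prod_linForm_ne_zero ha
  obtain ⟨c, hc, -, hc0⟩ := h.exists_homogeneous (isLog_X F) (isHomogeneous_X K)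
  obtain ⟨e, he, -, he0⟩ := h.exists_homogeneous (isLog_rotated hF) (rotated_homogeneous hQ)
  -- By Euler's identity this determinant is `-n Q`, not zero in characteristic zero.
  have hdet : X 0 * rotated Q 1 - X 1 * rotated Q 0 ≠ 0 := by
    have h1 := hQ.sum_X_mul_pderiv
    rw [Fin.sum_univ_two] at h1
    have h2 : X 0 * rotated Q 1 - X 1 * rotated Q 0 = -(n • Q) := by
      rw [← h1]
      simp only [rotated, Matrix.cons_val_zero, Matrix.cons_val_one]
      ring
    rw [h2, neg_ne_zero]
    exact smul_ne_zero hn hQ0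
  have hcj (j) : X j = c 0 * p 0 j + c 1 * p 1 j := by simpa using congrFun hc j
  have hej (j) : rotated Q j = e 0 * p 0 j + e 1 * p 1 j := by simpa using congrFun he j
  refine ⟨?_, ?_, ?_⟩
  · by_contra! hd
    have := hcj 0
    rw [hc0 0 (hd 0), hc0 1 (hd 1)] at this
    simp at this
  · by_contra! hd
    obtain ⟨i, hi⟩ := hd
    -- A basis element of larger degree would occur in neither expansion, leaving both fields
    -- multiples of the other element and their determinant zero.
    have h1 : c i = 0 := hc0 i (lt_of_le_of_lt (le_max_left _ _) hi)
    have h2 : e i = 0 := he0 i (lt_of_le_of_lt (le_max_right _ _) hi)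
    apply hdet
    rw [hcj 0, hcj 1, hej 0, hej 1]
    fin_cases i <;> simp only [Fin.zero_eta, Fin.mk_one] at h1 h2 <;> rw [h1, h2] <;> ring
  · have hp : (Matrix.of p).det ≠ 0 := by
      intro h0
      obtain ⟨v, hv, hv0⟩ := Matrix.exists_vecMul_eq_zero_iff.2 h0
      refine hv (funext fun i => Fintype.linearIndependent_iff.1 h.indep v ?_ i)
      rw [← hv0]
      ext1 j
      simp [Matrix.vecMul, dotProduct]
    have := card_le_of_linForm_dvd ha hne hp (det_homogeneous (P := Matrix.of p) h.hom)
      fun i => linForm_dvd_det (ha i) fun j => h.log j _ (haF i)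
    simpa using this

end Plane

/-! ### Low degree fields after the deletion of a plane -/

section Deletion

/-- If the second basis element is not radial along the plane of `a`, then two logarithmic vector
fields of degree at most 10 of the deletion are dependent. -/
theorem dependent_of_deletion {F G : Set (Fin 3 → K)} {P : Fin 3 → Fin 3 → MvPolynomial (Fin 3) K}
    (hP : IsHomBasis F P ![1, 11, 15]) (hP0 : P 0 = X) {a : Fin 3 → K} (ha : a ≠ 0)
    (haG : ∀ q, IsLog G q → IsLog F (linForm a • q)) {x : Fin 3 → K} (hx : a ⬝ᵥ x = 0)
    {i j : Fin 3} (hxP : x i * eval x (P 1 j) ≠ x j * eval x (P 1 i))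
    {q r : Fin 3 → MvPolynomial (Fin 3) K} (hq : IsLog G q) (hr : IsLog G r) {m n : ℕ}
    (hm : ∀ j, (q j).IsHomogeneous m) (hn : ∀ j, (r j).IsHomogeneous n) (hm10 : m ≤ 10)
    (hn10 : n ≤ 10) (hqr : ∀ s t : MvPolynomial (Fin 3) K, s • q = t • r → s = 0 ∧ t = 0) :
    False := by
  have key {q : Fin 3 → MvPolynomial (Fin 3) K} (hq : IsLog G q) {m : ℕ}
      (hm : ∀ j, (q j).IsHomogeneous m) (hm10 : m ≤ 10) :
      ∃ c : MvPolynomial (Fin 3) K, linForm a • q = c • X := by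
    obtain ⟨c, hc, hch, hc0⟩ := hP.exists_homogeneous (haG q hq) (m := 1 + m)
      fun j => (linForm_homogeneous a).mul (hm j)
    have h2 : c 2 = 0 := hc0 2 (by simp; omega)
    -- The product has degree at most 11, so this coefficient is constant. At `x` on the plane the
    -- product vanishes, and a nonzero constant would make the second basis field parallel to `x`
    -- there, against `hxP`.
    have h1 : c 1 = 0 := by
      rcases hm10.lt_or_eq with h | rfl
      · exact hc0 1 (by simp; omega)
      · have h3 : c 1 = C (coeff 0 (c 1)) :=
          totalDegree_eq_zero_iff_eq_C.1 (Nat.le_zero.1 ((hch 1).totalDegree_le))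
        have h4 (l : Fin 3) : 0 = eval x (c 0) * x l + coeff 0 (c 1) * eval x (P 1 l) := by
          have := congrArg (eval x) (congrFun hc l)
          rw [Fin.sum_univ_three, h2, hP0, h3] at this
          simpa [eval_linForm, hx] using this
        by_contra h5
        have h6 : coeff 0 (c 1) ≠ 0 := fun h6 => h5 (by rw [h3, h6, C_0])
        apply hxP
        apply mul_left_cancel₀ h6
        linear_combination (-x i) * h4 j + x j * h4 i
    refine ⟨c 0, ?_⟩
    rw [hc, Fin.sum_univ_three, h1, h2, hP0, zero_smul, zero_smul, add_zero, add_zero]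
  obtain ⟨c, hc⟩ := key hq hm hm10
  obtain ⟨e, he⟩ := key hr hn hn10
  -- Both products are multiples of the Euler field; cross-multiplying gives a relation between `q`
  -- and `r`.
  have h1 := hqr (e * linForm a) (c * linForm a) (by
    rw [mul_smul, mul_smul, hc, he, smul_smul, smul_smul, mul_comm])
  have h2 : e = 0 := (mul_eq_zero.1 h1.1).resolve_right (linForm_ne_zero ha)
  rw [h2, zero_smul] at he
  have h3 := hqr 0 (linForm a) (by rw [he, zero_smul])
  exact linForm_ne_zero ha h3.2

end Deletion

/-! ### Degrees after the addition of the plane `X 2 = 0` -/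

section Addition

theorem linForm_single (i : Fin 3) : linForm (Pi.single i (1 : K)) = X i := by
  simp [linForm, Pi.single_apply]

theorem X_two_dvd_iff {p : MvPolynomial (Fin 3) K} :
    X 2 ∣ p ↔ proj (Pi.single 2 1) (Pi.single 2 1) p = 0 := by
  rw [← linForm_single]
  exact linForm_dvd_iff_proj (by simp)

theorem proj_X (j : Fin 3) :
    proj (Pi.single 2 (1 : K) : Fin 3 → K) (Pi.single 2 1) (X j) = if j = 2 then 0 else X j := by
  rw [proj, aeval_X, linForm_single]
  fin_cases j <;> simp

variable {F : Set (Fin 3 → K)} {P : Fin 3 → Fin 3 → MvPolynomial (Fin 3) K}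
  {d : Fin 3 → ℕ}

/-- A basis element of degree `d₁` is not tangent to a plane that meets the arrangement in more
than `d₁ + 1` lines. -/
theorem not_X_two_dvd (hP : IsHomBasis F P d) (hP0 : P 0 = X)
    (hF0 : ∀ a ∈ F, a ≠ 0) (hF : ∀ a ∈ F, ¬ linForm a ∣ X 2)
    {κ : Type*} [Fintype κ] {a : κ → Fin 3 → K} (haF : ∀ k, a k ∈ F)
    (ha : ∀ k, (![a k 0, a k 1, 0] : Fin 3 → K) ≠ 0)
    (hne : ∀ k l, k ≠ l → ¬ linForm ![a k 0, a k 1, 0] ∣ linForm ![a l 0, a l 1, 0])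
    (hκ : 1 + d 1 < Fintype.card κ) : ¬ X 2 ∣ P 1 2 := by
  intro hdvd
  set π : MvPolynomial (Fin 3) K →ₐ[K] MvPolynomial (Fin 3) K :=
    proj (Pi.single 2 1) (Pi.single 2 1) with hπ
  have hX2 : Prime (X 2 : MvPolynomial (Fin 3) K) := by
    rw [← linForm_single]
    exact linForm_prime fun h => by simpa using congrFun h 2
  have hπhom {p : MvPolynomial (Fin 3) K} {n : ℕ} (h : p.IsHomogeneous n) :
      (π p).IsHomogeneous n := by
    have := h.aeval (fun j => X j - C ((Pi.single 2 (1 : K) : Fin 3 → K) j) *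
      linForm (Pi.single 2 1)) (n := 1)
      fun j => (isHomogeneous_X _ _).sub ((linForm_homogeneous _).C_mul _)
    rwa [one_mul] at this
  -- Restricted to the plane, the field is tangent to all the lines cut out. Its determinant with
  -- the Euler field has degree `1 + d 1` but is divisible by more linear forms than that, hence is
  -- zero.
  have hm : X 0 * π (P 1 1) - X 1 * π (P 1 0) = 0 := by
    by_contra h0
    have hhom : (X 0 * π (P 1 1) - X 1 * π (P 1 0)).IsHomogeneous (1 + d 1) :=
      ((isHomogeneous_X _ _).mul (hπhom (hP.hom 1 1))).sub
        ((isHomogeneous_X _ _).mul (hπhom (hP.hom 1 0)))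
    refine absurd (card_le_of_linForm_dvd ha hne h0 hhom fun k => ?_) (by omega)
    obtain ⟨g, hg⟩ := hP.log 1 _ (haF k)
    have h1 : C (a k 0) * π (P 1 0) + C (a k 1) * π (P 1 1) =
        linForm ![a k 0, a k 1, 0] * π g := by
      have h2 := congrArg π hg
      rw [map_mul, app, map_sum, Fin.sum_univ_three, linForm, map_sum, Fin.sum_univ_three] at h2
      simp only [map_mul, algHom_C, algebraMap_eq] at h2
      rw [X_two_dvd_iff.1 hdvd, hπ, proj_X, proj_X, proj_X, ← hπ] at h2
      simpa [linForm, Fin.sum_univ_three] using h2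
    have h3 : linForm ![a k 0, a k 1, 0] = C (a k 0) * X 0 + C (a k 1) * X 1 := by
      simp [linForm, Fin.sum_univ_three]
    have h4 : linForm ![a k 0, a k 1, 0] ∣ C (a k 0) * (X 0 * π (P 1 1) - X 1 * π (P 1 0)) :=
      ⟨π (P 1 1) - X 1 * π g, by
        linear_combination (-X 1) * h1 - π (P 1 1) * h3⟩
    have h5 : linForm ![a k 0, a k 1, 0] ∣ C (a k 1) * (X 0 * π (P 1 1) - X 1 * π (P 1 0)) :=
      ⟨X 0 * π g - π (P 1 0), by
        linear_combination (X 0) * h1 + π (P 1 0) * h3⟩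
    by_cases hk : a k 0 = 0
    · have hk1 : a k 1 ≠ 0 := by
        intro hk1
        apply ha k
        rw [hk, hk1]
        ext j; fin_cases j <;> rfl
      exact ((isUnit_iff_ne_zero.2 hk1).map C).dvd_mul_left.1 h5
    · exact ((isUnit_iff_ne_zero.2 hk).map C).dvd_mul_left.1 h4
  have hX0 : Prime (X 0 : MvPolynomial (Fin 3) K) := by
    rw [← linForm_single]
    exact linForm_prime fun h => by simpa using congrFun h 0
  obtain ⟨c, hc⟩ : X 0 ∣ π (P 1 0) := by
    refine (hX0.dvd_or_dvd (Dvd.intro (π (P 1 1)) (sub_eq_zero.1 hm))).resolve_left fun h => ?_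
    have := (map_dvd (eval (Pi.single 1 (1 : K))) h)
    simp at this
  have hc1 : π (P 1 1) = X 1 * c := by
    apply mul_left_cancel₀ hX0.ne_zero
    linear_combination hm + X 1 * hc
  have hππ (p : MvPolynomial (Fin 3) K) : π (π p) = π p := by
    have := X_two_dvd_iff.1 (linForm_single (K := K) 2 ▸
      linForm_dvd_sub_proj (Pi.single 2 1) (Pi.single 2 1) p)
    rw [map_sub, sub_eq_zero] at this
    exact this.symm
  have hcπ : π c = c := by
    apply mul_left_cancel₀ hX0.ne_zero
    have := congrArg π hc
    rw [hππ, map_mul, hπ, proj_X, ← hπ, hc] at this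
    simpa using this.symm
  -- The restriction is `c` times the Euler field, so the difference vanishes on the plane; its
  -- quotient by `X 2` is again logarithmic.
  have hdiff (j : Fin 3) : X 2 ∣ P 1 j - c * X j := by
    rw [X_two_dvd_iff, ← hπ, map_sub, map_mul, hcπ, hπ, proj_X, ← hπ]
    fin_cases j
    · simp [hc, mul_comm]
    · simp [hc1, mul_comm]
    · simpa using X_two_dvd_iff.1 hdvd
  choose η hη using hdiff
  have hη' : (X 2 : MvPolynomial (Fin 3) K) • η = P 1 - c • P 0 := by
    funext j
    simp [← hη, hP0]
  have hlog : IsLog F η := by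
    intro b hb
    have h1 : linForm b ∣ X 2 * app b η := by
      rw [← app_smul, hη']
      exact (((hP.log 1).sub ((hP.log 0).smul c)) b hb)
    exact ((linForm_prime (hF0 b hb)).dvd_or_dvd h1).resolve_left (hF b hb)
  obtain ⟨e, he⟩ := hP.span η hlog
  have hzero : ∑ i, (![X 2 * e 0 + c, X 2 * e 1 - 1, X 2 * e 2] :
      Fin 3 → MvPolynomial (Fin 3) K) i • P i = 0 := by
    rw [he, Fin.sum_univ_three] at hη'
    simp only [Fin.sum_univ_three, Matrix.cons_val_zero, Matrix.cons_val_one, Matrix.cons_val]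
    have h2 : (X 2 : MvPolynomial (Fin 3) K) • (e 0 • P 0 + e 1 • P 1 + e 2 • P 2)
      - (P 1 - c • P 0) = 0 := by rw [hη', sub_self]
    rw [← h2]
    module
  have h3 := Fintype.linearIndependent_iff.1 hP.indep _ hzero 1
  -- Comparing coefficients of `P 1` gives `X 2 * e 1 = 1`.
  exact hX2.not_isUnit (IsUnit.of_mul_eq_one _ (sub_eq_zero.1 h3))

/-- An element of a basis cannot have a degree that is larger than that of all elements of another
basis. -/
theorem IsHomBasis.exists_degree_le {I J : Type*} [Fintype I] [Fintype J] {e : J → ℕ}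
    {η : J → Fin 3 → MvPolynomial (Fin 3) K} {P : I → Fin 3 → MvPolynomial (Fin 3) K} {d : I → ℕ}
    (hP : IsHomBasis F P d) (hη : IsHomBasis F η e) (j : J) : ∃ i, e j ≤ d i := by
  classical
  by_contra! hlt
  have h1 (i : I) : P i ∈ Submodule.span (MvPolynomial (Fin 3) K) (η '' {j}ᶜ) := by
    obtain ⟨c, hc, -, hc0⟩ := hη.exists_homogeneous (hP.log i) (hP.hom i)
    rw [hc]
    refine Submodule.sum_mem _ fun l _ => ?_
    by_cases hl : l = j
    · rw [hl, hc0 j (hlt i), zero_smul]; exact Submodule.zero_mem _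
    · exact Submodule.smul_mem _ _ (Submodule.subset_span ⟨l, hl, rfl⟩)
  obtain ⟨c, hc⟩ := hP.span _ (hη.log j)
  refine hη.indep.notMem_span_image (s := {j}ᶜ) (x := j) (by simp) ?_
  rw [hc]
  exact Submodule.sum_mem _ fun i _ => Submodule.smul_mem _ _ (h1 i)

/-- The addition of a plane that meets the arrangement in many lines cannot be free with the
exponents `1` and at least `16` among its exponents. -/
theorem false_of_addition {G : Set (Fin 3 → K)} (hP : IsHomBasis F P ![1, 11, 15]) (hP0 : P 0 = X)
    (hFG : ∀ q, IsLog F q → X 2 ∣ q 2 → IsLog G q) (hGF : F ⊆ G)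
    (hnot : ¬ X 2 ∣ P 1 2)
    {η : Fin 3 → Fin 3 → MvPolynomial (Fin 3) K} {e : Fin 3 → ℕ} (hη : IsHomBasis G η e)
    {j : Fin 3} (hj : 16 ≤ e j) : False := by
  have hX2 : Prime (X 2 : MvPolynomial (Fin 3) K) := by
    rw [← linForm_single]
    exact linForm_prime fun h => by simpa using congrFun h 2
  have hX2P (i) : IsLog G ((X 2 : MvPolynomial (Fin 3) K) • P i) :=
    hFG _ ((hP.log i).smul _) (Dvd.intro _ rfl)
  -- the remaining degrees are at most 12
  have hdeg (k : Fin 3) (hk : k ≠ j) : e k ≤ 12 := by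
    by_contra! h12
    obtain ⟨l, hl⟩ : ∃ l : Fin 3, ∀ i, i ≠ l → i = j ∨ i = k := by
      have : ∀ j k : Fin 3, k ≠ j → ∃ l, ∀ i, i ≠ l → i = j ∨ i = k := by decide
      exact this j k hk
    -- If two of the degrees exceeded 12, every logarithmic field of degree at most 12 would be a
    -- multiple of the third basis element, in particular the independent fields `X` and `X 2 • P
    -- 1`.
    have hmul {q : Fin 3 → MvPolynomial (Fin 3) K} (hq : IsLog G q) {m : ℕ}
        (hm : ∀ j, (q j).IsHomogeneous m) (hm12 : m ≤ 12) :
        ∃ c : MvPolynomial (Fin 3) K, q = c • η l := by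
      obtain ⟨c, hc, -, hc0⟩ := hη.exists_homogeneous hq hm
      refine ⟨c l, ?_⟩
      rw [hc]
      refine Fintype.sum_eq_single l fun i hi => ?_
      rw [hc0 i (by rcases hl i hi with rfl | rfl <;> omega), zero_smul]
    obtain ⟨c, hc⟩ := hmul (isLog_X G) (isHomogeneous_X K) (by norm_num)
    obtain ⟨c', hc'⟩ := hmul (hX2P 1) (m := 1 + 11)
      (fun i => (isHomogeneous_X _ _).mul (hP.hom 1 i)) le_rfl
    have h1 : c' • P 0 = (c * X 2) • P 1 := by
      rw [mul_smul, hc', hP0, hc, smul_smul, smul_smul, mul_comm]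
    have h2 : c = 0 :=
      (mul_eq_zero.1 (pair_indep hP.indep (by decide) h1).2).resolve_right hX2.ne_zero
    rw [h2, zero_smul] at hc
    exact hP.indep.ne_zero 0 (hP0.trans hc)
  choose Z hZ hZhom hZ0 using fun l => hP.exists_homogeneous ((hη.log l).mono hGF) (hη.hom l)
  -- The other basis elements have degree at most 12, less than 15, so `P 2` does not occur in them.
  -- The coefficient of `P 2` in any field of `G` is thus a multiple of that in `η j`.
  have hcoeff {f : Fin 3 → MvPolynomial (Fin 3) K} (hf : IsLog G (∑ m, f m • P m)) :
      ∃ c, f 2 = c * Z j 2 := by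
    obtain ⟨c, hc⟩ := hη.span _ hf
    refine ⟨c j, ?_⟩
    have h1 : ∑ m, f m • P m = ∑ m, (∑ l, c l * Z l m) • P m := by
      rw [hc]
      simp only [Finset.sum_smul, mul_smul]
      rw [Finset.sum_comm]
      refine Finset.sum_congr rfl fun l _ => ?_
      rw [← Finset.smul_sum, ← hZ]
    rw [Fintype.linearIndependent_iffₛ.1 hP.indep _ _ h1 2]
    refine Fintype.sum_eq_single j fun l hl => ?_
    rw [hZ0 l 2 (lt_of_le_of_lt (hdeg l hl) (by simp)), mul_zero]
  obtain ⟨c, hc⟩ := hcoeff (f := ![0, 0, X 2]) (by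
    simpa [Fin.sum_univ_three] using hX2P 2)
  -- This combination of `P 1` and `P 2` has last component zero, so it is tangent to the added
  -- plane.
  obtain ⟨c', hc'⟩ := hcoeff (f := ![0, P 2 2, -P 1 2]) (by
    refine hFG _ ?_ ⟨0, ?_⟩
    · simpa [Fin.sum_univ_three, sub_eq_add_neg] using
        ((hP.log 1).smul (P 2 2)).sub ((hP.log 2).smul (P 1 2))
    · simp [Fin.sum_univ_three, mul_comm])
  simp only [Matrix.cons_val] at hc hc'
  -- It is homogeneous of degree `e j - 15`, which is positive. As it divides the prime `X 2`, it is
  -- associated to `X 2`, and then `X 2` divides `P 1 2`.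
  have hZnu : ¬ IsUnit (Z j 2) := not_isUnit_of_homogeneous (hZhom j 2) (by simp; omega)
  have hcu : IsUnit c := (hX2.irreducible.isUnit_or_isUnit hc).resolve_right hZnu
  have hdvd : X 2 ∣ Z j 2 := hcu.dvd_mul_left.1 (Dvd.intro 1 (by rw [mul_one, hc]))
  exact hnot (dvd_neg.1 (hc' ▸ hdvd.mul_left c'))

end Addition

end LogField

/-! ### Klein's invariants of the icosahedral group and invariant vector fields -/

namespace Klein

section Ring

variable {R : Type*} [CommRing R]

/-- Klein's invariant of degree 2, in terms of `y` and `p = uw`. -/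
def inv2 (y p : R) : R := y ^ 2 + p

/-- Klein's invariant of degree 6, in terms of `y`, `p = uw` and `q = u⁵ + w⁵`. -/
def inv6 (y p q : R) : R := 8 * y ^ 4 * p - 2 * y ^ 2 * p ^ 2 + p ^ 3 - y * q

/-- Klein's invariant of degree 10, in terms of `y`, `p = uw` and `q = u⁵ + w⁵`. -/
def inv10 (y p q : R) : R :=
  320 * y ^ 6 * p ^ 2 - 160 * y ^ 4 * p ^ 3 + 20 * y ^ 2 * p ^ 4 + 6 * p ^ 5 -
    4 * y * q * (32 * y ^ 4 - 20 * y ^ 2 * p + 5 * p ^ 2) + (q ^ 2 - 2 * p ^ 5)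

/-- The gradient with respect to `y² + uw` of a function of `y, p = uw, q = u⁵ + w⁵` with partial
derivatives `f = (f_p, f_q, f_y)`. -/
def grad (f : Fin 3 → R) (x : Fin 3 → R) : Fin 3 → R :=
  ![2 * (f 0 * x 0 + 5 * f 1 * x 2 ^ 4), f 2, 2 * (f 0 * x 2 + 5 * f 1 * x 0 ^ 4)]

/-- The partial derivatives of `inv6`. -/
def d6 (y p q : R) : Fin 3 → R :=
  ![8 * y ^ 4 - 4 * y ^ 2 * p + 3 * p ^ 2, -y, 32 * y ^ 3 * p - 4 * y * p ^ 2 - q]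

/-- The partial derivatives of `inv10`. -/
def d10 (y p q : R) : Fin 3 → R :=
  ![640 * y ^ 6 * p - 480 * y ^ 4 * p ^ 2 + 80 * y ^ 2 * p ^ 3 + 20 * p ^ 4 + 80 * y ^ 3 * q -
      40 * y * p * q,
    -4 * y * (32 * y ^ 4 - 20 * y ^ 2 * p + 5 * p ^ 2) + 2 * q,
    1920 * y ^ 5 * p ^ 2 - 640 * y ^ 3 * p ^ 3 + 40 * y * p ^ 4 -
      4 * q * (32 * y ^ 4 - 20 * y ^ 2 * p + 5 * p ^ 2) - 4 * y * q * (128 * y ^ 3 - 40 * y * p)]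

/-- The coefficients of the vector field of degree 11. -/
def coef11 (y p q : R) : Fin 3 → R :=
  (-2 * inv6 y p q - 128 * inv2 y p ^ 3) • d6 y p q + inv2 y p • d10 y p q

/-- The coefficients of the vector field of degree 15. -/
def coef15 (y p q : R) : Fin 3 → R :=
  (-2 * inv10 y p q + 128 * inv2 y p ^ 2 * inv6 y p q) • d6 y p q + inv6 y p q • d10 y p q

/-- An invariant vector field of degree 11. -/
def vec11 (x : Fin 3 → R) : Fin 3 → R :=
  grad (coef11 (x 1) (x 0 * x 2) (x 0 ^ 5 + x 2 ^ 5)) x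

/-- An invariant vector field of degree 15. -/
def vec15 (x : Fin 3 → R) : Fin 3 → R :=
  grad (coef15 (x 1) (x 0 * x 2) (x 0 ^ 5 + x 2 ^ 5)) x

theorem map_vec11 {S : Type*} [CommRing S] (f : R →+* S) (x : Fin 3 → R) (j : Fin 3) :
    f (vec11 x j) = vec11 (fun i => f (x i)) j := by
  fin_cases j <;> simp [vec11, grad, coef11, d6, d10, inv2, inv6, map_ofNat]

theorem map_vec15 {S : Type*} [CommRing S] (f : R →+* S) (x : Fin 3 → R) (j : Fin 3) :
    f (vec15 x j) = vec15 (fun i => f (x i)) j := by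
  fin_cases j <;> simp [vec15, grad, coef15, d6, d10, inv2, inv6, inv10, map_ofNat]

theorem vec11_smul (t : R) (x : Fin 3 → R) : vec11 (t • x) = t ^ 11 • vec11 x := by
  have h : coef11 (t * x 1) (t * x 0 * (t * x 2)) ((t * x 0) ^ 5 + (t * x 2) ^ 5) =
      ![t ^ 10, t ^ 7, t ^ 11] * coef11 (x 1) (x 0 * x 2) (x 0 ^ 5 + x 2 ^ 5) := by
    rw [show t * x 0 * (t * x 2) = t ^ 2 * (x 0 * x 2) by ring,
      show (t * x 0) ^ 5 + (t * x 2) ^ 5 = t ^ 5 * (x 0 ^ 5 + x 2 ^ 5) by ring]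
    ext j
    fin_cases j <;> simp [coef11, d6, d10, inv2, inv6] <;> ring
  ext j
  fin_cases j <;> simp [vec11, grad, h] <;> ring

theorem vec15_smul (t : R) (x : Fin 3 → R) : vec15 (t • x) = t ^ 15 • vec15 x := by
  have h : coef15 (t * x 1) (t * x 0 * (t * x 2)) ((t * x 0) ^ 5 + (t * x 2) ^ 5) =
      ![t ^ 14, t ^ 11, t ^ 15] * coef15 (x 1) (x 0 * x 2) (x 0 ^ 5 + x 2 ^ 5) := by
    rw [show t * x 0 * (t * x 2) = t ^ 2 * (x 0 * x 2) by ring,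
      show (t * x 0) ^ 5 + (t * x 2) ^ 5 = t ^ 5 * (x 0 ^ 5 + x 2 ^ 5) by ring]
    ext j
    fin_cases j <;> simp [coef15, d6, d10, inv2, inv6, inv10] <;> ring
  ext j
  fin_cases j <;> simp [vec15, grad, h] <;> ring

/-- The rotation by a fifth root of unity. -/
def rot (z : R) (x : Fin 3 → R) : Fin 3 → R := ![z * x 0, x 1, z ^ 4 * x 2]

/-- `y`, `uw` and `u⁵ + w⁵` are invariant under the rotation, and the gradient is equivariant. It
suffices therefore to check one plane in each orbit of the rotation. -/
theorem vec_rot {z : R} (hz : z ^ 5 = 1) (x : Fin 3 → R) :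
    vec11 (rot z x) = rot z (vec11 x) ∧ vec15 (rot z x) = rot z (vec15 x) := by
  have hp : z * x 0 * (z ^ 4 * x 2) = x 0 * x 2 := by linear_combination x 0 * x 2 * hz
  have hq : (z * x 0) ^ 5 + (z ^ 4 * x 2) ^ 5 = x 0 ^ 5 + x 2 ^ 5 := by
    linear_combination (x 0 ^ 5 + x 2 ^ 5 * (z ^ 15 + z ^ 10 + z ^ 5 + 1)) * hz
  have hw : (z ^ 4 * x 2) ^ 4 = z * x 2 ^ 4 := by
    linear_combination x 2 ^ 4 * (z ^ 11 + z ^ 6 + z) * hz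
  have hg (f : Fin 3 → R) : grad f (rot z x) = rot z (grad f x) := by
    ext j
    fin_cases j <;> simp [grad, rot, hw] <;> ring
  constructor
  · simp only [vec11]
    rw [← hg]
    simp [rot, hp, hq]
  · simp only [vec15]
    rw [← hg]
    simp [rot, hp, hq]

end Ring

/-! ### Tangency of the two fields to mirrors and to tangent planes of the cone -/

section Divisibility

variable {K : Type*} [Field K]

/-- The pairing of the form `(-1, 2c, e)` with a vector. -/
def pair (c e : K) (x : Fin 3 → K) : K := -x 0 + 2 * c * x 1 + e * x 2

theorem vec_mirror_zero {x : Fin 3 → K} (hx : x 0 = x 2) :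
    pair 0 1 (vec11 x) = 0 ∧ pair 0 1 (vec15 x) = 0 := by
  simp only [pair, vec11, vec15, grad, hx]
  constructor <;> simp

/-- The gradient of an invariant function is tangent to a mirror. So the gradients of `inv6` (`h5`)
and of `inv10` (`h9`) are tangent separately, whatever their coefficients in the two fields. -/
theorem vec_mirror {c : K} (hc : c ^ 2 + c = 1) {x : Fin 3 → K} (hx : x 0 = 2 * c * x 1 - x 2) :
    pair c (-1) (vec11 x) = 0 ∧ pair c (-1) (vec15 x) = 0 := by
  generalize hp : x 0 * x 2 = p
  generalize hq : x 0 ^ 5 + x 2 ^ 5 = q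
  have h5 : pair c (-1) (grad (d6 (x 1) p q) x) = 0 := by
    rw [← hp, ← hq]
    simp only [pair, grad, d6, Matrix.cons_val_zero, Matrix.cons_val_one, Matrix.cons_val, hx]
    generalize x 1 = y
    generalize x 2 = w
    linear_combination
      (-20 * y * w ^ 4 + 80 * c * y ^ 2 * w ^ 3 + 80 * c * y ^ 3 * w ^ 2 + 32 * c * y ^ 5
      - 160 * c ^ 2 * y ^ 3 * w ^ 2 - 160 * c ^ 2 * y ^ 4 * w + 32 * c ^ 2 * y ^ 5
      + 160 * c ^ 3 * y ^ 4 * w + 64 * c ^ 3 * y ^ 5 - 64 * c ^ 4 * y ^ 5) * hc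
  have h9 : pair c (-1) (grad (d10 (x 1) p q) x) = 0 := by
    rw [← hp, ← hq]
    simp only [pair, grad, d10, Matrix.cons_val_zero, Matrix.cons_val_one, Matrix.cons_val, hx]
    generalize x 1 = y
    generalize x 2 = w
    linear_combination
      (-400 * y * w ^ 8 - 1600 * y ^ 3 * w ^ 6 - 2560 * y ^ 5 * w ^ 4
      + 3200 * c * y ^ 2 * w ^ 7 - 3200 * c * y ^ 3 * w ^ 6 + 9600 * c * y ^ 4 * w ^ 5
      - 8320 * c * y ^ 5 * w ^ 4 + 10240 * c * y ^ 6 * w ^ 3 - 2560 * c * y ^ 7 * w ^ 2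
      - 11200 * c ^ 2 * y ^ 3 * w ^ 6 + 19200 * c ^ 2 * y ^ 4 * w ^ 5
      - 26880 * c ^ 2 * y ^ 5 * w ^ 4 + 33280 * c ^ 2 * y ^ 6 * w ^ 3
      - 33280 * c ^ 2 * y ^ 7 * w ^ 2 + 5120 * c ^ 2 * y ^ 8 * w
      + 22400 * c ^ 3 * y ^ 4 * w ^ 5 - 54400 * c ^ 3 * y ^ 5 * w ^ 4
      + 43520 * c ^ 3 * y ^ 6 * w ^ 3 - 58880 * c ^ 3 * y ^ 7 * w ^ 2
      + 46080 * c ^ 3 * y ^ 8 * w - 26880 * c ^ 4 * y ^ 5 * w ^ 4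
      + 89600 * c ^ 4 * y ^ 6 * w ^ 3 - 28160 * c ^ 4 * y ^ 7 * w ^ 2
      + 51200 * c ^ 4 * y ^ 8 * w - 20480 * c ^ 4 * y ^ 9 + 17920 * c ^ 5 * y ^ 6 * w ^ 3
      - 87040 * c ^ 5 * y ^ 7 * w ^ 2 - 5120 * c ^ 5 * y ^ 8 * w - 20480 * c ^ 5 * y ^ 9
      - 5120 * c ^ 6 * y ^ 7 * w ^ 2 + 46080 * c ^ 6 * y ^ 8 * w + 10240 * c ^ 6 * y ^ 9
      - 10240 * c ^ 7 * y ^ 9) * hc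
  have hgrad (s t : K) (f g : Fin 3 → K) :
      pair c (-1) (grad (s • f + t • g) x) =
        s * pair c (-1) (grad f x) + t * pair c (-1) (grad g x) := by
    simp [pair, grad]; ring
  simp [vec11, vec15, coef11, coef15, hp, hq, hgrad, h5, h9]

/-- The plane touches the cone, so `inv2` restricts to a square `δ²`, and `inv6`, `inv10` become
polynomials in `δ` and a second form `ε`. The normal components of the two gradients are not zero
here, but they are explicit in `δ`, `ε`, and cancel for the coefficients chosen in `coef11` and
`coef15`. -/
theorem vec_tangent {c : K} (hc : c ^ 2 + c = 1) {x : Fin 3 → K}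
    (hx : x 0 = 2 * c * x 1 + c ^ 2 * x 2) :
    pair c (c ^ 2) (vec11 x) = 0 ∧ pair c (c ^ 2) (vec15 x) = 0 := by
  generalize hp : x 0 * x 2 = p
  generalize hq : x 0 ^ 5 + x 2 ^ 5 = q
  obtain ⟨δ, hδ⟩ : ∃ δ, δ = x 1 + c * x 2 := ⟨_, rfl⟩
  obtain ⟨ε, hε⟩ : ∃ ε, ε = 2 * c * x 1 - c * x 2 := ⟨_, rfl⟩
  have h2 : inv2 (x 1) p = δ ^ 2 := by
    rw [← hp, hδ, inv2, hx]; ring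
  have h6 : inv6 (x 1) p q = -δ * ε ^ 5 := by
    rw [← hp, ← hq, hδ, hε, inv6, hx]
    generalize x 1 = y
    generalize x 2 = w
    linear_combination
      (y * w ^ 5 + c * y * w ^ 5 - 16 * c * y ^ 5 * w + 2 * c ^ 2 * y * w ^ 5
      - 16 * c ^ 2 * y ^ 5 * w + 3 * c ^ 3 * y * w ^ 5 - 32 * c ^ 3 * y ^ 5 * w
      + 5 * c ^ 4 * y * w ^ 5 - 10 * c ^ 4 * y ^ 2 * w ^ 4 - 48 * c ^ 4 * y ^ 5 * w
      + 3 * c ^ 5 * y * w ^ 5 - 20 * c ^ 5 * y ^ 2 * w ^ 4 + 40 * c ^ 5 * y ^ 3 * w ^ 3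
      - 80 * c ^ 5 * y ^ 4 * w ^ 2 - 2 * c ^ 6 * y * w ^ 5 + 10 * c ^ 6 * y ^ 2 * w ^ 4
      - 40 * c ^ 6 * y ^ 3 * w ^ 3 + c ^ 7 * y * w ^ 5 - 10 * c ^ 7 * y ^ 2 * w ^ 4
      - c ^ 8 * y * w ^ 5) * hc
  have h10 : inv10 (x 1) p q = ε ^ 10 - 128 * δ ^ 5 * ε ^ 5 := by
    rw [← hp, ← hq, hδ, hε, inv10, hx]
    generalize x 1 = y
    generalize x 2 = w
    linear_combination
      (-w ^ 10 + 128 * y ^ 5 * w ^ 5 - c * w ^ 10 - 160 * c * y ^ 4 * w ^ 6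
      + 128 * c * y ^ 5 * w ^ 5 - 2 * c ^ 2 * w ^ 10 - 160 * c ^ 2 * y ^ 4 * w ^ 6
      + 256 * c ^ 2 * y ^ 5 * w ^ 5 - 1280 * c ^ 2 * y ^ 8 * w ^ 2 - 3 * c ^ 3 * w ^ 10
      + 80 * c ^ 3 * y ^ 2 * w ^ 8 - 320 * c ^ 3 * y ^ 4 * w ^ 6
      + 384 * c ^ 3 * y ^ 5 * w ^ 5 - 1280 * c ^ 3 * y ^ 8 * w ^ 2 - 5 * c ^ 4 * w ^ 10
      + 20 * c ^ 4 * y * w ^ 9 + 80 * c ^ 4 * y ^ 2 * w ^ 8 - 480 * c ^ 4 * y ^ 4 * w ^ 6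
      + 640 * c ^ 4 * y ^ 5 * w ^ 5 + 1280 * c ^ 4 * y ^ 6 * w ^ 4
      - 2560 * c ^ 4 * y ^ 8 * w ^ 2 - 8 * c ^ 5 * w ^ 10 + 20 * c ^ 5 * y * w ^ 9
      + 160 * c ^ 5 * y ^ 2 * w ^ 8 - 800 * c ^ 5 * y ^ 4 * w ^ 6
      + 1280 * c ^ 5 * y ^ 5 * w ^ 5 + 5120 * c ^ 5 * y ^ 7 * w ^ 3
      - 14080 * c ^ 5 * y ^ 8 * w ^ 2 + 10240 * c ^ 5 * y ^ 9 * w - 13 * c ^ 6 * w ^ 10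
      + 40 * c ^ 6 * y * w ^ 9 + 240 * c ^ 6 * y ^ 2 * w ^ 8 - 1440 * c ^ 6 * y ^ 4 * w ^ 6
      - 4480 * c ^ 6 * y ^ 5 * w ^ 5 + 26880 * c ^ 6 * y ^ 6 * w ^ 4
      - 46080 * c ^ 6 * y ^ 7 * w ^ 3 + 34560 * c ^ 6 * y ^ 8 * w ^ 2
      - 5120 * c ^ 6 * y ^ 9 * w - 21 * c ^ 7 * w ^ 10 + 60 * c ^ 7 * y * w ^ 9
      + 400 * c ^ 7 * y ^ 2 * w ^ 8 + 640 * c ^ 7 * y ^ 3 * w ^ 7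
      - 15040 * c ^ 7 * y ^ 4 * w ^ 6 + 48000 * c ^ 7 * y ^ 5 * w ^ 5
      - 75520 * c ^ 7 * y ^ 6 * w ^ 4 + 61440 * c ^ 7 * y ^ 7 * w ^ 3
      - 23040 * c ^ 7 * y ^ 8 * w ^ 2 + 5120 * c ^ 7 * y ^ 9 * w - 34 * c ^ 8 * w ^ 10
      + 100 * c ^ 8 * y * w ^ 9 + 1660 * c ^ 8 * y ^ 2 * w ^ 8
      - 12160 * c ^ 8 * y ^ 3 * w ^ 7 + 34720 * c ^ 8 * y ^ 4 * w ^ 6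
      - 58880 * c ^ 8 * y ^ 5 * w ^ 5 + 53760 * c ^ 8 * y ^ 6 * w ^ 4
      - 30720 * c ^ 8 * y ^ 7 * w ^ 3 + 11520 * c ^ 8 * y ^ 8 * w ^ 2 - 55 * c ^ 9 * w ^ 10
      + 740 * c ^ 9 * y * w ^ 9 - 4340 * c ^ 9 * y ^ 2 * w ^ 8
      + 14080 * c ^ 9 * y ^ 3 * w ^ 7 - 31520 * c ^ 9 * y ^ 4 * w ^ 6
      + 40320 * c ^ 9 * y ^ 5 * w ^ 5 - 40320 * c ^ 9 * y ^ 6 * w ^ 4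
      + 30720 * c ^ 9 * y ^ 7 * w ^ 3 - 11520 * c ^ 9 * y ^ 8 * w ^ 2
      + 5120 * c ^ 9 * y ^ 9 * w + 34 * c ^ 10 * w ^ 10 - 460 * c ^ 10 * y * w ^ 9
      + 2620 * c ^ 10 * y ^ 2 * w ^ 8 - 9280 * c ^ 10 * y ^ 3 * w ^ 7
      + 16800 * c ^ 10 * y ^ 4 * w ^ 6 - 24192 * c ^ 10 * y ^ 5 * w ^ 5
      + 26880 * c ^ 10 * y ^ 6 * w ^ 4 - 15360 * c ^ 10 * y ^ 7 * w ^ 3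
      + 11520 * c ^ 10 * y ^ 8 * w ^ 2 - 21 * c ^ 11 * w ^ 10 + 280 * c ^ 11 * y * w ^ 9
      - 1720 * c ^ 11 * y ^ 2 * w ^ 8 + 4800 * c ^ 11 * y ^ 3 * w ^ 7
      - 10080 * c ^ 11 * y ^ 4 * w ^ 6 + 16128 * c ^ 11 * y ^ 5 * w ^ 5
      - 13440 * c ^ 11 * y ^ 6 * w ^ 4 + 15360 * c ^ 11 * y ^ 7 * w ^ 3
      + 13 * c ^ 12 * w ^ 10 - 180 * c ^ 12 * y * w ^ 9 + 900 * c ^ 12 * y ^ 2 * w ^ 8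
      - 2880 * c ^ 12 * y ^ 3 * w ^ 7 + 6720 * c ^ 12 * y ^ 4 * w ^ 6
      - 8064 * c ^ 12 * y ^ 5 * w ^ 5 + 13440 * c ^ 12 * y ^ 6 * w ^ 4 - 8 * c ^ 13 * w ^ 10
      + 100 * c ^ 13 * y * w ^ 9 - 540 * c ^ 13 * y ^ 2 * w ^ 8
      + 1920 * c ^ 13 * y ^ 3 * w ^ 7 - 3360 * c ^ 13 * y ^ 4 * w ^ 6
      + 8064 * c ^ 13 * y ^ 5 * w ^ 5 + 5 * c ^ 14 * w ^ 10 - 60 * c ^ 14 * y * w ^ 9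
      + 360 * c ^ 14 * y ^ 2 * w ^ 8 - 960 * c ^ 14 * y ^ 3 * w ^ 7
      + 3360 * c ^ 14 * y ^ 4 * w ^ 6 - 3 * c ^ 15 * w ^ 10 + 40 * c ^ 15 * y * w ^ 9
      - 180 * c ^ 15 * y ^ 2 * w ^ 8 + 960 * c ^ 15 * y ^ 3 * w ^ 7 + 2 * c ^ 16 * w ^ 10
      - 20 * c ^ 16 * y * w ^ 9 + 180 * c ^ 16 * y ^ 2 * w ^ 8 - c ^ 17 * w ^ 10
      + 20 * c ^ 17 * y * w ^ 9 + c ^ 18 * w ^ 10) * hc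
  have h5 : pair c (c ^ 2) (grad (d6 (x 1) p q) x) = (2 - c) * (-10 * δ * ε ^ 4) := by
    rw [← hp, ← hq, hδ, hε]
    simp only [pair, grad, d6, Matrix.cons_val_zero, Matrix.cons_val_one, Matrix.cons_val, hx]
    generalize x 1 = y
    generalize x 2 = w
    linear_combination
      (-10 * y * w ^ 4 + 2 * c * w ^ 5 - 10 * c * y * w ^ 4 + 32 * c * y ^ 5
      + 2 * c ^ 2 * w ^ 5 - 20 * c ^ 2 * y * w ^ 4 - 160 * c ^ 2 * y ^ 4 * w
      + 32 * c ^ 2 * y ^ 5 + 4 * c ^ 3 * w ^ 5 - 30 * c ^ 3 * y * w ^ 4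
      - 160 * c ^ 3 * y ^ 4 * w + 64 * c ^ 3 * y ^ 5 + 6 * c ^ 4 * w ^ 5
      - 70 * c ^ 4 * y * w ^ 4 + 240 * c ^ 4 * y ^ 2 * w ^ 3 - 480 * c ^ 4 * y ^ 3 * w ^ 2
      + 320 * c ^ 4 * y ^ 4 * w - 224 * c ^ 4 * y ^ 5 - 10 * c ^ 5 * w ^ 5
      + 90 * c ^ 5 * y * w ^ 4 - 320 * c ^ 5 * y ^ 2 * w ^ 3 + 400 * c ^ 5 * y ^ 3 * w ^ 2
      - 480 * c ^ 5 * y ^ 4 * w + 6 * c ^ 6 * w ^ 5 - 60 * c ^ 6 * y * w ^ 4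
      + 160 * c ^ 6 * y ^ 2 * w ^ 3 - 400 * c ^ 6 * y ^ 3 * w ^ 2 - 4 * c ^ 7 * w ^ 5
      + 30 * c ^ 7 * y * w ^ 4 - 160 * c ^ 7 * y ^ 2 * w ^ 3 + 2 * c ^ 8 * w ^ 5
      - 30 * c ^ 8 * y * w ^ 4 - 2 * c ^ 9 * w ^ 5) * hc
  have h9 : pair c (c ^ 2) (grad (d10 (x 1) p q) x) =
      (2 - c) * (20 * ε ^ 9 - 1280 * δ ^ 5 * ε ^ 4) := by
    rw [← hp, ← hq, hδ, hε]
    simp only [pair, grad, d10, Matrix.cons_val_zero, Matrix.cons_val_one, Matrix.cons_val, hx]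
    generalize x 1 = y
    generalize x 2 = w
    linear_combination
      (20 * w ^ 9 - 1280 * y ^ 5 * w ^ 4 + 20 * c * w ^ 9 + 3200 * c * y ^ 4 * w ^ 5
      - 1280 * c * y ^ 5 * w ^ 4 + 40 * c ^ 2 * w ^ 9 - 1280 * c ^ 2 * y ^ 3 * w ^ 6
      + 3200 * c ^ 2 * y ^ 4 * w ^ 5 - 2560 * c ^ 2 * y ^ 5 * w ^ 4
      + 5120 * c ^ 2 * y ^ 8 * w + 60 * c ^ 3 * w ^ 9 - 1280 * c ^ 3 * y ^ 2 * w ^ 7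
      - 1280 * c ^ 3 * y ^ 3 * w ^ 6 + 6400 * c ^ 3 * y ^ 4 * w ^ 5
      - 3840 * c ^ 3 * y ^ 5 * w ^ 4 - 20480 * c ^ 3 * y ^ 7 * w ^ 2
      + 5120 * c ^ 3 * y ^ 8 * w + 100 * c ^ 4 * w ^ 9 - 40 * c ^ 4 * y * w ^ 8
      - 1280 * c ^ 4 * y ^ 2 * w ^ 7 - 2560 * c ^ 4 * y ^ 3 * w ^ 6
      + 9600 * c ^ 4 * y ^ 4 * w ^ 5 - 8960 * c ^ 4 * y ^ 5 * w ^ 4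
      + 10240 * c ^ 4 * y ^ 6 * w ^ 3 - 81920 * c ^ 4 * y ^ 7 * w ^ 2
      + 92160 * c ^ 4 * y ^ 8 * w - 40960 * c ^ 4 * y ^ 9 + 200 * c ^ 5 * w ^ 9
      - 40 * c ^ 5 * y * w ^ 8 - 2560 * c ^ 5 * y ^ 2 * w ^ 7 - 3840 * c ^ 5 * y ^ 3 * w ^ 6
      + 3200 * c ^ 5 * y ^ 4 * w ^ 5 + 104960 * c ^ 5 * y ^ 5 * w ^ 4
      - 307200 * c ^ 5 * y ^ 6 * w ^ 3 + 337920 * c ^ 5 * y ^ 7 * w ^ 2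
      - 148480 * c ^ 5 * y ^ 8 * w - 20480 * c ^ 5 * y ^ 9 + 300 * c ^ 6 * w ^ 9
      - 80 * c ^ 6 * y * w ^ 8 - 3840 * c ^ 6 * y ^ 2 * w ^ 7
      - 32000 * c ^ 6 * y ^ 3 * w ^ 6 + 234880 * c ^ 6 * y ^ 4 * w ^ 5
      - 569600 * c ^ 6 * y ^ 5 * w ^ 4 + 675840 * c ^ 6 * y ^ 6 * w ^ 3
      - 358400 * c ^ 6 * y ^ 7 * w ^ 2 + 46080 * c ^ 6 * y ^ 8 * w + 10240 * c ^ 6 * y ^ 9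
      + 500 * c ^ 7 * w ^ 9 - 120 * c ^ 7 * y * w ^ 8 - 32000 * c ^ 7 * y ^ 2 * w ^ 7
      + 184320 * c ^ 7 * y ^ 3 * w ^ 6 - 478720 * c ^ 7 * y ^ 4 * w ^ 5
      + 661760 * c ^ 7 * y ^ 5 * w ^ 4 - 450560 * c ^ 7 * y ^ 6 * w ^ 3
      + 184320 * c ^ 7 * y ^ 7 * w ^ 2 - 10240 * c ^ 7 * y ^ 9 + 800 * c ^ 8 * w ^ 9
      - 13000 * c ^ 8 * y * w ^ 8 + 79680 * c ^ 8 * y ^ 2 * w ^ 7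
      - 257280 * c ^ 8 * y ^ 3 * w ^ 6 + 472960 * c ^ 8 * y ^ 4 * w ^ 5
      - 522240 * c ^ 8 * y ^ 5 * w ^ 4 + 430080 * c ^ 8 * y ^ 6 * w ^ 3
      - 184320 * c ^ 8 * y ^ 7 * w ^ 2 + 46080 * c ^ 8 * y ^ 8 * w - 1300 * c ^ 9 * w ^ 9
      + 14520 * c ^ 9 * y * w ^ 8 - 70720 * c ^ 9 * y ^ 2 * w ^ 7
      + 189440 * c ^ 9 * y ^ 3 * w ^ 6 - 332160 * c ^ 9 * y ^ 4 * w ^ 5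
      + 403200 * c ^ 9 * y ^ 5 * w ^ 4 - 322560 * c ^ 9 * y ^ 6 * w ^ 3
      + 184320 * c ^ 9 * y ^ 7 * w ^ 2 - 46080 * c ^ 9 * y ^ 8 * w + 10240 * c ^ 9 * y ^ 9
      + 800 * c ^ 10 * w ^ 9 - 9080 * c ^ 10 * y * w ^ 8 + 42560 * c ^ 10 * y ^ 2 * w ^ 7
      - 122240 * c ^ 10 * y ^ 3 * w ^ 6 + 201600 * c ^ 10 * y ^ 4 * w ^ 5
      - 241920 * c ^ 10 * y ^ 5 * w ^ 4 + 215040 * c ^ 10 * y ^ 6 * w ^ 3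
      - 92160 * c ^ 10 * y ^ 7 * w ^ 2 + 46080 * c ^ 10 * y ^ 8 * w - 500 * c ^ 11 * w ^ 9
      + 5440 * c ^ 11 * y * w ^ 8 - 28160 * c ^ 11 * y ^ 2 * w ^ 7
      + 67200 * c ^ 11 * y ^ 3 * w ^ 6 - 120960 * c ^ 11 * y ^ 4 * w ^ 5
      + 161280 * c ^ 11 * y ^ 5 * w ^ 4 - 107520 * c ^ 11 * y ^ 6 * w ^ 3
      + 92160 * c ^ 11 * y ^ 7 * w ^ 2 + 300 * c ^ 12 * w ^ 9 - 3640 * c ^ 12 * y * w ^ 8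
      + 14400 * c ^ 12 * y ^ 2 * w ^ 7 - 40320 * c ^ 12 * y ^ 3 * w ^ 6
      + 80640 * c ^ 12 * y ^ 4 * w ^ 5 - 80640 * c ^ 12 * y ^ 5 * w ^ 4
      + 107520 * c ^ 12 * y ^ 6 * w ^ 3 - 200 * c ^ 13 * w ^ 9 + 1800 * c ^ 13 * y * w ^ 8
      - 8640 * c ^ 13 * y ^ 2 * w ^ 7 + 26880 * c ^ 13 * y ^ 3 * w ^ 6
      - 40320 * c ^ 13 * y ^ 4 * w ^ 5 + 80640 * c ^ 13 * y ^ 5 * w ^ 4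
      + 100 * c ^ 14 * w ^ 9 - 1080 * c ^ 14 * y * w ^ 8 + 5760 * c ^ 14 * y ^ 2 * w ^ 7
      - 13440 * c ^ 14 * y ^ 3 * w ^ 6 + 40320 * c ^ 14 * y ^ 4 * w ^ 5
      - 60 * c ^ 15 * w ^ 9 + 720 * c ^ 15 * y * w ^ 8 - 2880 * c ^ 15 * y ^ 2 * w ^ 7
      + 13440 * c ^ 15 * y ^ 3 * w ^ 6 + 40 * c ^ 16 * w ^ 9 - 360 * c ^ 16 * y * w ^ 8
      + 2880 * c ^ 16 * y ^ 2 * w ^ 7 - 20 * c ^ 17 * w ^ 9 + 360 * c ^ 17 * y * w ^ 8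
      + 20 * c ^ 18 * w ^ 9) * hc
  have hgrad (s t : K) (f g : Fin 3 → K) :
      pair c (c ^ 2) (grad (s • f + t • g) x) =
        s * pair c (c ^ 2) (grad f x) + t * pair c (c ^ 2) (grad g x) := by
    simp [pair, grad]; ring
  constructor
  · rw [vec11, hp, hq, coef11, hgrad, h5, h9, h2, h6]
    ring
  · rw [vec15, hp, hq, coef15, hgrad, h5, h9, h2, h6, h10]
    ring

theorem vec_apply_zero {x : Fin 3 → K} (hx : x 0 = 0) : vec11 x 0 = 0 ∧ vec15 x 0 = 0 := by
  constructor
  · simp only [vec11, grad, coef11, d6, d10, inv2, inv6, hx, Pi.add_apply, Pi.smul_apply,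
      smul_eq_mul, Matrix.cons_val_zero, Matrix.cons_val_one, Matrix.cons_val]
    ring
  · simp only [vec15, grad, coef15, d6, d10, inv2, inv6, inv10, hx, Pi.add_apply, Pi.smul_apply,
      smul_eq_mul, Matrix.cons_val_zero, Matrix.cons_val_one, Matrix.cons_val]
    ring

theorem vec_apply_two {x : Fin 3 → K} (hx : x 2 = 0) : vec11 x 2 = 0 ∧ vec15 x 2 = 0 := by
  constructor
  · simp only [vec11, grad, coef11, d6, d10, inv2, inv6, hx, Pi.add_apply, Pi.smul_apply,
      smul_eq_mul, Matrix.cons_val_zero, Matrix.cons_val_one, Matrix.cons_val]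
    ring
  · simp only [vec15, grad, coef15, d6, d10, inv2, inv6, inv10, hx, Pi.add_apply, Pi.smul_apply,
      smul_eq_mul, Matrix.cons_val_zero, Matrix.cons_val_one, Matrix.cons_val]
    ring

end Divisibility

end Klein

/-! ### The homogeneous basis of degrees 1, 11 and 15 -/

-- For fixed `x` both sides are polynomials in `t` that agree on an infinite field; comparing
-- coefficients kills all components of degree other than `n`.
open MvPolynomial in
theorem MvPolynomial.IsHomogeneous.of_eval_smul {K σ : Type*} [Field K] [Infinite K]
    {p : MvPolynomial σ K} {n : ℕ} (h : ∀ (t : K) (x : σ → K), eval (t • x) p = t ^ n * eval x p) :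
    p.IsHomogeneous n := by
  have hsmul (i : ℕ) (t : K) (x : σ → K) :
      eval (t • x) (homogeneousComponent i p) = t ^ i * eval x (homogeneousComponent i p) := by
    rw [eval_eq, eval_eq, Finset.mul_sum]
    refine Finset.sum_congr rfl fun d hd => ?_
    have hd' := (homogeneousComponent_isHomogeneous i p).degree_eq_sum_deg_support hd
    simp only [Pi.smul_apply, smul_eq_mul, mul_pow, Finset.prod_mul_distrib,
      Finset.prod_pow_eq_pow_sum]
    rw [← hd']
    ring
  have hzero (i : ℕ) (hi : i ≠ n) : homogeneousComponent i p = 0 := by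
    refine MvPolynomial.funext fun x => ?_
    rw [map_zero]
    set f : Polynomial K := ∑ i ∈ Finset.range (p.totalDegree + 1),
      Polynomial.C (eval x (homogeneousComponent i p)) * Polynomial.X ^ i -
        Polynomial.C (eval x p) * Polynomial.X ^ n with hf
    have hf0 : f = 0 := by
      refine Polynomial.funext fun t => ?_
      have h1 := h t x
      conv_lhs at h1 => rw [← sum_homogeneousComponent p, map_sum]
      simp only [hsmul] at h1
      simp only [hf, Polynomial.eval_sub, Polynomial.eval_finsetSum, Polynomial.eval_mul,
        Polynomial.eval_C, Polynomial.eval_pow, Polynomial.eval_X, Polynomial.eval_zero]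
      rw [sub_eq_zero, mul_comm (eval x p), ← h1]
      exact Finset.sum_congr rfl fun i _ => mul_comm _ _
    by_cases hip : i < p.totalDegree + 1
    · have h2 := congrArg (fun g => Polynomial.coeff g i) hf0
      simpa [hf, Polynomial.coeff_X_pow, hi, hip, Finset.sum_ite_eq] using h2
    · rw [homogeneousComponent_eq_zero _ _ (by omega), map_zero]
  rw [← sum_homogeneousComponent p]
  refine IsHomogeneous.sum _ _ _ fun i _ => ?_
  by_cases hi : i = n
  · exact hi ▸ homogeneousComponent_isHomogeneous i p
  · rw [hzero i hi]
    exact isHomogeneous_zero _ _ _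

namespace Klein

open MvPolynomial LogField

variable {K : Type*} [Field K]

/-- The forms that define the 27 planes, in coordinates adapted to an axis of order five. -/
def IsStd (v : Fin 3 → K) : Prop :=
  v = ![1, 0, 0] ∨ v = ![0, 0, 1] ∨ ∃ c e z : K, z ^ 5 = 1 ∧
    (c = 0 ∧ e = 1 ∨ c ^ 2 + c = 1 ∧ (e = -1 ∨ e = c ^ 2)) ∧ v = ![-1, 2 * c * z, e * z ^ 2]

theorem dotProduct_rot (c e : K) {z : K} (hz : z ^ 5 = 1) (x : Fin 3 → K) :
    ![-1, 2 * c * z, e * z ^ 2] ⬝ᵥ rot z x = z * pair c e x := by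
  simp only [dotProduct, Fin.sum_univ_three, rot, pair, Matrix.cons_val_zero, Matrix.cons_val_one,
    Matrix.cons_val]
  linear_combination e * z * x 2 * hz

theorem rot_rot {z : K} (hz : z ^ 5 = 1) (x : Fin 3 → K) : rot z (rot (z ^ 4) x) = x := by
  have h : z ^ 4 * (z ^ 4) ^ 4 = 1 := by
    linear_combination (z ^ 15 + z ^ 10 + z ^ 5 + 1) * hz
  ext j
  fin_cases j
  · simp only [rot, Fin.zero_eta, Matrix.cons_val_zero]
    linear_combination x 0 * hz
  · rfl
  · simp only [rot, Fin.reduceFinMk, Matrix.cons_val]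
    linear_combination x 2 * h

/-- Rotating by `z` reduces the third family to `z = 1`, that is, to `vec_mirror_zero`, `vec_mirror`
and `vec_tangent`. -/
theorem IsStd.tangent {v : Fin 3 → K} (hv : IsStd v) {x : Fin 3 → K} (hx : v ⬝ᵥ x = 0) :
    v ⬝ᵥ vec11 x = 0 ∧ v ⬝ᵥ vec15 x = 0 := by
  rcases hv with rfl | rfl | ⟨c, e, z, hz, hce, rfl⟩
  · simp only [dotProduct, Fin.sum_univ_three, Matrix.cons_val_zero, Matrix.cons_val_one,
      Matrix.cons_val, one_mul, zero_mul, add_zero] at hx ⊢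
    exact vec_apply_zero hx
  · simp only [dotProduct, Fin.sum_univ_three, Matrix.cons_val_zero, Matrix.cons_val_one,
      Matrix.cons_val, one_mul, zero_mul, zero_add] at hx ⊢
    exact vec_apply_two hx
  · have hz0 : z ≠ 0 := by
      rintro rfl
      norm_num at hz
    obtain ⟨x', rfl⟩ : ∃ x', x = rot z x' := ⟨_, (rot_rot hz x).symm⟩
    rw [(vec_rot hz x').1, (vec_rot hz x').2]
    rw [dotProduct_rot c e hz] at hx ⊢
    rw [dotProduct_rot c e hz]
    have hx' := (mul_eq_zero.1 hx).resolve_left hz0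
    suffices pair c e (vec11 x') = 0 ∧ pair c e (vec15 x') = 0 by
      rw [this.1, this.2, mul_zero]
      exact ⟨rfl, rfl⟩
    rcases hce with ⟨rfl, rfl⟩ | ⟨hc, rfl | rfl⟩
    · exact vec_mirror_zero (by simp only [pair] at hx'; linear_combination -hx')
    · exact vec_mirror hc (by simp only [pair] at hx'; linear_combination -hx')
    · exact vec_tangent hc (by simp only [pair] at hx'; linear_combination -hx')

/-- The vector field of degree 11 is not radial along any of the planes. -/
theorem IsStd.exists_not_radial [CharZero K] {v : Fin 3 → K} (hv : IsStd v) :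
    ∃ (x : Fin 3 → K) (i j : Fin 3), v ⬝ᵥ x = 0 ∧ x i * vec11 x j ≠ x j * vec11 x i := by
  -- `a² - ab - b²` is the product of `a + bc` with its conjugate, `c` being replaced by `-1 - c`.
  have hne {c : K} (hc : c ^ 2 + c = 1) (a b : K) (hab : a ^ 2 - a * b - b ^ 2 ≠ 0) :
      a + b * c ≠ 0 := fun h => hab (by
    linear_combination (a - b - b * c) * h + b ^ 2 * hc)
  rcases hv with rfl | rfl | ⟨c, e, z, hz, hce, rfl⟩
  · refine ⟨![0, 1, 1], 1, 2, by simp [dotProduct, Fin.sum_univ_three], ?_⟩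
    simp only [vec11, grad, coef11, d6, d10, inv2, inv6, Pi.add_apply, Pi.smul_apply,
      smul_eq_mul, Matrix.cons_val_zero, Matrix.cons_val_one, Matrix.cons_val]
    norm_num
  · refine ⟨![1, 1, 0], 1, 0, by simp [dotProduct, Fin.sum_univ_three], ?_⟩
    simp only [vec11, grad, coef11, d6, d10, inv2, inv6, Pi.add_apply, Pi.smul_apply,
      smul_eq_mul, Matrix.cons_val_zero, Matrix.cons_val_one, Matrix.cons_val]
    norm_num
  · have hz0 : z ≠ 0 := by
      rintro rfl
      norm_num at hz
    suffices ∃ x : Fin 3 → K, pair c e x = 0 ∧ x 1 * vec11 x 0 ≠ x 0 * vec11 x 1 by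
      obtain ⟨x, hx, hx'⟩ := this
      refine ⟨rot z x, 1, 0, by rw [dotProduct_rot c e hz, hx, mul_zero], ?_⟩
      rw [(vec_rot hz x).1]
      simp only [rot, Matrix.cons_val_zero, Matrix.cons_val_one]
      intro h
      exact hx' (mul_left_cancel₀ hz0 (by linear_combination h))
    rcases hce with ⟨rfl, rfl⟩ | ⟨hc, rfl | rfl⟩
    · refine ⟨![1, 1, 1], by simp [pair], ?_⟩
      simp only [vec11, grad, coef11, d6, d10, inv2, inv6, Pi.add_apply, Pi.smul_apply,
        smul_eq_mul, Matrix.cons_val_zero, Matrix.cons_val_one, Matrix.cons_val]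
      norm_num
    · refine ⟨![2 * c + 1, 1, -1], ?_, ?_⟩
      · simp only [pair, Matrix.cons_val_zero, Matrix.cons_val_one, Matrix.cons_val]
        ring
      rw [← sub_ne_zero]
      convert hne hc (-165000) 313500 (by norm_num) using 1
      simp only [vec11, grad, coef11, d6, d10, inv2, inv6, Pi.add_apply, Pi.smul_apply,
        smul_eq_mul, Matrix.cons_val_zero, Matrix.cons_val_one, Matrix.cons_val]
      linear_combination (-166232 + 122544 * c - 118048 * c ^ 2 - 93184 * c ^ 3 - 241152 * c ^ 4 - 75264 * c ^ 5
      + 89088 * c ^ 6 + 98304 * c ^ 7 + 18432 * c ^ 8 + 4096 * c ^ 9) * hc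
    · refine ⟨![c + 1, 1, 1], ?_, ?_⟩
      · simp only [pair, Matrix.cons_val_zero, Matrix.cons_val_one, Matrix.cons_val]
        linear_combination hc
      rw [← sub_ne_zero]
      convert hne hc 50050 31350 (by norm_num) using 1
      simp only [vec11, grad, coef11, d6, d10, inv2, inv6, Pi.add_apply, Pi.smul_apply,
        smul_eq_mul, Matrix.cons_val_zero, Matrix.cons_val_one, Matrix.cons_val]
      linear_combination (28182 - 2946 * c - 34274 * c ^ 2 - 37110 * c ^ 3 - 21334 * c ^ 4 - 7316 * c ^ 5
      - 1282 * c ^ 6 - 18 * c ^ 7 + 20 * c ^ 8 + 2 * c ^ 9) * hc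

/-- The vector fields of degrees 1, 11 and 15. -/
noncomputable def basisFields : Matrix (Fin 3) (Fin 3) (MvPolynomial (Fin 3) K) :=
  ![X, vec11 X, vec15 X]

theorem eval_vec11 (x : Fin 3 → K) (j : Fin 3) : eval x (vec11 X j) = vec11 x j := by
  rw [map_vec11]; simp

theorem eval_vec15 (x : Fin 3 → K) (j : Fin 3) : eval x (vec15 X j) = vec15 x j := by
  rw [map_vec15]; simp

theorem linForm_smul {σ : Type*} [Fintype σ] (c : K) (a : σ → K) :
    linForm (c • a) = C c * linForm a := by
  simp [linForm, Finset.mul_sum, mul_assoc]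

theorem app_smul_left {σ : Type*} [Fintype σ] (c : K) (a : σ → K) (q : σ → MvPolynomial σ K) :
    app (c • a) q = C c * app a q := by
  simp [app, Finset.mul_sum, mul_assoc]

/-- Saito's criterion applies because `1 + 11 + 15 = 27`. `F` may contain all multiples of the
forms, and `a` selects one form for each plane. -/
theorem isHomBasis [CharZero K] {F : Set (Fin 3 → K)}
    (hF : ∀ a ∈ F, a ≠ 0 ∧ ∃ v, IsStd v ∧ ∃ c : K, a = c • v)
    {κ : Type*} [Fintype κ] (hκ : Fintype.card κ = 27) {a : κ → Fin 3 → K} (haF : ∀ i, a i ∈ F)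
    (hne : ∀ i j, i ≠ j → ¬ linForm (a i) ∣ linForm (a j)) :
    IsHomBasis F (basisFields (K := K)) ![1, 11, 15] := by
  have hlog (q : Fin 3 → MvPolynomial (Fin 3) K)
      (hq : ∀ v : Fin 3 → K, IsStd v → ∀ x, v ⬝ᵥ x = 0 → v ⬝ᵥ (fun j => eval x (q j)) = 0) :
      IsLog F q := by
    intro f hf
    obtain ⟨hf0, v, hv, c, rfl⟩ := hF f hf
    rw [linForm_smul, app_smul_left]
    refine mul_dvd_mul_left _ ((linForm_dvd_iff_eval fun h => hf0 (by rw [h, smul_zero])).2 ?_)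
    intro x hx
    rw [eval_app]
    exact hq v hv x hx
  refine isHomBasis_of_det_ne_zero (fun i => (hF _ (haF i)).1) hne haF ?_ ?_ ?_ ?_
  · intro i
    fin_cases i
    · exact isLog_X F
    · refine hlog _ fun v hv x hx => ?_
      simpa only [basisFields, Fin.mk_one, Matrix.cons_val_one, Matrix.cons_val_zero, eval_vec11]
        using (hv.tangent hx).1
    · refine hlog _ fun v hv x hx => ?_
      simpa only [basisFields, Fin.reduceFinMk, Matrix.cons_val, eval_vec15]
        using (hv.tangent hx).2
  · intro i j
    fin_cases i
    · exact isHomogeneous_X _ _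
    · refine IsHomogeneous.of_eval_smul fun t x => ?_
      change eval (t • x) (vec11 X j) = t ^ 11 * eval x (vec11 X j)
      rw [eval_vec11, eval_vec11, vec11_smul]
      rfl
    · refine IsHomogeneous.of_eval_smul fun t x => ?_
      change eval (t • x) (vec15 X j) = t ^ 15 * eval x (vec15 X j)
      rw [eval_vec15, eval_vec15, vec15_smul]
      rfl
  · intro h0
    -- One point where the determinant has a nonzero value is enough.
    have h1 := congrArg (eval (![1, 1, -1] : Fin 3 → K)) h0
    rw [map_zero, Matrix.det_fin_three] at h1
    simp only [basisFields, Matrix.cons_val_zero, Matrix.cons_val_one, Matrix.cons_val, map_add,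
      map_sub, map_mul, eval_vec11, eval_vec15, eval_X] at h1
    simp only [vec11, vec15, grad, coef11, coef15, d6, d10, inv2, inv6, inv10, Pi.add_apply,
      Pi.smul_apply, smul_eq_mul, Matrix.cons_val_zero, Matrix.cons_val_one, Matrix.cons_val] at h1
    norm_num at h1
  · rw [hκ]; rfl

end Klein

/-! ### The 27 planes in exact coordinates -/

namespace H3

/-- The cross product of two vectors. -/
def cross {R : Type*} [CommRing R] (a b : Fin 3 → R) : Fin 3 → R :=
  ![a 1 * b 2 - a 2 * b 1, a 2 * b 0 - a 0 * b 2, a 0 * b 1 - a 1 * b 0]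

/-- The scalar product of two vectors. -/
def dot {R : Type*} [CommRing R] (a b : Fin 3 → R) : R := a 0 * b 0 + a 1 * b 1 + a 2 * b 2

theorem dotProduct_eq_dot {R : Type*} [CommRing R] (a b : Fin 3 → R) : a ⬝ᵥ b = dot a b := by
  simp [dotProduct, Fin.sum_univ_three, dot]

/-- The product of a row vector and a matrix. -/
def rowMul {R : Type*} [CommRing R] (v : Fin 3 → R) (g : Fin 3 → Fin 3 → R) : Fin 3 → R :=
  fun j => v 0 * g 0 j + v 1 * g 1 j + v 2 * g 2 j

theorem map_cross {R S : Type*} [CommRing R] [CommRing S] (f : R →+* S) (a b : Fin 3 → R) :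
    cross (fun j => f (a j)) (fun j => f (b j)) = fun j => f (cross a b j) := by
  funext j
  fin_cases j <;> simp [cross]

theorem map_dot {R S : Type*} [CommRing R] [CommRing S] (f : R →+* S) (a b : Fin 3 → R) :
    dot (fun j => f (a j)) (fun j => f (b j)) = f (dot a b) := by
  simp [dot]

theorem dot_cross_left {R : Type*} [CommRing R] (a b : Fin 3 → R) : dot a (cross a b) = 0 := by
  simp [dot, cross]; ring

theorem dot_cross_right {R : Type*} [CommRing R] (a b : Fin 3 → R) : dot b (cross a b) = 0 := by
  simp [dot, cross]; ring

theorem exists_smul_of_cross_eq_zero {K : Type*} [Field K] {a b : Fin 3 → K} (ha : a ≠ 0)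
    (h : cross a b = 0) : ∃ c : K, b = c • a := by
  obtain ⟨i, hi⟩ := Function.ne_iff.1 ha
  have hi' : a i ≠ 0 := hi
  have h0 := congrFun h 0
  have h1 := congrFun h 1
  have h2 := congrFun h 2
  simp only [cross, Matrix.cons_val_zero, Matrix.cons_val_one, Matrix.cons_val,
    Pi.zero_apply] at h0 h1 h2
  refine ⟨b i / a i, funext fun j => ?_⟩
  rw [Pi.smul_apply, smul_eq_mul, div_mul_eq_mul_div, eq_div_iff hi']
  fin_cases i <;> fin_cases j <;> simp <;> grind

section Perp

variable {K : Type*} [Field K]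

theorem mem_perp {v x : Fin 3 → K} : x ∈ perp v ↔ dot v x = 0 := by
  rw [perp, LinearMap.mem_ker, dotProductEquiv_apply_apply, dotProduct_eq_dot]

theorem perp_smul {c : K} (hc : c ≠ 0) (v : Fin 3 → K) : perp (c • v) = perp v := by
  rw [perp, perp, map_smul, LinearMap.ker_smul _ _ hc]

/-- The vectors `cross v e`, `e` a standard basis vector, lie in `perp v`; that `w` annihilates them
says that the cross product vanishes. -/
theorem cross_eq_zero_of_perp_le {v w : Fin 3 → K} (h : perp v ≤ perp w) : cross v w = 0 := by
  have key (e : Fin 3 → K) : dot w (cross v e) = 0 := mem_perp.1 (h (mem_perp.2 (dot_cross_left v e)))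
  have h0 := key ![1, 0, 0]
  have h1 := key ![0, 1, 0]
  have h2 := key ![0, 0, 1]
  simp only [dot, cross, Matrix.cons_val_zero, Matrix.cons_val_one, Matrix.cons_val] at h0 h1 h2
  funext j
  fin_cases j <;>
    simp only [cross, Fin.zero_eta, Fin.mk_one, Fin.reduceFinMk, Matrix.cons_val_zero,
      Matrix.cons_val_one, Matrix.cons_val, Pi.zero_apply] <;> grind

theorem perp_eq_iff {v w : Fin 3 → K} (hv : v ≠ 0) (hw : w ≠ 0) :
    perp v = perp w ↔ cross v w = 0 := by
  refine ⟨fun h => cross_eq_zero_of_perp_le h.le, fun h => ?_⟩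
  obtain ⟨c, rfl⟩ := exists_smul_of_cross_eq_zero hv h
  rw [perp_smul fun hc => hw (by rw [hc, zero_smul])]

theorem perp_vecMul (v : Fin 3 → K) (g : Matrix (Fin 3) (Fin 3) K) :
    perp (Matrix.vecMul v g) = (perp v).comap (Matrix.mulVecLin g) := by
  ext x
  rw [Submodule.mem_comap, mem_perp, mem_perp, Matrix.mulVecLin_apply, ← dotProduct_eq_dot,
    ← dotProduct_eq_dot, Matrix.dotProduct_mulVec]

theorem dotProductEquiv_ne_zero {v : Fin 3 → K} (hv : v ≠ 0) : dotProductEquiv K (Fin 3) v ≠ 0 :=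
  (LinearEquiv.map_ne_zero_iff _).2 hv

end Perp

/-- Representatives of the 15 roots up to sign and of the 12 vectors in the orbit of
`(1, -ζ², 0)` up to scalars. -/
def normal : Fin 27 → Fin 3 → Cyc :=
  ![![1, 0, 0], ![0, 1, 0], ![0, 0, 1], ![1, ⟨0, 0, -1, -1⟩, 0], ![0, 1, 1],
    ![⟨0, 0, -1, -1⟩, 1, 0], ![1, ⟨0, 0, -1, -1⟩, ⟨0, 0, -1, -1⟩],
    ![⟨0, 0, -1, -1⟩, ⟨0, 0, -1, -1⟩, 0], ![⟨0, 0, -1, -1⟩, 1, 1],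
    ![⟨0, 0, -1, -1⟩, ⟨0, 0, -1, -1⟩, ⟨0, 0, -1, -1⟩], ![⟨0, 0, -1, -1⟩, ⟨1, 0, -1, -1⟩, 1],
    ![⟨0, 0, -1, -1⟩, ⟨1, 0, -1, -1⟩, ⟨0, 0, -1, -1⟩], ![⟨1, 0, -1, -1⟩, ⟨1, 0, -1, -1⟩, 1],
    ![⟨1, 0, -1, -1⟩, ⟨1, 0, -1, -1⟩, ⟨0, 0, -1, -1⟩],
    ![⟨1, 0, -1, -1⟩, ⟨0, 0, -2, -2⟩, ⟨0, 0, -1, -1⟩], ![1, ⟨0, 0, -1, 0⟩, 0],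
    ![1, ⟨0, 0, -1, 0⟩, ⟨0, 0, -1, 0⟩], ![⟨-1, -1, -1, -1⟩, ⟨0, 0, -1, 0⟩, 0],
    ![⟨-1, -1, -1, -1⟩, ⟨0, 0, -1, 0⟩, ⟨0, 0, -1, 0⟩], ![1, ⟨0, 0, -1, -1⟩, ⟨0, 0, -1, 0⟩],
    ![⟨-1, -1, -1, -1⟩, ⟨0, -1, -1, 0⟩, ⟨0, 0, -1, 0⟩],
    ![⟨0, 0, -1, -1⟩, ⟨0, 0, -1, -1⟩, ⟨0, 0, -1, 0⟩],
    ![⟨0, -1, -1, 0⟩, ⟨0, -1, -1, 0⟩, ⟨0, 0, -1, 0⟩],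
    ![⟨0, 0, -1, -1⟩, ⟨1, 0, -1, 0⟩, ⟨0, 0, -1, 0⟩],
    ![⟨0, -1, -1, 0⟩, ⟨-1, -1, -2, -1⟩, ⟨0, 0, -1, 0⟩], ![⟨0, 0, -1, -1⟩, ⟨1, 0, -1, 0⟩, 1],
    ![⟨0, -1, -1, -1⟩, ⟨1, 0, -1, 0⟩, ⟨0, 0, -1, 0⟩]]

/-- The generating matrices. -/
def gen : Fin 3 → Fin 3 → Fin 3 → Cyc :=
  ![![![1, 0, 0], ![0, 1, 1], ![0, 0, -1]],
    ![![-1, 0, 0], ![⟨0, 0, -1, -1⟩, 1, 0], ![0, 0, 1]],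
    ![![1, ⟨0, 0, -1, -1⟩, 0], ![0, -1, 0], ![0, 1, 1]]]

theorem normal_ne_zero : ∀ k, normal k ≠ 0 := by decide +kernel

theorem cross_normal_ne_zero : ∀ k l, k ≠ l → cross (normal k) (normal l) ≠ 0 := by
  decide +kernel

/-- The generators permute the 27 planes and preserve the two classes, given by the indices below 15
and the others. -/
theorem exists_rowMul_gen : ∀ k j, ∃ l, (l < 15 ↔ k < 15) ∧
    cross (rowMul (normal k) (gen j)) (normal l) = 0 := by
  decide +kernel

/-- The list is ordered so that every plane other than the seeds 0, 1, 2 and 15 is the image of an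
earlier one of its class; this makes an induction on the index possible. -/
theorem exists_lt_rowMul_gen : ∀ k, k < 3 ∨ k = 15 ∨ ∃ l, l < k ∧ (l < 15 ↔ k < 15) ∧
    ∃ j, cross (rowMul (normal l) (gen j)) (normal k) = 0 := by
  decide +kernel

/-- A basis adapted to an axis of order five of the icosahedron. -/
def axisBasis : Fin 3 → Fin 3 → Cyc :=
  ![![⟨-1, 1, 1, -1⟩, ⟨-2, -1, -2, 0⟩, ⟨1, 0, 0, -1⟩], ![0, 0, ⟨0, -2, 2, 0⟩],
    ![⟨1, -1, -1, 1⟩, ⟨0, 2, 1, 2⟩, ⟨1, 0, 0, -1⟩]]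

theorem axisBasis_volume : dot (axisBasis 0) (cross (axisBasis 1) (axisBasis 2)) ≠ 0 := by
  decide +kernel

/-- The coordinates of the forms with respect to `axisBasis`. -/
def axisCoords (k : Fin 27) : Fin 3 → Cyc := fun j => dot (normal k) (axisBasis j)

/-- The powers of `ζ`. -/
def zpow : Fin 5 → Cyc := ![1, ⟨0, 1, 0, 0⟩, ⟨0, 0, 1, 0⟩, ⟨0, 0, 0, 1⟩, ⟨-1, -1, -1, -1⟩]

theorem zpow_pow : ∀ m, zpow m ^ 5 = 1 := by decide +kernel

/-- The parameters `(c, e)` of the forms. -/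
def params : Fin 5 → Cyc × Cyc :=
  ![(0, 1), (⟨-1, 0, -1, -1⟩, -1), (⟨0, 0, 1, 1⟩, -1),
    (⟨-1, 0, -1, -1⟩, ⟨-1, 0, -1, -1⟩ * ⟨-1, 0, -1, -1⟩), (⟨0, 0, 1, 1⟩, ⟨0, 0, 1, 1⟩ * ⟨0, 0, 1, 1⟩)]

theorem params_spec : ∀ m, (params m).1 = 0 ∧ (params m).2 = 1 ∨
    (params m).1 ^ 2 + (params m).1 = 1 ∧ ((params m).2 = -1 ∨ (params m).2 = (params m).1 ^ 2) := by
  decide +kernel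

/-- In the adapted basis every form is proportional to one of the standard forms for which tangency
has been shown. -/
theorem axisCoords_spec : ∀ k, cross ![1, 0, 0] (axisCoords k) = 0 ∨
    cross ![0, 0, 1] (axisCoords k) = 0 ∨ ∃ m n,
      cross ![-1, 2 * (params m).1 * zpow n, (params m).2 * zpow n ^ 2] (axisCoords k) = 0 := by
  decide +kernel

end H3

theorem Cyc.eval_mk {R : Type*} [CommRing R] (z : R) (hz : z ^ 4 + z ^ 3 + z ^ 2 + z + 1 = 0)
    (a b c d : ℤ) : Cyc.eval z hz ⟨a, b, c, d⟩ = a + b * z + c * z ^ 2 + d * z ^ 3 := rfl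

/-! ### The planes as orbits of the reflection group -/

namespace H3

open LogField

section Planes

variable {K : Type*} [Field K] {ζ : K}

/-- The image of a vector over `ℤ[ζ]`. -/
noncomputable def toK (hζ : IsPrimitiveRoot ζ 5) (v : Fin 3 → Cyc) : Fin 3 → K :=
  fun j => Cyc.eval ζ hζ.sum_pow_five (v j)

theorem cross_toK (hζ : IsPrimitiveRoot ζ 5) (v w : Fin 3 → Cyc) :
    cross (toK hζ v) (toK hζ w) = toK hζ (cross v w) := map_cross _ v w

theorem dot_toK (hζ : IsPrimitiveRoot ζ 5) (v w : Fin 3 → Cyc) :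
    dot (toK hζ v) (toK hζ w) = Cyc.eval ζ hζ.sum_pow_five (dot v w) := map_dot _ v w

theorem toK_zero (hζ : IsPrimitiveRoot ζ 5) : toK hζ 0 = 0 := by
  funext j; simp [toK]

theorem toK_eq_zero_iff [CharZero K] (hζ : IsPrimitiveRoot ζ 5) {v : Fin 3 → Cyc} :
    toK hζ v = 0 ↔ v = 0 := by
  refine ⟨fun h => funext fun j => ?_, fun h => by rw [h, toK_zero]⟩
  exact Cyc.eval_injective hζ ((congrFun h j).trans (map_zero _).symm)

/-- The planes of the arrangement. -/
noncomputable def plane (hζ : IsPrimitiveRoot ζ 5) (k : Fin 27) : Submodule K (Fin 3 → K) :=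
  perp (toK hζ (normal k))

/-- The generating matrices over `K`. -/
def genK (ζ : K) : Fin 3 → Matrix (Fin 3) (Fin 3) K := ![m1, m2 ζ, m3 ζ]

theorem vecMul_genK (hζ : IsPrimitiveRoot ζ 5) (v : Fin 3 → Cyc) (j : Fin 3) :
    Matrix.vecMul (toK hζ v) (genK ζ j) = toK hζ (rowMul v (gen j)) := by
  funext i
  fin_cases j <;> fin_cases i <;>
    simp [Matrix.vecMul, dotProduct, Fin.sum_univ_three, toK, rowMul, gen, genK, m1, m2, m3, omega,
      Cyc.eval_mk, sub_eq_add_neg]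

theorem genK_mul_self (j : Fin 3) : genK ζ j * genK ζ j = 1 := by
  fin_cases j
  · exact m1_mul_self
  · exact m2_mul_self ζ
  · exact m3_mul_self ζ

theorem toK_normal_ne_zero [CharZero K] (hζ : IsPrimitiveRoot ζ 5) (k : Fin 27) : toK hζ (normal k) ≠ 0 :=
  fun h => normal_ne_zero k ((toK_eq_zero_iff hζ).1 h)

theorem plane_injective [CharZero K] (hζ : IsPrimitiveRoot ζ 5) : Function.Injective (plane hζ) := by
  intro k l h
  by_contra hkl
  have := (perp_eq_iff (toK_normal_ne_zero hζ k) (toK_normal_ne_zero hζ l)).1 h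
  rw [cross_toK, toK_eq_zero_iff] at this
  exact cross_normal_ne_zero k l hkl this

theorem vecMul_genK_ne_zero {v : Fin 3 → K} (hv : v ≠ 0) (j : Fin 3) :
    Matrix.vecMul v (genK ζ j) ≠ 0 := by
  intro h
  apply hv
  rw [← Matrix.vecMul_one v, ← genK_mul_self (ζ := ζ) j, ← Matrix.vecMul_vecMul, h,
    Matrix.zero_vecMul]

theorem comap_genK_plane [CharZero K] (hζ : IsPrimitiveRoot ζ 5) {k l : Fin 27} {j : Fin 3}
    (h : cross (rowMul (normal k) (gen j)) (normal l) = 0) :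
    (plane hζ k).comap (Matrix.mulVecLin (genK ζ j)) = plane hζ l := by
  rw [plane, ← perp_vecMul, plane, perp_eq_iff (vecMul_genK_ne_zero (toK_normal_ne_zero hζ k) j)
    (toK_normal_ne_zero hζ l), vecMul_genK, cross_toK, h, toK_zero]

theorem genK_mem_W (j : Fin 3) : ∃ g ∈ W ζ, (g : Matrix (Fin 3) (Fin 3) K) = genK ζ j := by
  fin_cases j
  · exact ⟨g1, Subgroup.subset_closure (by simp), rfl⟩
  · exact ⟨g2 ζ, Subgroup.subset_closure (by simp), rfl⟩
  · exact ⟨g3 ζ, Subgroup.subset_closure (by simp), rfl⟩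

/-- Stated as an equivalence, which passes to inverses and products, so that induction over the
generated group works. For a generator the converse holds because it is an involution. -/
theorem perp_vecMul_mem_iff {T : Set (Submodule K (Fin 3 → K))}
    (hT : ∀ H ∈ T, ∀ j, H.comap (Matrix.mulVecLin (genK ζ j)) ∈ T) {g : GL (Fin 3) K}
    (hg : g ∈ W ζ) :
    ∀ v, perp (Matrix.vecMul v (g : Matrix (Fin 3) (Fin 3) K)) ∈ T ↔ perp v ∈ T := by
  have hgen (j : Fin 3) (v : Fin 3 → K) : perp (Matrix.vecMul v (genK ζ j)) ∈ T ↔ perp v ∈ T := by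
    refine ⟨fun h => ?_, fun h => perp_vecMul v _ ▸ hT _ h j⟩
    have := hT _ h j
    rwa [← perp_vecMul, Matrix.vecMul_vecMul, genK_mul_self, Matrix.vecMul_one] at this
  induction hg using Subgroup.closure_induction with
  | mem g hg =>
    rcases hg with rfl | rfl | rfl
    · exact hgen 0
    · exact hgen 1
    · exact hgen 2
  | one => intro v; simp
  | mul g h _ _ hg hh =>
    intro v
    rw [Units.val_mul, ← Matrix.vecMul_vecMul, hh, hg]
  | inv g _ hg =>
    intro v
    rw [← hg, Matrix.vecMul_vecMul, ← Units.val_mul, inv_mul_cancel, Units.val_one,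
      Matrix.vecMul_one]

theorem comap_mem_image [CharZero K] (hζ : IsPrimitiveRoot ζ 5) {S : Set (Fin 27)}
    (hS : ∀ k l : Fin 27, (l < 15 ↔ k < 15) → k ∈ S → l ∈ S) :
    ∀ H ∈ plane hζ '' S, ∀ j, H.comap (Matrix.mulVecLin (genK ζ j)) ∈ plane hζ '' S := by
  rintro _ ⟨k, hk, rfl⟩ j
  obtain ⟨l, hl, h⟩ := exists_rowMul_gen k j
  exact ⟨l, hS k l hl hk, (comap_genK_plane hζ h).symm⟩

/-- Induction on the index: each plane is reached from an earlier one by a generator, starting from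
the seeds. It gives the inclusion of the listed planes in the orbits. -/
theorem plane_mem [CharZero K] (hζ : IsPrimitiveRoot ζ 5) {T : Set (Submodule K (Fin 3 → K))}
    (hT : ∀ H ∈ T, ∀ j, H.comap (Matrix.mulVecLin (genK ζ j)) ∈ T) {S : Set (Fin 27)}
    (hS : ∀ k l : Fin 27, (l < 15 ↔ k < 15) → k ∈ S → l ∈ S)
    (hseed : ∀ k ∈ S, k < 3 ∨ k = 15 → plane hζ k ∈ T) (k : Fin 27) (hk : k ∈ S) :
    plane hζ k ∈ T := by
  induction k using WellFoundedLT.induction with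
  | ind k ih =>
    rcases exists_lt_rowMul_gen k with h | h | ⟨l, hlk, hl, j, h⟩
    · exact hseed k hk (Or.inl h)
    · exact hseed k hk (Or.inr h)
    · rw [← comap_genK_plane hζ h]
      exact hT _ (ih l hlk (hS k l hl hk)) j

theorem comap_mem_perp_orbit (v : Fin 3 → K) :
    ∀ H ∈ perp '' orbit ζ v, ∀ j, H.comap (Matrix.mulVecLin (genK ζ j)) ∈ perp '' orbit ζ v := by
  rintro _ ⟨w, ⟨g, hg, rfl⟩, rfl⟩ j
  obtain ⟨h, hh, hj⟩ := genK_mem_W (ζ := ζ) j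
  refine ⟨_, ⟨g * h, mul_mem hg hh, rfl⟩, ?_⟩
  rw [← perp_vecMul, Units.val_mul, hj, Matrix.vecMul_vecMul]

theorem mem_orbit_self (v : Fin 3 → K) : v ∈ orbit ζ v := ⟨1, one_mem _, by simp⟩

theorem toK_normal_of_lt (hζ : IsPrimitiveRoot ζ 5) (i : Fin 3) :
    toK hζ (normal ⟨i, by omega⟩) = Pi.single i 1 := by
  funext j
  fin_cases i <;> fin_cases j <;> simp [toK, normal]

theorem toK_normal_fifteen (hζ : IsPrimitiveRoot ζ 5) :
    toK hζ (normal 15) = ![1, -ζ ^ 2, 0] := by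
  funext j
  fin_cases j <;> simp [toK, normal, Cyc.eval_mk]

theorem rootPlanes_eq [CharZero K] (hζ : IsPrimitiveRoot ζ 5) :
    rootPlanes ζ = plane hζ '' {k | k < 15} := by
  apply subset_antisymm
  · rintro _ ⟨w, ⟨i, g, hg, rfl⟩, rfl⟩
    rw [perp_vecMul_mem_iff (comap_mem_image hζ (S := {k | k < 15}) fun k l h => h.2) hg]
    refine ⟨⟨i, by omega⟩, ?_, by rw [plane, toK_normal_of_lt]⟩
    rw [Set.mem_ofPred_eq, Fin.lt_def]
    exact lt_trans i.2 (by decide)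
  · rintro _ ⟨k, hk, rfl⟩
    refine plane_mem hζ (T := rootPlanes ζ) ?_ (S := {k | k < 15}) (fun k l h => h.2) ?_ k hk
    · rintro _ ⟨w, ⟨i, hw⟩, rfl⟩ j
      obtain ⟨w', hw', h⟩ := comap_mem_perp_orbit _ _ ⟨w, hw, rfl⟩ j
      exact ⟨w', ⟨i, hw'⟩, h⟩
    · rintro k hk (h | rfl)
      · have : k = ⟨(⟨k, h⟩ : Fin 3), by omega⟩ := rfl
        rw [plane, this, toK_normal_of_lt]
        exact ⟨_, ⟨_, mem_orbit_self _⟩, rfl⟩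
      · exact absurd hk (by decide)

theorem orbitPlanes_eq [CharZero K] (hζ : IsPrimitiveRoot ζ 5) :
    orbitPlanes ζ = plane hζ '' {k | 15 ≤ k} := by
  have hS (k l : Fin 27) (h : l < 15 ↔ k < 15) (hk : 15 ≤ k) : 15 ≤ l :=
    not_lt.1 fun hl => absurd (h.1 hl) (not_lt.2 hk)
  apply subset_antisymm
  · rintro _ ⟨w, ⟨g, hg, rfl⟩, rfl⟩
    rw [perp_vecMul_mem_iff (comap_mem_image hζ (S := {k | 15 ≤ k}) hS) hg]
    exact ⟨15, le_refl (15 : Fin 27), by rw [plane, toK_normal_fifteen]⟩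
  · rintro _ ⟨k, hk, rfl⟩
    refine plane_mem hζ (comap_mem_perp_orbit _) (S := {k | 15 ≤ k}) hS ?_ k hk
    rintro k hk (h | rfl)
    · exact absurd (lt_of_le_of_lt hk h) (by decide)
    · rw [plane, toK_normal_fifteen]
      exact ⟨_, mem_orbit_self _, rfl⟩

open Classical in
/-- The arrangement of 27 planes. -/
noncomputable def arrangement [CharZero K] (hζ : IsPrimitiveRoot ζ 5) : Arrangement K (Fin 3 → K) where
  planes := Finset.univ.image (plane hζ)
  isHyperplane := by
    intro H hH
    obtain ⟨k, -, rfl⟩ := Finset.mem_image.1 hH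
    exact ⟨_, dotProductEquiv_ne_zero (toK_normal_ne_zero hζ k), rfl⟩

theorem mem_planes_iff [CharZero K] (hζ : IsPrimitiveRoot ζ 5) {H : Submodule K (Fin 3 → K)} :
    H ∈ (arrangement hζ).planes ↔ ∃ k, plane hζ k = H := by
  simp [arrangement]

theorem coe_planes [CharZero K] (hζ : IsPrimitiveRoot ζ 5) :
    ((arrangement hζ).planes : Set (Submodule K (Fin 3 → K))) = rootPlanes ζ ∪ orbitPlanes ζ := by
  rw [rootPlanes_eq hζ, orbitPlanes_eq hζ, ← Set.image_union]
  have : ({k : Fin 27 | k < 15} ∪ {k | 15 ≤ k}) = Set.univ := by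
    ext k
    simp [lt_or_ge]
  rw [this]
  simp [arrangement]

theorem ncard_rootPlanes [CharZero K] (hζ : IsPrimitiveRoot ζ 5) : (rootPlanes ζ).ncard = 15 := by
  rw [rootPlanes_eq hζ, Set.ncard_image_of_injective _ (plane_injective hζ),
    Set.ncard_eq_toFinset_card']
  decide

theorem ncard_orbitPlanes [CharZero K] (hζ : IsPrimitiveRoot ζ 5) : (orbitPlanes ζ).ncard = 12 := by
  rw [orbitPlanes_eq hζ, Set.ncard_image_of_injective _ (plane_injective hζ),
    Set.ncard_eq_toFinset_card']
  decide

theorem card_planes [CharZero K] (hζ : IsPrimitiveRoot ζ 5) : (arrangement hζ).planes.card = 27 := by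
  rw [arrangement, Finset.card_image_of_injective _ (plane_injective hζ), Finset.card_univ,
    Fintype.card_fin]

end Planes

end H3

/-! ### Freeness of the arrangement with exponents 1, 11, 15 -/

namespace Arrangement

open LogField MvPolynomial

theorem ker_le_of_linForm_coeffs_dvd {K V σ : Type*} [Field K] [Infinite K] [AddCommGroup V]
    [Module K V] [Fintype σ] [DecidableEq σ] (b : Module.Basis σ K V) {α β : Module.Dual K V}
    (hα : α ≠ 0) (h : linForm (coeffs b α) ∣ linForm (coeffs b β)) :
    LinearMap.ker α ≤ LinearMap.ker β := by
  have key (γ : Module.Dual K V) (x : V) : coeffs b γ ⬝ᵥ (b.repr x) = γ x := by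
    conv_rhs => rw [← b.sum_repr x, map_sum]
    simp only [dotProduct, coeffs, map_smul, smul_eq_mul, mul_comm]
  intro x hx
  rw [linForm_dvd_iff_eval (coeffs_ne_zero b hα)] at h
  have := h (b.repr x) (by rw [key]; exact hx)
  rwa [eval_linForm, key] at this

end Arrangement

namespace H3

open LogField Arrangement

variable {K : Type*} [Field K] {ζ : K}

theorem linearIndependent_of_dot_cross_ne_zero {b : Fin 3 → Fin 3 → K}
    (h : dot (b 0) (cross (b 1) (b 2)) ≠ 0) : LinearIndependent K b := by
  refine Matrix.linearIndependent_rows_of_det_ne_zero (A := Matrix.of b) ?_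
  convert h using 1
  rw [Matrix.det_fin_three]
  simp only [Matrix.of_apply, dot, cross, Matrix.cons_val_zero, Matrix.cons_val_one,
    Matrix.cons_val]
  ring

variable [CharZero K]

/-- The basis of `K³` adapted to an axis of order five. -/
noncomputable def axis (hζ : IsPrimitiveRoot ζ 5) : Module.Basis (Fin 3) K (Fin 3 → K) :=
  basisOfLinearIndependentOfCardEqFinrank (b := fun j => toK hζ (axisBasis j))
    (linearIndependent_of_dot_cross_ne_zero (by
      rw [cross_toK, dot_toK]
      exact (map_ne_zero_iff _ (Cyc.eval_injective hζ)).2 axisBasis_volume)) (by simp)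

theorem coeffs_axis (hζ : IsPrimitiveRoot ζ 5) (k : Fin 27) :
    coeffs (axis hζ) (dotProductEquiv K (Fin 3) (toK hζ (normal k))) = toK hζ (axisCoords k) := by
  funext j
  rw [coeffs, axis, coe_basisOfLinearIndependentOfCardEqFinrank, dotProductEquiv_apply_apply,
    dotProduct_eq_dot, dot_toK]
  rfl

/-- Transfers the finite check `axisCoords_spec` to `K` by evaluation. -/
theorem exists_isStd (hζ : IsPrimitiveRoot ζ 5) (k : Fin 27) :
    ∃ v, Klein.IsStd v ∧ ∃ c : K, toK hζ (axisCoords k) = c • v := by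
  have hc (v : Fin 3 → Cyc) (hv : v ≠ 0) (h : cross v (axisCoords k) = 0) :
      ∃ c : K, toK hζ (axisCoords k) = c • toK hζ v :=
    exists_smul_of_cross_eq_zero (fun h0 => hv ((toK_eq_zero_iff hζ).1 h0))
      (by rw [cross_toK, h, toK_zero])
  rcases axisCoords_spec k with h | h | ⟨m, n, h⟩
  · refine ⟨_, ?_, hc _ (by decide) h⟩
    left
    funext j
    fin_cases j <;> simp [toK]
  · refine ⟨_, ?_, hc _ (by decide) h⟩
    right; left
    funext j
    fin_cases j <;> simp [toK]
  · refine ⟨_, ?_, hc _ (fun h0 => absurd (congrFun h0 0) (by decide : (-1 : Cyc) ≠ 0)) h⟩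
    right; right
    set φ := Cyc.eval ζ hζ.sum_pow_five with hφ
    refine ⟨φ (params m).1, φ (params m).2, φ (zpow n), ?_, ?_, ?_⟩
    · rw [← map_pow, zpow_pow, map_one]
    · rcases params_spec m with ⟨h1, h2⟩ | ⟨h1, h2 | h2⟩
      · left; rw [h1, h2, map_zero, map_one]; exact ⟨rfl, rfl⟩
      · right
        rw [← map_pow, ← map_add, h1, h2, map_one, map_neg, map_one]
        exact ⟨rfl, Or.inl rfl⟩
      · right
        rw [← map_pow, ← map_add, h1, h2, map_one]
        exact ⟨rfl, Or.inr rfl⟩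
    · have h2 : φ 2 = 2 := map_ofNat φ 2
      funext j
      fin_cases j <;> simp [toK, ← hφ, h2]

theorem formSet_axis (hζ : IsPrimitiveRoot ζ 5) {a : Fin 3 → K}
    (ha : a ∈ (arrangement hζ).formSet (axis hζ)) :
    ∃ k, ∃ c : K, a = c • toK hζ (axisCoords k) := by
  obtain ⟨α, hα, hk, rfl⟩ := ha
  obtain ⟨k, hk⟩ := (mem_planes_iff hζ).1 hk
  obtain ⟨c, rfl⟩ := Module.Dual.exists_smul_of_ker_le
    (dotProductEquiv_ne_zero (toK_normal_ne_zero hζ k)) hk.le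
  exact ⟨k, c, by rw [← coeffs_axis]; rfl⟩

theorem isHomBasis_axis (hζ : IsPrimitiveRoot ζ 5) :
    IsHomBasis ((arrangement hζ).formSet (axis hζ)) (Klein.basisFields (K := K)) ![1, 11, 15] := by
  refine Klein.isHomBasis ?_ (Fintype.card_fin 27)
    (a := fun k => coeffs (axis hζ) (dotProductEquiv K (Fin 3) (toK hζ (normal k)))) ?_ ?_
  · intro a ha
    refine ⟨?_, ?_⟩
    · obtain ⟨α, hα, -, rfl⟩ := ha
      exact coeffs_ne_zero _ hα
    · obtain ⟨k, c, rfl⟩ := formSet_axis hζ ha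
      obtain ⟨v, hv, d, h⟩ := exists_isStd hζ k
      exact ⟨v, hv, c * d, by rw [h, smul_smul]⟩
  · intro k
    exact ⟨_, dotProductEquiv_ne_zero (toK_normal_ne_zero hζ k), (mem_planes_iff hζ).2 ⟨k, rfl⟩,
      rfl⟩
  · intro k l hkl h
    have hk := dotProductEquiv_ne_zero (toK_normal_ne_zero hζ k)
    have hl := dotProductEquiv_ne_zero (toK_normal_ne_zero hζ l)
    exact hkl (plane_injective hζ (Module.Dual.ker_eq_of_ker_le hk hl
      (ker_le_of_linForm_coeffs_dvd _ hk h)))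

theorem hasExponents (hζ : IsPrimitiveRoot ζ 5) :
    (arrangement hζ).HasExponents {1, 11, 15} := by
  rw [hasExponents_iff _ (axis hζ)]
  have e : Fin (Module.finrank K (Fin 3 → K)) ≃ Fin 3 := finCongr (by simp)
  refine ⟨_, _, (isHomBasis_axis hζ).reindex e, ?_⟩
  rw [← Multiset.map_map]
  have : Multiset.map e Finset.univ.val = Finset.univ.val :=
    congrArg Finset.val (Finset.map_univ_equiv e)
  rw [this]
  rfl

end H3

/-! ### Compatible triples and exponents in general -/

theorem Multiset.exists_ne_of_pair_le {I : Type*} [Fintype I] {d : I → ℕ} {a c : ℕ}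
    (h : ({a, c} : Multiset ℕ) ≤ Finset.univ.val.map d) : ∃ i j, i ≠ j ∧ d i = a ∧ d j = c := by
  classical
  obtain ⟨i, -, hi⟩ := Multiset.mem_map.1 (Multiset.mem_of_le h (Multiset.mem_cons_self a _))
  rw [← Finset.insert_erase (Finset.mem_univ i), Finset.insert_val_of_notMem
    (Finset.notMem_erase i _), Multiset.map_cons, hi, Multiset.insert_eq_cons,
    Multiset.cons_le_cons_iff] at h
  obtain ⟨j, hj, hj'⟩ := Multiset.mem_map.1 (Multiset.mem_of_le h (Multiset.mem_singleton_self c))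
  exact ⟨i, j, (Finset.ne_of_mem_erase hj).symm, hi, hj'⟩

namespace LogField

open MvPolynomial

variable {K σ I : Type*} [Field K] [Fintype σ] [Fintype I]

theorem IsHomBasis.smul {F : Set (σ → K)} {p : I → σ → MvPolynomial σ K} {d : I → ℕ}
    (h : IsHomBasis F p d) {u : I → K} (hu : ∀ i, u i ≠ 0) :
    IsHomBasis F (fun i => (C (u i) : MvPolynomial σ K) • p i) d where
  log i := (h.log i).smul _
  hom i j := by
    have := (isHomogeneous_C σ (u i)).mul (h.hom i j)
    rwa [zero_add] at this
  indep := by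
    rw [Fintype.linearIndependent_iff]
    intro g hg i
    have := Fintype.linearIndependent_iff.1 h.indep (fun i => g i * C (u i))
      (by simpa only [smul_smul] using hg) i
    exact (mul_eq_zero.1 this).resolve_right (by simpa using hu i)
  span q hq := by
    obtain ⟨c, rfl⟩ := h.span q hq
    refine ⟨fun i => c i * C (u i)⁻¹, Finset.sum_congr rfl fun i _ => ?_⟩
    rw [smul_smul, mul_assoc, ← C_mul, inv_mul_cancel₀ (hu i), C_1, mul_one]

/-- A homogeneous basis whose only member of degree at most one is of degree one may be chosen to
contain the Euler field. -/
theorem IsHomBasis.exists_euler {F : Set (Fin 3 → K)} {p : Fin 3 → Fin 3 → MvPolynomial (Fin 3) K}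
    {d : Fin 3 → ℕ} (h : IsHomBasis F p d) (h0 : d 0 = 1) (h1 : 1 < d 1) (h2 : 1 < d 2) :
    ∃ p' : Fin 3 → Fin 3 → MvPolynomial (Fin 3) K, IsHomBasis F p' d ∧ p' 0 = X := by
  obtain ⟨c, hc, hhom, hc0⟩ := h.exists_homogeneous (isLog_X F) (m := 1)
    fun j => isHomogeneous_X K j
  -- By degree only the first basis element occurs in the expansion of the Euler field, with a
  -- constant coefficient; rescaling by it suffices.
  rw [Fin.sum_univ_three, hc0 1 h1, hc0 2 h2, zero_smul, zero_smul, add_zero, add_zero] at hc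
  have hc1 := hhom 0
  rw [h0, Nat.sub_self] at hc1
  obtain ⟨u, hu⟩ : ∃ u, c 0 = C u := ⟨_, totalDegree_eq_zero_iff_eq_C.1 (Nat.le_zero.1 hc1.totalDegree_le)⟩
  rw [hu] at hc
  have hu0 : u ≠ 0 := by
    rintro rfl
    have := congrFun hc 0
    rw [C_0, zero_smul] at this
    exact X_ne_zero _ this
  refine ⟨_, h.smul (u := ![u, 1, 1]) fun i => ?_, hc.symm⟩
  fin_cases i
  · exact hu0
  · exact one_ne_zero
  · exact one_ne_zero

end LogField

namespace Arrangement

open LogField MvPolynomial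

universe u' v'

variable {K : Type v'} [Field K]

section General

variable {V : Type u'} [AddCommGroup V] [Module K V]

theorem formSet_mono {A B : Arrangement K V} (h : A.planes ⊆ B.planes) {σ : Type*} [Fintype σ]
    [DecidableEq σ] (b : Module.Basis σ K V) : A.formSet b ⊆ B.formSet b := by
  rintro _ ⟨α, hα, hA, rfl⟩
  exact ⟨α, hα, h hA, rfl⟩

theorem delete_add {A : Arrangement K V} {H : Submodule K V} (hH : H ∈ A.planes) :
    (A.delete H).add H (A.isHyperplane H hH) = A := by
  classical
  ext1
  simpa [add, delete] using Finset.insert_erase hH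

theorem add_delete {A : Arrangement K V} {H : Submodule K V} (hA : H ∉ A.planes)
    (hH : IsHyperplane H) : (A.add H hH).delete H = A := by
  classical
  ext1
  simpa [add, delete] using Finset.erase_insert hA

/-- Only the last step of the construction is inspected: an addition ends at `A` as the larger
member of a triple, a deletion at `A` as the smaller one. -/
theorem RecursivelyFree.exists_compatibleTriple {A : Arrangement K V} (h : RecursivelyFree K V A) :
    A.planes = ∅ ∨ (∃ H ∈ A.planes, A.CompatibleTriple H) ∨
      ∃ (H : Submodule K V) (hH : IsHyperplane H), H ∉ A.planes ∧
        (A.add H hH).CompatibleTriple H := by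
  classical
  cases h with
  | empty => exact Or.inl rfl
  | addition _ _ H hH _ _ hexp => exact Or.inr (Or.inl ⟨H, hH, Or.inr hexp⟩)
  | deletion _ B H hH _ _ hexp =>
    refine Or.inr (Or.inr ⟨H, B.isHyperplane H hH, ?_, ?_⟩)
    · simp [delete]
    · rw [delete_add hH]
      exact Or.inl hexp

/-- The exponents of a free arrangement of lines in a plane. -/
theorem HasExponents.exists_pair [CharZero K] {B : Arrangement K V} {E : Multiset ℕ}
    (hE : B.HasExponents E) (hV : Module.finrank K V = 2) (hB : B.planes.Nonempty) :
    ∃ a c, E = {a, c} ∧ a ≤ 1 ∧ c ≤ max 1 (B.planes.card - 1) ∧ B.planes.card ≤ a + c := by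
  have : FiniteDimensional K V := Module.finite_of_finrank_eq_succ hV
  let b := Module.finBasisOfFinrankEq K V hV
  obtain ⟨p, d, hp, rfl⟩ := (hasExponents_iff B b _).1 hE
  let e : Fin 2 ≃ Fin (Module.finrank K V) := finCongr hV.symm
  have hmap : Finset.univ.val.map d = {d (e 0), d (e 1)} := by
    rw [← Multiset.map_univ_val_equiv e, Multiset.map_map]
    rfl
  have hcard : Fintype.card {H // H ∈ B.planes} = B.planes.card := Fintype.card_coe _
  obtain ⟨⟨i, hi⟩, hmax, hsum⟩ := exponents_plane
    (a := fun H : {H // H ∈ B.planes} => coeffs b (B.form H))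
    (fun H => coeffs_ne_zero b (B.form_ne_zero H))
    (fun H H' hne h => hne (Subtype.ext (by
      rw [← B.ker_form H, ← B.ker_form H']
      exact Module.Dual.ker_eq_of_ker_le (B.form_ne_zero H) (B.form_ne_zero H')
        (ker_le_of_linForm_coeffs_dvd b (B.form_ne_zero H) h))))
    (F := B.formSet b)
    (fun H => ⟨_, B.form_ne_zero H, by rw [B.ker_form]; exact H.2, rfl⟩)
    (by
      rintro _ ⟨α, hα, hk, rfl⟩
      obtain ⟨c, hc⟩ := Module.Dual.exists_smul_of_ker_le (B.form_ne_zero ⟨_, hk⟩)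
        (B.ker_form ⟨_, hk⟩).le
      refine ⟨⟨_, hk⟩, c, ?_, ?_⟩
      · rintro rfl
        exact hα (by rw [hc, zero_smul])
      · conv_lhs => rw [hc]
        rfl)
    (by rw [hcard]; exact hB.card_pos.ne') (hp.reindex e)
  rw [hcard] at hmax hsum
  fin_cases i
  · exact ⟨_, _, hmap, hi, hmax 1, hsum⟩
  · exact ⟨_, _, hmap.trans (Multiset.pair_comm _ _), hi, hmax 0, by rw [add_comm]; exact hsum⟩

end General

end Arrangement

/-! ### Coordinates adapted to a plane -/

namespace Arrangement

open LogField MvPolynomial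

section Restriction

variable {K V : Type*} [Field K] [AddCommGroup V] [Module K V]

theorem linForm_coeffs_smul_isLog {σ : Type*} [Fintype σ] [DecidableEq σ]
    {A : Arrangement K V} (b : Module.Basis σ K V) {α : Module.Dual K V}
    {q : σ → MvPolynomial σ K} (hq : IsLog ((A.delete (LinearMap.ker α)).formSet b) q) :
    IsLog (A.formSet b) (linForm (coeffs b α) • q) := by
  classical
  rintro _ ⟨β, hβ, hA, rfl⟩
  rw [app_smul]
  by_cases h : LinearMap.ker β = LinearMap.ker α
  · obtain ⟨c, hc⟩ := Module.Dual.exists_smul_of_ker_le hβ h.le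
    have : linForm (coeffs b α) = C c * linForm (coeffs b β) := by
      rw [hc, ← Klein.linForm_smul]
      rfl
    rw [this, mul_right_comm]
    exact dvd_mul_left _ _
  · exact (hq _ ⟨β, hβ, Finset.mem_erase.2 ⟨h, hA⟩, rfl⟩).mul_left _

/-- A basis whose first two vectors span a given plane. -/
theorem exists_basis_of_dual {α : Module.Dual K V} (hV : Module.finrank K V = 3) (hα : α ≠ 0) :
    ∃ b : Module.Basis (Fin 3) K V, coeffs b α = Pi.single 2 1 := by
  have : FiniteDimensional K V := Module.finite_of_finrank_eq_succ hV
  have hker : Module.finrank K (LinearMap.ker α) = 2 := by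
    have := Module.Dual.finrank_ker_add_one_of_ne_zero hα
    omega
  obtain ⟨v, hv⟩ : ∃ v, α v = 1 := by
    obtain ⟨v, hv⟩ : ∃ v, α v ≠ 0 := by
      by_contra! h0
      exact hα (LinearMap.ext h0)
    exact ⟨(α v)⁻¹ • v, by rw [map_smul, smul_eq_mul, inv_mul_cancel₀ hv]⟩
  let b := Module.Basis.mkFinCons v (Module.finBasisOfFinrankEq K _ hker)
    (fun c x hx h => by
      have := congrArg α h
      rwa [map_add, LinearMap.mem_ker.1 hx, map_smul, hv, smul_eq_mul, mul_one, add_zero,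
        map_zero] at this)
    (fun z => ⟨-α z, by simp [hv]⟩)
  -- `mkFinCons` puts the vector outside the plane first; the rotation moves it to the last place.
  refine ⟨b.reindex (finRotate 3).symm, funext fun j => ?_⟩
  rw [coeffs, Module.Basis.reindex_apply, Equiv.symm_symm, Module.Basis.coe_mkFinCons]
  fin_cases j
  · exact (Module.finBasisOfFinrankEq K _ hker 0).2
  · exact (Module.finBasisOfFinrankEq K _ hker 1).2
  · exact hv

/-- Subtracting a multiple of `α` does not change the restriction to its kernel, so the first two
coefficients describe the trace of `β` on the plane. -/
theorem single_smul_coeffs {b : Module.Basis (Fin 3) K V} {α : Module.Dual K V}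
    (hb : coeffs b α = Pi.single 2 1) (β : Module.Dual K V) :
    coeffs b (β - β (b 2) • α) = ![coeffs b β 0, coeffs b β 1, 0] := by
  have h (j : Fin 3) : α (b j) = Pi.single (M := fun _ => K) 2 1 j := congrFun hb j
  funext j
  fin_cases j <;> simp [coeffs, h]

end Restriction

end Arrangement

/-! ### Absence of compatible triples, given the numbers of lines -/

namespace H3

open LogField Arrangement MvPolynomial

variable {K : Type*} [Field K] [CharZero K] {ζ : K}

/-- At most 11 lines leave both exponents of the restriction at most 10, so `dependent_of_deletion`
applies to the two corresponding basis fields. -/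
theorem not_compatibleTriple_of_mem (hζ : IsPrimitiveRoot ζ 5) {H : Submodule K (Fin 3 → K)}
    (hH : H ∈ (arrangement hζ).planes)
    (hne : ((arrangement hζ).restrict H).planes.Nonempty)
    (hcard : ((arrangement hζ).restrict H).planes.card ≤ 11) :
    ¬ (arrangement hζ).CompatibleTriple H := by
  classical
  intro hcomp
  obtain ⟨k, rfl⟩ := (mem_planes_iff hζ).1 hH
  have hα := dotProductEquiv_ne_zero (toK_normal_ne_zero hζ k)
  set α := dotProductEquiv K (Fin 3) (toK hζ (normal k)) with hαdef
  have hker : LinearMap.ker α = plane hζ k := rfl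
  have hsub : ((arrangement hζ).delete (plane hζ k)).planes ⊆ (arrangement hζ).planes :=
    Finset.erase_subset _ _
  have hH2 : Module.finrank K (plane hζ k) = 2 := by
    have := Module.Dual.finrank_ker_add_one_of_ne_zero hα
    rw [Module.finrank_fin_fun] at this
    rw [← hker]
    omega
  -- `B` is the arrangement or its deletion; in both cases its logarithmic fields are logarithmic
  -- for the deletion.
  suffices ∃ B : Arrangement K (Fin 3 → K),
      ((arrangement hζ).delete (plane hζ k)).planes ⊆ B.planes ∧
        ExpSubset ((arrangement hζ).restrict (plane hζ k)) B by
    obtain ⟨B, hB, E, F, hE, hF, hEF⟩ := this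
    obtain ⟨a, c, rfl, ha, hc, -⟩ := hE.exists_pair hH2 hne
    obtain ⟨p, d, hp, rfl⟩ := (hasExponents_iff B (axis hζ) _).1 hF
    obtain ⟨i, j, hij, hi, hj⟩ := Multiset.exists_ne_of_pair_le hEF
    obtain ⟨v, hv, c', hc'⟩ := exists_isStd hζ k
    obtain ⟨x, i', j', hx, hx'⟩ := hv.exists_not_radial
    refine dependent_of_deletion (isHomBasis_axis hζ) rfl (coeffs_ne_zero (axis hζ) hα)
      (fun q hq => linForm_coeffs_smul_isLog (axis hζ) hq) (x := x) (i := i') (j := j')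
      ?_ ?_ ((hp.log i).mono (formSet_mono hB _)) ((hp.log j).mono (formSet_mono hB _))
      (hp.hom i) (hp.hom j) (by omega) (by omega) fun s t hst => pair_indep hp.indep hij hst
    · rw [coeffs_axis, hc', smul_dotProduct, hx, smul_zero]
    · simpa [Klein.basisFields, Klein.eval_vec11] using hx'
  rcases hcomp with h | h
  · exact ⟨_, hsub, h⟩
  · exact ⟨_, subset_rfl, h⟩

/-- Makes the basis available in coordinates adapted to an arbitrary plane, sorted by degree and
starting with the Euler field. -/
theorem exists_isHomBasis (hζ : IsPrimitiveRoot ζ 5) (b : Module.Basis (Fin 3) K (Fin 3 → K)) :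
    ∃ P, IsHomBasis ((arrangement hζ).formSet b) P ![1, 11, 15] ∧ P 0 = X := by
  obtain ⟨p, d, hp, hd⟩ := (hasExponents_iff _ b _).1 (hasExponents hζ)
  have hmem (n : ℕ) (hn : n ∈ ({1, 11, 15} : Multiset ℕ)) : ∃ i, d i = n := by
    rw [hd] at hn
    obtain ⟨i, -, hi⟩ := Multiset.mem_map.1 hn
    exact ⟨i, hi⟩
  obtain ⟨i, hi⟩ := hmem 1 (by simp)
  obtain ⟨j, hj⟩ := hmem 11 (by simp)
  obtain ⟨k, hk⟩ := hmem 15 (by simp)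
  have hcomp : d ∘ ![i, j, k] = ![1, 11, 15] := by
    funext l
    fin_cases l
    · exact hi
    · exact hj
    · exact hk
  have hinj : Function.Injective ![i, j, k] := by
    have h : Function.Injective (![1, 11, 15] : Fin 3 → ℕ) := by decide
    rw [← hcomp] at h
    exact h.of_comp
  have hbij : Function.Bijective ![i, j, k] := by
    rw [Fintype.bijective_iff_injective_and_card]
    exact ⟨hinj, by simp⟩
  have h := hp.reindex (Equiv.ofBijective _ hbij)
  rw [Equiv.coe_ofBijective, hcomp] at h
  exact h.exists_euler rfl (by decide) (by decide)

/-- With 17 lines and one exponent at most 1, the other exponent of the restriction is at least 16.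
It is excluded in the enlarged arrangement by `false_of_addition`, and in the given one because all
degrees there are at most 15. -/
theorem not_compatibleTriple_of_notMem (hζ : IsPrimitiveRoot ζ 5) {H : Submodule K (Fin 3 → K)}
    (hH : IsHyperplane H) (hHA : H ∉ (arrangement hζ).planes)
    (hcard : 17 ≤ (((arrangement hζ).add H hH).restrict H).planes.card) :
    ¬ ((arrangement hζ).add H hH).CompatibleTriple H := by
  classical
  obtain ⟨α, hα, rfl⟩ := id hH
  set A := arrangement hζ with hA
  set B := A.add (LinearMap.ker α) hH with hB
  set R := B.restrict (LinearMap.ker α) with hR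
  have hH2 : Module.finrank K (LinearMap.ker α) = 2 := by
    have := Module.Dual.finrank_ker_add_one_of_ne_zero hα
    rw [Module.finrank_fin_fun] at this
    omega
  have hne : R.planes.Nonempty := Finset.card_pos.1 (by omega)
  have hexp {E : Multiset ℕ} (hE : R.HasExponents E) : ∃ a c, E = {a, c} ∧ 16 ≤ c := by
    obtain ⟨a, c, h, ha, -, hac⟩ := hE.exists_pair hH2 hne
    exact ⟨a, c, h, by omega⟩
  rintro (⟨E, F, hE, hF, hEF⟩ | ⟨E, F, hE, hF, hEF⟩)
  · obtain ⟨a, c, rfl, hc⟩ := hexp hE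
    obtain ⟨b, hb⟩ := exists_basis_of_dual (Module.finrank_fin_fun K) hα
    obtain ⟨P, hP, hP0⟩ := exists_isHomBasis hζ b
    obtain ⟨η, e, hη, rfl⟩ := (hasExponents_iff B b _).1 hF
    obtain ⟨-, j, -, -, hj⟩ := Multiset.exists_ne_of_pair_le hEF
    have hX : (MvPolynomial.X 2 : MvPolynomial (Fin 3) K) = linForm (coeffs b α) := by
      rw [hb, linForm_single]
    -- One plane of `A` is chosen for each line of the restriction; the restricted forms are then
    -- pairwise independent, as `not_X_two_dvd` requires.
    have hlift (Y : {Y // Y ∈ R.planes}) : ∃ β : Module.Dual K (Fin 3 → K), β ≠ 0 ∧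
        LinearMap.ker β ∈ A.planes ∧ ¬ LinearMap.ker α ≤ LinearMap.ker β ∧
        LinearMap.ker (β ∘ₗ (LinearMap.ker α).subtype) = Y.1 := by
      obtain ⟨H', hH', hY⟩ := Finset.mem_image.1 Y.2
      obtain ⟨hH'B, hle⟩ := Finset.mem_filter.1 hH'
      obtain ⟨β, hβ, rfl⟩ := B.isHyperplane H' hH'B
      refine ⟨β, hβ, ?_, hle, by rw [LinearMap.ker_comp, hY]⟩
      exact (Finset.mem_insert.1 hH'B).resolve_left fun h => hle h.ge
    choose β hβ hβA hle hβY using hlift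
    have hγ (Y) : β Y - β Y (b 2) • α ≠ 0 := by
      intro h0
      refine hle Y fun x hx => ?_
      have := LinearMap.congr_fun h0 x
      simpa [LinearMap.mem_ker.1 hx] using this
    have hnot : ¬ MvPolynomial.X 2 ∣ P 1 2 := by
      refine not_X_two_dvd hP hP0 ?_ ?_ (a := fun Y => coeffs b (β Y))
        (fun Y => ⟨_, hβ Y, hβA Y, rfl⟩) ?_ ?_ ?_
      · rintro _ ⟨γ, hγ, -, rfl⟩
        exact coeffs_ne_zero b hγ
      · rintro _ ⟨γ, hγ, hγA, rfl⟩ h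
        rw [hX] at h
        refine hHA ?_
        rw [← Module.Dual.ker_eq_of_ker_le hγ hα (ker_le_of_linForm_coeffs_dvd b hγ h)]
        exact hγA
      · intro Y
        rw [← single_smul_coeffs hb]
        exact coeffs_ne_zero b (hγ Y)
      · intro Y Z hYZ h
        rw [← single_smul_coeffs hb, ← single_smul_coeffs hb] at h
        have h1 := ker_le_of_linForm_coeffs_dvd b (hγ Y) h
        have hne0 (Y) : β Y ∘ₗ (LinearMap.ker α).subtype ≠ 0 := fun h0 =>
          hle Y fun x hx => LinearMap.congr_fun h0 ⟨x, hx⟩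
        refine hYZ (Subtype.ext ?_)
        rw [← hβY Y, ← hβY Z]
        refine Module.Dual.ker_eq_of_ker_le (hne0 Y) (hne0 Z) fun x hx => ?_
        have hx2 : α x = 0 := x.2
        have hx1 : β Y x = 0 := hx
        have h2 := h1 (x := (x : Fin 3 → K)) (by simp [hx1, hx2])
        simpa [hx2] using h2
      · rw [Fintype.card_coe]
        exact lt_of_lt_of_le (by decide) hcard
    let σ : Fin 3 ≃ Fin (Module.finrank K (Fin 3 → K)) := finCongr (by simp)
    refine false_of_addition (G := B.formSet b) (j := σ.symm j) hP hP0 ?_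
      (formSet_mono (Finset.subset_insert _ _) b) hnot (hη.reindex σ) ?_
    · rintro q hq h2 _ ⟨γ, hγ, hγB, rfl⟩
      rcases Finset.mem_insert.1 hγB with h | h
      · obtain ⟨c, rfl⟩ := Module.Dual.exists_smul_of_ker_le hα h.ge
        have : coeffs b (c • α) = c • Pi.single 2 1 := by rw [← hb]; rfl
        rw [this, Klein.linForm_smul, Klein.app_smul_left, linForm_single]
        refine mul_dvd_mul_left _ ?_
        simpa [app, Pi.single_apply] using h2
      · exact hq _ ⟨γ, hγ, h, rfl⟩
    · simp only [Function.comp_apply, Equiv.apply_symm_apply]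
      omega
  · obtain ⟨a, c, rfl, hc⟩ := hexp hE
    rw [add_delete hHA] at hF
    obtain ⟨p, d, hp, rfl⟩ := (hasExponents_iff A (axis hζ) _).1 hF
    obtain ⟨-, j, -, -, hj⟩ := Multiset.exists_ne_of_pair_le hEF
    obtain ⟨i, hi⟩ := (isHomBasis_axis hζ).exists_degree_le hp j
    fin_cases i <;> simp at hi <;> omega

end H3

/-! ### The lines of the intersection lattice and the finite checks on them -/

namespace H3

/-- A line in which planes of the arrangement meet, given by two of these planes; the number of
all planes through the line, less one; the set of these planes as a bit mask; and the coordinates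
modulo 31 of a direction vector, where `ζ` is mapped to 2. -/
structure Vertex where
  fst : Fin 27
  snd : Fin 27
  weight : ℕ
  mask : ℕ
  x : ℕ
  y : ℕ
  z : ℕ

/-- A direction vector of the line. -/
def Vertex.point (v : Vertex) : Fin 3 → Cyc := cross (normal v.fst) (normal v.snd)

/-- Incidence of a line and a plane. -/
def Vertex.inc (v : Vertex) (k : Fin 27) : Bool := v.mask.testBit k

/-- All the lines in which at least two planes meet. -/
def vertices : List Vertex :=
  [⟨0, 1, 6, 164011, 0, 0, 1⟩, ⟨0, 2, 1, 5, 0, 30, 0⟩, ⟨0, 4, 6, 328529, 0, 30, 1⟩,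
    ⟨0, 10, 2, 5121, 0, 30, 20⟩, ⟨0, 11, 2, 10241, 0, 12, 20⟩, ⟨0, 14, 1, 16385, 0, 12, 7⟩,
    ⟨0, 19, 2, 2621441, 0, 4, 19⟩, ⟨0, 20, 2, 5242881, 0, 4, 25⟩, ⟨0, 23, 2, 75497473, 0, 4, 28⟩,
    ⟨0, 24, 2, 50331649, 0, 4, 12⟩, ⟨1, 2, 2, 22, 1, 0, 0⟩, ⟨1, 6, 1, 66, 19, 0, 30⟩,
    ⟨1, 8, 6, 100689154, 1, 0, 12⟩, ⟨1, 9, 2, 2562, 19, 0, 12⟩, ⟨1, 12, 1, 4098, 1, 0, 11⟩,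
    ⟨1, 16, 2, 589826, 27, 0, 30⟩, ⟨1, 18, 2, 1310722, 27, 0, 15⟩,
    ⟨1, 21, 2, 10485762, 27, 0, 12⟩, ⟨1, 22, 2, 20971522, 27, 0, 6⟩,
    ⟨2, 3, 6, 1576012, 12, 1, 0⟩, ⟨2, 5, 2, 292, 30, 19, 0⟩, ⟨2, 7, 6, 6304388, 12, 19, 0⟩,
    ⟨2, 14, 1, 16388, 24, 20, 0⟩, ⟨2, 15, 2, 98308, 4, 1, 0⟩, ⟨2, 17, 2, 393220, 4, 16, 0⟩,
    ⟨2, 23, 2, 41943044, 3, 19, 0⟩, ⟨2, 24, 2, 83886084, 19, 25, 0⟩, ⟨3, 4, 1, 24, 19, 30, 1⟩,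
    ⟨3, 8, 2, 4360, 19, 30, 12⟩, ⟨3, 9, 2, 16904, 20, 12, 30⟩, ⟨3, 13, 1, 8200, 20, 12, 12⟩,
    ⟨3, 16, 2, 8454152, 17, 4, 8⟩, ⟨3, 18, 2, 17039368, 17, 4, 2⟩,
    ⟨3, 21, 2, 35651592, 17, 4, 30⟩, ⟨3, 22, 2, 71303176, 17, 4, 15⟩,
    ⟨4, 5, 6, 25188400, 30, 19, 12⟩, ⟨4, 7, 2, 1168, 12, 19, 12⟩, ⟨4, 13, 1, 8208, 30, 20, 11⟩,
    ⟨4, 15, 2, 1081360, 4, 1, 30⟩, ⟨4, 17, 2, 655376, 4, 16, 15⟩,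
    ⟨4, 21, 2, 69206032, 8, 19, 12⟩, ⟨4, 22, 2, 37748752, 2, 25, 6⟩, ⟨5, 6, 2, 8288, 19, 11, 19⟩,
    ⟨5, 9, 1, 544, 19, 11, 1⟩, ⟨5, 10, 1, 1056, 1, 12, 20⟩, ⟨5, 16, 2, 4259872, 27, 14, 16⟩,
    ⟨5, 18, 2, 2359328, 27, 14, 1⟩, ⟨5, 19, 2, 67633184, 27, 14, 19⟩,
    ⟨5, 20, 2, 34603040, 27, 14, 25⟩, ⟨6, 7, 2, 16576, 11, 20, 30⟩, ⟨6, 12, 1, 4160, 11, 7, 12⟩,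
    ⟨6, 15, 2, 33587264, 14, 19, 8⟩, ⟨6, 17, 2, 67240000, 14, 25, 2⟩,
    ⟨6, 21, 2, 18874432, 28, 24, 30⟩, ⟨6, 22, 2, 12582976, 7, 14, 15⟩,
    ⟨7, 8, 1, 384, 19, 12, 30⟩, ⟨7, 11, 1, 2176, 20, 11, 19⟩, ⟨7, 16, 2, 33620096, 17, 14, 29⟩,
    ⟨7, 18, 2, 67371136, 17, 14, 23⟩, ⟨7, 19, 2, 17301632, 17, 14, 1⟩,
    ⟨7, 20, 2, 9437312, 17, 14, 16⟩, ⟨8, 11, 1, 2304, 30, 30, 20⟩, ⟨8, 15, 2, 2130176, 4, 1, 16⟩,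
    ⟨8, 17, 2, 4325632, 4, 16, 1⟩, ⟨8, 19, 2, 8913152, 8, 15, 19⟩,
    ⟨8, 20, 2, 17826048, 2, 30, 25⟩, ⟨9, 10, 1, 1536, 11, 1, 19⟩,
    ⟨9, 15, 2, 8421888, 14, 19, 29⟩, ⟨9, 17, 2, 16908800, 14, 25, 23⟩,
    ⟨9, 19, 2, 34079232, 28, 2, 1⟩, ⟨9, 20, 2, 68157952, 7, 8, 16⟩,
    ⟨10, 15, 2, 16811008, 4, 1, 28⟩, ⟨10, 16, 2, 2163712, 17, 15, 28⟩,
    ⟨10, 17, 2, 8520704, 4, 16, 7⟩, ⟨10, 18, 2, 4457472, 17, 30, 7⟩,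
    ⟨11, 15, 2, 4229120, 14, 19, 28⟩, ⟨11, 16, 2, 67176448, 27, 2, 28⟩,
    ⟨11, 17, 2, 2230272, 14, 25, 7⟩, ⟨11, 18, 2, 33818624, 27, 8, 7⟩,
    ⟨12, 15, 2, 67145728, 4, 1, 24⟩, ⟨12, 16, 2, 1118208, 17, 19, 24⟩,
    ⟨12, 17, 2, 33689600, 4, 16, 3⟩, ⟨12, 18, 2, 790528, 17, 3, 3⟩,
    ⟨13, 15, 2, 565248, 14, 19, 24⟩, ⟨13, 16, 2, 16850944, 27, 6, 24⟩,
    ⟨13, 17, 2, 1187840, 14, 25, 3⟩, ⟨13, 18, 2, 8658944, 27, 12, 3⟩,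
    ⟨14, 15, 2, 311296, 14, 19, 6⟩, ⟨14, 16, 2, 212992, 17, 6, 6⟩,
    ⟨14, 19, 2, 4734976, 14, 6, 1⟩, ⟨14, 20, 2, 3162112, 24, 12, 16⟩]

theorem inc_iff : ∀ v ∈ vertices, ∀ k, v.inc k ↔ dot (normal k) v.point = 0 := by
  decide +kernel

theorem fst_ne_snd : ∀ v ∈ vertices, v.fst ≠ v.snd := by decide +kernel

/-- Completeness of the table: any two planes meet in a listed line. -/
theorem exists_inc : ∀ k l : Fin 27, k ≠ l → ∃ v ∈ vertices, v.inc k ∧ v.inc l := by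
  decide +kernel

theorem pairwise_inc : vertices.Pairwise fun v w => ∃ k, v.inc k ≠ w.inc k := by decide +kernel

theorem mask_lt : ∀ v ∈ vertices, v.mask < 2 ^ 27 := by decide +kernel

theorem card_inc : ∀ v ∈ vertices, (Finset.univ.filter fun k => v.inc k).card = v.weight + 1 := by
  decide +kernel

theorem sum_weight : (vertices.map Vertex.weight).sum = 191 := by decide +kernel

theorem length_filter_inc : ∀ k, (vertices.filter fun v => v.inc k).length ≤ 11 := by
  decide +kernel

/-- The value modulo 31 of an element of `ℤ[ζ]`, with `ζ` mapped to 2. -/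
def residue (c : Cyc) : ℤ := c.c0 + c.c1 * 2 + c.c2 * 4 + c.c3 * 8

theorem residue_point : ∀ v ∈ vertices, (residue (v.point 0) - v.x) % 31 = 0 ∧
    (residue (v.point 1) - v.y) % 31 = 0 ∧ (residue (v.point 2) - v.z) % 31 = 0 := by
  decide +kernel

/-- The weight of those lines that lie modulo 31 in the plane with the given normal vector. -/
def modWeight (a b c : ℕ) (l : List Vertex) : ℕ :=
  l.rec 0 fun v _ s => bif Nat.beq (Nat.mod (Nat.add (Nat.add (Nat.mul a v.x) (Nat.mul b v.y))
    (Nat.mul c v.z)) 31) 0 then Nat.add v.weight s else s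

/-- The weight of those lines that lie modulo 31 in the plane spanned by two of them. -/
def spanWeight (v w : Vertex) : ℕ :=
  modWeight ((v.y * w.z + 30 * (v.z * w.y)) % 31) ((v.z * w.x + 30 * (v.x * w.z)) % 31)
    ((v.x * w.y + 30 * (v.y * w.x)) % 31) vertices

/-- Two lines without a common plane of the arrangement span a plane whose lines have total weight
at most 10, even when incidence is tested modulo 31. A degenerate reduction would only count more: a
zero normal vector admits every line. -/
theorem spanWeight_le :
    vertices.Pairwise fun v w => v.mask &&& w.mask ≠ 0 ∨ (spanWeight v w).ble 10 := by
  decide +kernel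

theorem weight_le : ∀ v ∈ vertices, v.weight ≤ 6 := by decide +kernel

end H3

theorem List.Pairwise.or_of_ne {α : Type*} {R : α → α → Prop} {l : List α} (h : l.Pairwise R)
    {a b : α} (ha : a ∈ l) (hb : b ∈ l) (hab : a ≠ b) : R a b ∨ R b a := by
  have : Std.Symm fun a b => R a b ∨ R b a := ⟨fun _ _ => Or.symm⟩
  exact (h.imp (S := fun a b => R a b ∨ R b a) Or.inl).forall ha hb hab

/-! ### Counting the lines cut out on a plane -/

namespace H3

open Arrangement

section Cross

variable {K : Type*} [Field K]

/-- Two independent linear equations determine a vector up to a scalar. -/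
theorem exists_smul_cross {n h x : Fin 3 → K} (hc : cross n h ≠ 0) (hn : dot n x = 0)
    (hh : dot h x = 0) : ∃ c : K, x = c • cross n h := by
  refine exists_smul_of_cross_eq_zero hc (funext fun j => ?_)
  simp only [dot] at hn hh
  fin_cases j <;>
    simp only [cross, Fin.zero_eta, Fin.mk_one, Fin.reduceFinMk, Matrix.cons_val_zero,
      Matrix.cons_val_one, Matrix.cons_val, Pi.zero_apply]
  · linear_combination h 0 * hn - n 0 * hh
  · linear_combination h 1 * hn - n 1 * hh
  · linear_combination h 2 * hn - n 2 * hh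

theorem span_eq_inf_perp {n h x : Fin 3 → K} (hc : cross n h ≠ 0) (hx : x ≠ 0)
    (hn : x ∈ perp n) (hh : x ∈ perp h) : K ∙ x = perp n ⊓ perp h := by
  apply le_antisymm
  · rw [Submodule.span_singleton_le_iff_mem]
    exact ⟨hn, hh⟩
  · rintro y ⟨hy, hy'⟩
    obtain ⟨c, rfl⟩ := exists_smul_cross hc (mem_perp.1 hn) (mem_perp.1 hh)
    obtain ⟨d, rfl⟩ := exists_smul_cross hc (mem_perp.1 hy) (mem_perp.1 hy')
    have hc0 : c ≠ 0 := fun h0 => hx (by rw [h0, zero_smul])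
    rw [Submodule.mem_span_singleton]
    exact ⟨d / c, by rw [smul_smul, div_mul_cancel₀ _ hc0]⟩

theorem dot_comm {R : Type*} [CommRing R] (a b : Fin 3 → R) : dot a b = dot b a := by
  simp only [dot]; ring

theorem dot_smul_right {R : Type*} [CommRing R] (a b : Fin 3 → R) (c : R) :
    dot a (c • b) = c * dot a b := by
  simp only [dot, Pi.smul_apply, smul_eq_mul]; ring

end Cross

variable {K : Type*} [Field K] {ζ : K}

/-- The direction vector of a line over `K`. -/
noncomputable def Vertex.pointK (v : Vertex) (hζ : IsPrimitiveRoot ζ 5) : Fin 3 → K :=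
  toK hζ v.point

/-- A line of the arrangement. -/
noncomputable def Vertex.line (v : Vertex) (hζ : IsPrimitiveRoot ζ 5) :
    Submodule K (Fin 3 → K) := K ∙ v.pointK hζ

open Classical in
/-- The lines of the arrangement in a given plane. -/
noncomputable def linesIn (hζ : IsPrimitiveRoot ζ 5) (h : Fin 3 → K) : Finset Vertex :=
  vertices.toFinset.filter fun v => v.pointK hζ ∈ perp h

theorem mem_linesIn (hζ : IsPrimitiveRoot ζ 5) {h : Fin 3 → K} {v : Vertex} :
    v ∈ linesIn hζ h ↔ v ∈ vertices ∧ v.pointK hζ ∈ perp h := by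
  simp [linesIn]

variable [CharZero K] (hζ : IsPrimitiveRoot ζ 5)

theorem pointK_ne_zero {v : Vertex} (hv : v ∈ vertices) : v.pointK hζ ≠ 0 := fun h =>
  cross_normal_ne_zero _ _ (fst_ne_snd v hv) ((toK_eq_zero_iff hζ).1 h)

theorem pointK_mem_plane_iff {v : Vertex} (hv : v ∈ vertices) (k : Fin 27) :
    v.pointK hζ ∈ plane hζ k ↔ v.inc k := by
  rw [inc_iff v hv, plane, mem_perp, Vertex.pointK, dot_toK,
    map_eq_zero_iff _ (Cyc.eval_injective hζ)]

theorem line_le_plane_iff {v : Vertex} (hv : v ∈ vertices) (k : Fin 27) :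
    v.line hζ ≤ plane hζ k ↔ v.inc k := by
  rw [Vertex.line, Submodule.span_singleton_le_iff_mem, pointK_mem_plane_iff hζ hv]

theorem cross_toK_normal_ne_zero {k l : Fin 27} (hkl : k ≠ l) :
    cross (toK hζ (normal k)) (toK hζ (normal l)) ≠ 0 := by
  rw [cross_toK]
  exact fun h => cross_normal_ne_zero k l hkl ((toK_eq_zero_iff hζ).1 h)

theorem plane_inf_plane {v : Vertex} (hv : v ∈ vertices) {k l : Fin 27} (hkl : k ≠ l)
    (hk : v.inc k) (hl : v.inc l) : plane hζ k ⊓ plane hζ l = v.line hζ :=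
  (span_eq_inf_perp (cross_toK_normal_ne_zero hζ hkl) (pointK_ne_zero hζ hv)
    ((pointK_mem_plane_iff hζ hv k).2 hk) ((pointK_mem_plane_iff hζ hv l).2 hl)).symm

theorem eq_of_line_le {v w : Vertex} (hv : v ∈ vertices) (hw : w ∈ vertices)
    (h : v.line hζ ≤ w.line hζ) : v = w := by
  by_contra hne
  obtain ⟨k, hk⟩ := (pairwise_inc.or_of_ne hv hw hne).elim id
    fun ⟨k, hk⟩ => ⟨k, hk.symm⟩
  rw [Vertex.line, Submodule.span_singleton_le_iff_mem, Vertex.line,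
    Submodule.mem_span_singleton] at h
  obtain ⟨c, hc⟩ := h
  have hc0 : c ≠ 0 := fun h0 => pointK_ne_zero hζ hv (by rw [← hc, h0, zero_smul])
  apply hk
  rw [Bool.eq_iff_iff, ← pointK_mem_plane_iff hζ hv, ← pointK_mem_plane_iff hζ hw, ← hc,
    Submodule.smul_mem_iff _ hc0]

theorem card_restrict_le {H : Submodule K (Fin 3 → K)} (hH : H ∈ (arrangement hζ).planes) :
    ((arrangement hζ).restrict H).planes.Nonempty ∧
      ((arrangement hζ).restrict H).planes.card ≤ 11 := by
  classical
  obtain ⟨k, rfl⟩ := (mem_planes_iff hζ).1 hH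
  constructor
  · obtain ⟨l, hl⟩ := exists_ne k
    refine ⟨_, Finset.mem_image_of_mem _ (Finset.mem_filter.2 ⟨(mem_planes_iff hζ).2 ⟨l, rfl⟩, ?_⟩)⟩
    intro h
    refine cross_toK_normal_ne_zero hζ hl.symm (cross_eq_zero_of_perp_le h)
  · refine le_trans (Finset.card_le_card (t := ((vertices.filter fun v => v.inc k).toFinset).image
      fun v => (v.line hζ).comap (plane hζ k).subtype) ?_) (Finset.card_image_le.trans
        ((List.toFinset_card_le _).trans (length_filter_inc k)))
    intro Y hY
    obtain ⟨H', hH', rfl⟩ := Finset.mem_image.1 hY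
    obtain ⟨hA, hle⟩ := Finset.mem_filter.1 hH'
    obtain ⟨l, rfl⟩ := (mem_planes_iff hζ).1 hA
    have hkl : k ≠ l := fun h => hle (by rw [h])
    obtain ⟨v, hv, hk, hl⟩ := exists_inc k l hkl
    refine Finset.mem_image.2 ⟨v, by simp [hv, hk], ?_⟩
    rw [← plane_inf_plane hζ hv hkl hk hl]
    ext x
    simp

theorem nodup_vertices : vertices.Nodup :=
  pairwise_inc.imp fun ⟨_, hk⟩ h => hk (by rw [h])

theorem modWeight_eq (a b c : ℕ) (l : List Vertex) : modWeight a b c l =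
    (l.map fun v => if (a * v.x + b * v.y + c * v.z) % 31 = 0 then v.weight else 0).sum := by
  induction l with
  | nil => rfl
  | cons v l ih =>
    rw [List.map_cons, List.sum_cons, ← ih]
    change (bif Nat.beq ((a * v.x + b * v.y + c * v.z) % 31) 0 then
      v.weight + modWeight a b c l else modWeight a b c l) = _
    split_ifs with h
    · rw [h]; rfl
    · have : Nat.beq ((a * v.x + b * v.y + c * v.z) % 31) 0 = false :=
        Bool.eq_false_iff.2 fun h1 => h (Nat.eq_of_beq_eq_true h1)
      rw [this, zero_add]
      rfl

/-- Reduction modulo the prime `(31, ζ - 2)`. -/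
def toZMod : Cyc →+* ZMod 31 := Cyc.eval 2 (by decide)

theorem toZMod_apply (c : Cyc) : toZMod c = ((residue c : ℤ) : ZMod 31) := by
  rw [toZMod, Cyc.eval_apply, residue]
  push_cast
  ring

theorem toZMod_point {v : Vertex} (hv : v ∈ vertices) : toZMod (v.point 0) = v.x ∧
    toZMod (v.point 1) = v.y ∧ toZMod (v.point 2) = v.z := by
  have key (c : Cyc) (n : ℕ) (h : (residue c - n) % 31 = 0) : toZMod c = n := by
    have := (ZMod.intCast_zmod_eq_zero_iff_dvd (residue c - n) 31).2 (Int.dvd_of_emod_eq_zero h)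
    rw [toZMod_apply, ← sub_eq_zero, ← this]
    push_cast
    rfl
  obtain ⟨h0, h1, h2⟩ := residue_point v hv
  exact ⟨key _ _ h0, key _ _ h1, key _ _ h2⟩

/-- Reduction modulo `(31, ζ - 2)` is a ring homomorphism because `1 + 2 + 4 + 8 + 16 = 31`, so
every true incidence passes the test. The factor 30 stands for `-1`, which avoids subtraction in
`ℕ`. -/
theorem spanWeight_test {u v w : Vertex} (hu : u ∈ vertices) (hv : v ∈ vertices)
    (hw : w ∈ vertices) (h : dot (cross v.point w.point) u.point = 0) :
    ((v.y * w.z + 30 * (v.z * w.y)) % 31 * u.x + (v.z * w.x + 30 * (v.x * w.z)) % 31 * u.y +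
      (v.x * w.y + 30 * (v.y * w.x)) % 31 * u.z) % 31 = 0 := by
  apply Nat.mod_eq_zero_of_dvd
  rw [← ZMod.natCast_eq_zero_iff]
  have h30 : (30 : ZMod 31) = -1 := by decide
  have h' := congrArg toZMod h
  obtain ⟨u0, u1, u2⟩ := toZMod_point hu
  obtain ⟨v0, v1, v2⟩ := toZMod_point hv
  obtain ⟨w0, w1, w2⟩ := toZMod_point hw
  simp only [dot, cross, Matrix.cons_val_zero, Matrix.cons_val_one, Matrix.cons_val, map_add,
    map_sub, map_mul, map_zero, u0, u1, u2, v0, v1, v2, w0, w1, w2] at h'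
  push_cast [ZMod.natCast_mod]
  rw [h30, ← h']
  ring

/-- If the plane contains at most one listed line, the bound 6 on a single weight is enough.
Otherwise two such lines determine the plane, and the finite check `spanWeight_le` bounds the total
weight. -/
theorem sum_weight_linesIn_le {h : Fin 3 → K} (h0 : h ≠ 0)
    (hne : ∀ k, cross h (toK hζ (normal k)) ≠ 0) : ∑ v ∈ linesIn hζ h, v.weight ≤ 10 := by
  classical
  by_cases hvw : ∀ v ∈ linesIn hζ h, ∀ w ∈ linesIn hζ h, v = w
  · refine (Finset.sum_le_card_nsmul _ _ 6 fun v hv => weight_le v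
      ((mem_linesIn hζ).1 hv).1).trans ?_
    rw [smul_eq_mul]
    have := Finset.card_le_one.2 hvw
    omega
  push Not at hvw
  obtain ⟨v, hv, w, hw, hvw⟩ := hvw
  rw [mem_linesIn] at hv hw
  suffices ∀ v w, v ∈ vertices → w ∈ vertices → v.pointK hζ ∈ perp h → w.pointK hζ ∈ perp h →
      v ≠ w → (v.mask &&& w.mask ≠ 0 ∨ (spanWeight v w).ble 10) →
      ∑ v ∈ linesIn hζ h, v.weight ≤ 10 by
    rcases spanWeight_le.or_of_ne hv.1 hw.1 hvw with h1 | h1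
    · exact this v w hv.1 hw.1 hv.2 hw.2 hvw h1
    · exact this w v hw.1 hv.1 hw.2 hv.2 hvw.symm h1
  clear hv hw hvw v w
  intro v w hv hw hvh hwh hvw hspan
  have hcross : cross (v.pointK hζ) (w.pointK hζ) ≠ 0 := by
    intro h1
    obtain ⟨c, hc⟩ := exists_smul_of_cross_eq_zero (pointK_ne_zero hζ hv) h1
    refine hvw (eq_of_line_le hζ hw hv ?_).symm
    rw [Vertex.line, Submodule.span_singleton_le_iff_mem, hc]
    exact Submodule.smul_mem _ _ (Submodule.mem_span_singleton_self _)
  rcases hspan with hspan | hspan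
  -- A common bit is a common plane of the arrangement. As it differs from the given plane, both
  -- lines would be their intersection, hence equal.
  · obtain ⟨i, hi⟩ := Nat.exists_testBit_of_ne_zero hspan
    rw [Nat.testBit_and, Bool.and_eq_true] at hi
    have hlt : i < 27 := by
      by_contra hle
      rw [Nat.testBit_eq_false_of_lt ((mask_lt v hv).trans_le
        (Nat.pow_le_pow_right (by norm_num) (not_lt.1 hle)))] at hi
      exact absurd hi.1 (by decide)
    have hline {u : Vertex} (hu : u ∈ vertices) (huh : u.pointK hζ ∈ perp h)
        (hui : u.mask.testBit i = true) : u.line hζ = perp h ⊓ plane hζ ⟨i, hlt⟩ :=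
      span_eq_inf_perp (hne _) (pointK_ne_zero hζ hu) huh ((pointK_mem_plane_iff hζ hu _).2 hui)
    refine absurd (eq_of_line_le hζ hv hw ?_) hvw
    rw [hline hv hvh hi.1, hline hw hwh hi.2]
  · obtain ⟨c, hc⟩ := exists_smul_cross hcross (dot_comm h _ ▸ mem_perp.1 hvh)
      (dot_comm h _ ▸ mem_perp.1 hwh)
    have hc0 : c ≠ 0 := fun h1 => h0 (by rw [hc, h1, zero_smul])
    refine le_trans ?_ (Nat.le_of_ble_eq_true hspan)
    rw [spanWeight, modWeight_eq, ← List.sum_toFinset _ nodup_vertices, linesIn,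
      Finset.sum_filter]
    refine Finset.sum_le_sum fun u hu => ?_
    split_ifs with h1 h2 h2
    · exact le_rfl
    · refine absurd (spanWeight_test (List.mem_toFinset.1 hu) hv hw ?_) h2
      rw [mem_perp, hc, dot_comm, dot_smul_right, dot_comm, Vertex.pointK, Vertex.pointK,
        Vertex.pointK, cross_toK, dot_toK] at h1
      exact (map_eq_zero_iff _ (Cyc.eval_injective hζ)).1 ((mul_eq_zero.1 h1).resolve_left hc0)
    · exact Nat.zero_le _
    · exact le_rfl

/-- Planes have the same trace on `H` only if they meet in a line of `H`. Keeping one plane through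
each such line discards at most 10 of the 27, and the rest have distinct traces. -/
theorem le_card_restrict_add {H : Submodule K (Fin 3 → K)} (hH : IsHyperplane H)
    (hHA : H ∉ (arrangement hζ).planes) :
    17 ≤ (((arrangement hζ).add H hH).restrict H).planes.card := by
  classical
  obtain ⟨h, h0, rfl⟩ : ∃ h : Fin 3 → K, h ≠ 0 ∧ perp h = H := by
    obtain ⟨α, hα, h1⟩ := id hH
    refine ⟨(dotProductEquiv K (Fin 3)).symm α, (LinearEquiv.map_ne_zero_iff _).2 hα, ?_⟩
    rw [perp, LinearEquiv.apply_symm_apply, h1]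
  have hne (k) : cross h (toK hζ (normal k)) ≠ 0 := fun h1 =>
    hHA ((mem_planes_iff hζ).2 ⟨k, ((perp_eq_iff h0 (toK_normal_ne_zero hζ k)).2 h1).symm⟩)
  let f (k : Fin 27) : Submodule K (perp h) := (plane hζ k).comap (perp h).subtype
  -- On each line in the plane only the member `v.fst` is kept; this discards exactly `v.weight`
  -- planes for that line, possibly with repetitions between lines.
  obtain ⟨S, hSdef⟩ : ∃ S : Finset (Fin 27), S = Finset.univ \
    (linesIn hζ h).biUnion fun v => (Finset.univ.filter fun k => v.inc k).erase v.fst := ⟨_, rfl⟩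
  have hS : 17 ≤ S.card := by
    have h1 : ((linesIn hζ h).biUnion fun v =>
        (Finset.univ.filter fun k => v.inc k).erase v.fst).card ≤ 10 := by
      refine Finset.card_biUnion_le.trans (le_trans (Finset.sum_le_sum fun v hv => ?_)
        (sum_weight_linesIn_le hζ h0 hne))
      have hv' := ((mem_linesIn hζ).1 hv).1
      rw [Finset.card_erase_of_mem, card_inc v hv', Nat.add_sub_cancel]
      rw [Finset.mem_filter]
      exact ⟨Finset.mem_univ _, (inc_iff v hv' _).2 (dot_cross_left _ _)⟩
    have h2 := Finset.le_card_sdiff ((linesIn hζ h).biUnion fun v =>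
        (Finset.univ.filter fun k => v.inc k).erase v.fst) (Finset.univ : Finset (Fin 27))
    rw [Finset.card_univ, Fintype.card_fin] at h2
    rw [hSdef]
    omega
  have hinj : Set.InjOn f S := by
    intro k hk l hl hkl
    by_contra hkl'
    obtain ⟨v, hv, hvk, hvl⟩ := exists_inc k l hkl'
    have hx : cross h (toK hζ (normal k)) ∈ v.line hζ := by
      rw [← plane_inf_plane hζ hv hkl' hvk hvl]
      have h1 : cross h (toK hζ (normal k)) ∈ plane hζ k := mem_perp.2 (dot_cross_right _ _)
      refine ⟨h1, ?_⟩
      have h2 : (⟨_, mem_perp.2 (dot_cross_left h _)⟩ : perp h) ∈ f k := h1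
      rw [hkl] at h2
      exact h2
    obtain ⟨c, hc⟩ := Submodule.mem_span_singleton.1 hx
    have hc0 : c ≠ 0 := fun h1 => hne k (by rw [← hc, h1, zero_smul])
    have hvh : v ∈ linesIn hζ h := by
      rw [mem_linesIn, ← Submodule.smul_mem_iff _ hc0, hc]
      exact ⟨hv, mem_perp.2 (dot_cross_left _ _)⟩
    have hfst {m : Fin 27} (hm : m ∈ S) (hvm : v.inc m) : m = v.fst := by
      by_contra hm'
      simp only [hSdef, Finset.mem_sdiff, Finset.mem_univ, Finset.mem_biUnion, Finset.mem_erase,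
        Finset.mem_filter, true_and, not_exists, not_and] at hm
      exact hm v hvh hm' hvm
    exact hkl' ((hfst (Finset.mem_coe.1 hk) hvk).trans (hfst (Finset.mem_coe.1 hl) hvl).symm)
  refine hS.trans ((Finset.card_image_of_injOn hinj).symm.le.trans (Finset.card_le_card ?_))
  intro Y hY
  obtain ⟨k, -, rfl⟩ := Finset.mem_image.1 hY
  refine Finset.mem_image.2 ⟨plane hζ k, Finset.mem_filter.2
    ⟨Finset.mem_insert_of_mem ((mem_planes_iff hζ).2 ⟨k, rfl⟩), fun hle => ?_⟩, rfl⟩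
  exact hne k (cross_eq_zero_of_perp_le hle)

end H3

/-! ### Möbius function and characteristic polynomial -/

namespace Arrangement

open Polynomial

variable {K V : Type*} [Field K] [AddCommGroup V] [Module K V]

open Classical in
/-- The Möbius function, extended by zero to all subspaces. -/
noncomputable def mu (A : Arrangement K V) (X : Submodule K V) : ℤ :=
  if h : X ∈ A.lattice then A.moebius ⟨X, h⟩ else 0

theorem charPoly_eq_sum (A : Arrangement K V) :
    A.charPoly = ∑ X ∈ A.lattice, C (A.mu X) * Polynomial.X ^ Module.finrank K X := by
  rw [charPoly, ← Finset.sum_attach A.lattice]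
  refine Finset.sum_congr rfl fun X _ => ?_
  rw [mu, dif_pos X.2]

-- The defining recursion of the Möbius function, freed of the order dual: the interval from `V` to
-- `X` consists of the lattice elements containing `X`.
open Classical in
theorem sum_mu (A : Arrangement K V) {X : Submodule K V} (hX : X ∈ A.lattice) :
    ∑ Y ∈ A.lattice.filter (X ≤ ·), A.mu Y = if X = ⊤ then 1 else 0 := by
  have h := IncidenceAlgebra.sum_Icc_mu_right (𝕜 := ℤ) (α := A.LatticePoset)
    (OrderDual.toDual ⟨⊤, A.top_mem_lattice⟩) (OrderDual.toDual ⟨X, hX⟩)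
  have hiff : (OrderDual.toDual (⟨⊤, A.top_mem_lattice⟩ : {X // X ∈ A.lattice}) =
      OrderDual.toDual ⟨X, hX⟩) ↔ X = ⊤ := by
    rw [EmbeddingLike.apply_eq_iff_eq, Subtype.mk.injEq, eq_comm]
  simp only [hiff] at h
  rw [← h]
  symm
  refine Finset.sum_bij (fun Y _ => (OrderDual.ofDual Y).1) ?_ ?_ ?_ ?_
  · intro Y hY
    exact Finset.mem_filter.2 ⟨(OrderDual.ofDual Y).2, (Finset.mem_Icc.1 hY).2⟩
  · intro Y _ Z _ hYZ
    exact OrderDual.ofDual.injective (Subtype.ext hYZ)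
  · intro Y hY
    obtain ⟨hY, hXY⟩ := Finset.mem_filter.1 hY
    refine ⟨OrderDual.toDual ⟨Y, hY⟩, Finset.mem_Icc.2 ⟨?_, hXY⟩, rfl⟩
    change Y ≤ ⊤
    exact le_top
  · intro Y _
    rw [mu, dif_pos (OrderDual.ofDual Y).2]
    rfl

end Arrangement

namespace H3

open Arrangement

variable {K : Type*} [Field K] {ζ : K}

theorem inf_coordinate_planes (hζ : IsPrimitiveRoot ζ 5) : plane hζ 0 ⊓ (plane hζ 1 ⊓ plane hζ 2) = ⊥ := by
  rw [eq_bot_iff]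
  rintro x ⟨h0, h1, h2⟩
  have key (i : Fin 3) (h : x ∈ perp (toK hζ (normal ⟨i, by omega⟩))) : x i = 0 := by
    rwa [toK_normal_of_lt, mem_perp, ← dotProduct_eq_dot, single_one_dotProduct] at h
  rw [Submodule.mem_bot]
  funext i
  fin_cases i
  · exact key 0 h0
  · exact key 1 h1
  · exact key 2 h2

theorem inf_mem_lattice {A : Arrangement K (Fin 3 → K)} {H X : Submodule K (Fin 3 → K)}
    (hH : H ∈ A.planes) (hX : X ∈ A.lattice) : H ⊓ X ∈ A.lattice := by
  classical
  obtain ⟨B, hB, rfl⟩ := Finset.mem_image.1 hX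
  refine Finset.mem_image.2 ⟨insert H B, Finset.mem_powerset.2
    (Finset.insert_subset hH (Finset.mem_powerset.1 hB)), by rw [Finset.inf_insert]; rfl⟩

variable [CharZero K] (hζ : IsPrimitiveRoot ζ 5)

theorem finrank_plane (k : Fin 27) : Module.finrank K (plane hζ k) = 2 := by
  have := Module.Dual.finrank_ker_add_one_of_ne_zero
    (dotProductEquiv_ne_zero (toK_normal_ne_zero hζ k))
  rw [Module.finrank_fin_fun] at this
  rw [plane, perp]
  omega

theorem finrank_line {v : Vertex} (hv : v ∈ vertices) : Module.finrank K (v.line hζ) = 1 :=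
  finrank_span_singleton (pointK_ne_zero hζ hv)

theorem plane_le_plane_iff {k l : Fin 27} : plane hζ k ≤ plane hζ l ↔ l = k := by
  refine ⟨fun h => ?_, fun h => by rw [h]⟩
  by_contra hkl
  exact cross_toK_normal_ne_zero hζ (Ne.symm hkl) (cross_eq_zero_of_perp_le h)

theorem not_plane_le_line {k : Fin 27} {v : Vertex} (hv : v ∈ vertices) :
    ¬ plane hζ k ≤ v.line hζ := fun h => by
  have := Submodule.finrank_mono h
  rw [finrank_plane, finrank_line hζ hv] at this
  omega

theorem line_le_line_iff {v w : Vertex} (hv : v ∈ vertices) (hw : w ∈ vertices) :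
    v.line hζ ≤ w.line hζ ↔ w = v :=
  ⟨fun h => (eq_of_line_le hζ hv hw h).symm, fun h => by rw [h]⟩

theorem plane_ne_top (k : Fin 27) : plane hζ k ≠ ⊤ := fun h => by
  have := finrank_plane hζ k
  rw [h, finrank_top, Module.finrank_fin_fun] at this
  omega

theorem plane_ne_bot (k : Fin 27) : plane hζ k ≠ ⊥ := fun h => by
  have := finrank_plane hζ k
  rw [h, finrank_bot] at this
  omega

theorem line_ne_top {v : Vertex} (hv : v ∈ vertices) : v.line hζ ≠ ⊤ := fun h => by
  have := finrank_line hζ hv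
  rw [h, finrank_top, Module.finrank_fin_fun] at this
  omega

theorem line_ne_bot {v : Vertex} (hv : v ∈ vertices) : v.line hζ ≠ ⊥ := fun h => by
  have := finrank_line hζ hv
  rw [h, finrank_bot] at this
  omega

theorem plane_ne_line (k : Fin 27) {v : Vertex} (hv : v ∈ vertices) :
    plane hζ k ≠ v.line hζ := fun h => not_plane_le_line hζ hv h.le

theorem line_inf_plane {v : Vertex} (hv : v ∈ vertices) {k : Fin 27} (h : ¬ v.inc k) :
    plane hζ k ⊓ v.line hζ = ⊥ := by
  rw [eq_bot_iff]
  rintro x ⟨hx, hx'⟩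
  obtain ⟨c, rfl⟩ := Submodule.mem_span_singleton.1 hx'
  by_cases hc : c = 0
  · rw [hc, zero_smul]
    exact Submodule.zero_mem _
  · exact absurd ((pointK_mem_plane_iff hζ hv k).1 ((Submodule.smul_mem_iff _ hc).1 hx)) h

/-- Induction on the set of planes intersected: a further plane leaves the intersection unchanged or
cuts it down by one dimension. The zero space occurs because the coordinate planes belong to the
arrangement. -/
theorem mem_lattice_iff {X : Submodule K (Fin 3 → K)} : X ∈ (arrangement hζ).lattice ↔
    X = ⊤ ∨ X = ⊥ ∨ (∃ k, plane hζ k = X) ∨ ∃ v ∈ vertices, v.line hζ = X := by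
  classical
  have hpl (k : Fin 27) : plane hζ k ∈ (arrangement hζ).planes := (mem_planes_iff hζ).2 ⟨k, rfl⟩
  have htop := (arrangement hζ).top_mem_lattice
  have hmem (k : Fin 27) : plane hζ k ∈ (arrangement hζ).lattice := by
    rw [← inf_top_eq (plane hζ k)]
    exact inf_mem_lattice (hpl k) htop
  constructor
  · intro hX
    obtain ⟨B, hB, rfl⟩ := Finset.mem_image.1 hX
    rw [Finset.mem_powerset] at hB
    clear hX
    induction B using Finset.induction_on with
    | empty => exact Or.inl Finset.inf_empty
    | insert H B _ ih =>
      obtain ⟨hH, hB'⟩ := Finset.insert_subset_iff.1 hB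
      obtain ⟨k, rfl⟩ := (mem_planes_iff hζ).1 hH
      rw [Finset.inf_insert, id]
      rcases ih hB' with h | h | ⟨l, h⟩ | ⟨v, hv, h⟩
      · rw [h, inf_top_eq]
        exact Or.inr (Or.inr (Or.inl ⟨k, rfl⟩))
      · rw [h, inf_bot_eq]
        exact Or.inr (Or.inl rfl)
      · rw [← h]
        by_cases hkl : k = l
        · rw [hkl, inf_idem]
          exact Or.inr (Or.inr (Or.inl ⟨l, rfl⟩))
        · obtain ⟨v, hv, hk, hl⟩ := exists_inc k l hkl
          exact Or.inr (Or.inr (Or.inr ⟨v, hv, (plane_inf_plane hζ hv hkl hk hl).symm⟩))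
      · rw [← h]
        by_cases hk : v.inc k
        · rw [inf_eq_right.2 ((line_le_plane_iff hζ hv k).2 hk)]
          exact Or.inr (Or.inr (Or.inr ⟨v, hv, rfl⟩))
        · exact Or.inr (Or.inl (line_inf_plane hζ hv hk))
  · rintro (rfl | rfl | ⟨k, rfl⟩ | ⟨v, hv, rfl⟩)
    · exact htop
    · rw [← inf_coordinate_planes hζ]
      exact inf_mem_lattice (hpl 0) (inf_mem_lattice (hpl 1) (hmem 2))
    · exact hmem k
    · rw [← plane_inf_plane hζ hv (fst_ne_snd v hv) ((inc_iff v hv _).2 (dot_cross_left _ _))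
        ((inc_iff v hv _).2 (dot_cross_right _ _))]
      exact inf_mem_lattice (hpl _) (hmem _)

theorem sum_lattice {M : Type*} [AddCommMonoid M] (f : Submodule K (Fin 3 → K) → M) :
    ∑ X ∈ (arrangement hζ).lattice, f X =
      f ⊤ + (f ⊥ + (∑ k, f (plane hζ k) + (vertices.map fun v => f (v.line hζ)).sum)) := by
  classical
  have hlat : (arrangement hζ).lattice = insert ⊤ (insert ⊥
      (Finset.univ.image (plane hζ) ∪ vertices.toFinset.image fun v => v.line hζ)) := by
    ext X
    rw [mem_lattice_iff]
    simp
  rw [hlat, Finset.sum_insert, Finset.sum_insert, Finset.sum_union, Finset.sum_image,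
    Finset.sum_image, ← List.sum_toFinset _ nodup_vertices]
  · intro v hv w hw h
    exact eq_of_line_le hζ (List.mem_toFinset.1 hv) (List.mem_toFinset.1 hw) h.le
  · exact (plane_injective hζ).injOn
  · rw [Finset.disjoint_left]
    intro X hX hX'
    obtain ⟨k, -, rfl⟩ := Finset.mem_image.1 hX
    obtain ⟨v, hv, h⟩ := Finset.mem_image.1 hX'
    exact plane_ne_line hζ k (List.mem_toFinset.1 hv) h.symm
  · intro h
    rcases Finset.mem_union.1 h with h | h
    · obtain ⟨k, -, h⟩ := Finset.mem_image.1 h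
      exact plane_ne_bot hζ k h
    · obtain ⟨v, hv, h⟩ := Finset.mem_image.1 h
      exact line_ne_bot hζ (List.mem_toFinset.1 hv) h
  · intro h
    rcases Finset.mem_insert.1 h with h | h
    · exact top_ne_bot h
    rcases Finset.mem_union.1 h with h | h
    · obtain ⟨k, -, h⟩ := Finset.mem_image.1 h
      exact plane_ne_top hζ k h
    · obtain ⟨v, hv, h⟩ := Finset.mem_image.1 h
      exact line_ne_top hζ (List.mem_toFinset.1 hv) h

theorem mu_top : (arrangement hζ).mu ⊤ = 1 := by
  classical
  have h := (arrangement hζ).sum_mu ((mem_lattice_iff hζ).2 (Or.inl rfl))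
  rw [Finset.sum_filter, Finset.sum_eq_single ⊤, if_pos le_rfl, if_pos rfl] at h
  · exact h
  · exact fun X _ hX => if_neg fun h => hX (top_le_iff.1 h)
  · exact fun h => absurd (arrangement hζ).top_mem_lattice h

theorem mu_plane (k : Fin 27) : (arrangement hζ).mu (plane hζ k) = -1 := by
  classical
  have h := (arrangement hζ).sum_mu ((mem_lattice_iff hζ).2 (Or.inr (Or.inr (Or.inl ⟨k, rfl⟩))))
  have h0 : (vertices.map fun v => if plane hζ k ≤ v.line hζ then
      (arrangement hζ).mu (v.line hζ) else 0).sum = 0 := by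
    refine List.sum_eq_zero fun x hx => ?_
    obtain ⟨v, hv, rfl⟩ := List.mem_map.1 hx
    exact if_neg (not_plane_le_line hζ hv)
  have h1 : ∑ l, (if plane hζ k ≤ plane hζ l then (arrangement hζ).mu (plane hζ l) else 0) =
      (arrangement hζ).mu (plane hζ k) := by
    simp only [plane_le_plane_iff, Finset.sum_ite_eq', Finset.mem_univ, if_true]
  rw [Finset.sum_filter, sum_lattice hζ, if_pos le_top, mu_top, le_bot_iff,
    if_neg (plane_ne_bot hζ k), if_neg (plane_ne_top hζ k), h0, h1] at h
  linarith

/-- The recursion reads `1 - (weight + 1) + μ = 0`, since `weight + 1` planes contain the line. -/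
theorem mu_line {v : Vertex} (hv : v ∈ vertices) :
    (arrangement hζ).mu (v.line hζ) = v.weight := by
  classical
  have h := (arrangement hζ).sum_mu ((mem_lattice_iff hζ).2
    (Or.inr (Or.inr (Or.inr ⟨v, hv, rfl⟩))))
  have h0 : (vertices.map fun w => if v.line hζ ≤ w.line hζ then
      (arrangement hζ).mu (w.line hζ) else 0).sum = (arrangement hζ).mu (v.line hζ) := by
    rw [← List.sum_toFinset _ nodup_vertices, Finset.sum_eq_single v, if_pos le_rfl]
    · intro w hw hwv
      rw [if_neg]
      rwa [line_le_line_iff hζ hv (List.mem_toFinset.1 hw)]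
    · exact fun h => absurd (List.mem_toFinset.2 hv) h
  have h1 : ∑ k, (if v.line hζ ≤ plane hζ k then (arrangement hζ).mu (plane hζ k) else 0) =
      -(v.weight + 1 : ℤ) := by
    simp only [line_le_plane_iff hζ hv, mu_plane]
    rw [← Finset.sum_filter, Finset.sum_const, card_inc v hv]
    simp
  rw [Finset.sum_filter, sum_lattice hζ, if_pos le_top, mu_top, le_bot_iff,
    if_neg (line_ne_bot hζ hv), if_neg (line_ne_top hζ hv), h0, h1] at h
  linarith

theorem sum_mu_line : (vertices.map fun v => (arrangement hζ).mu (v.line hζ)).sum = 191 := by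
  rw [List.map_congr_left fun v hv => mu_line hζ hv]
  have := congrArg (Nat.cast : ℕ → ℤ) sum_weight
  rw [Nat.cast_list_sum, List.map_map] at this
  exact this

/-- The values over the whole lattice add up to zero: `1 - 27 + 191 + μ = 0`. -/
theorem mu_bot : (arrangement hζ).mu ⊥ = -165 := by
  classical
  have h := (arrangement hζ).sum_mu ((mem_lattice_iff hζ).2 (Or.inr (Or.inl rfl)))
  rw [Finset.sum_filter, sum_lattice hζ] at h
  simp only [bot_le, if_true, mu_top, mu_plane, sum_mu_line, if_neg bot_ne_top] at h
  simp at h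
  linarith

open Polynomial in
theorem charPoly_arrangement :
    (arrangement hζ).charPoly = (X - 1) * (X - 11) * (X - 15) := by
  have h1 : (vertices.map fun v => C ((arrangement hζ).mu (v.line hζ)) *
      (X : ℤ[X]) ^ Module.finrank K (v.line hζ)).sum = C 191 * X := by
    rw [List.map_congr_left fun v hv => by rw [finrank_line hζ hv, pow_one],
      List.sum_map_mul_right, ← sum_mu_line hζ, map_list_sum, List.map_map, Function.comp_def]
  rw [charPoly_eq_sum, sum_lattice hζ, h1, mu_top, mu_bot, finrank_top, Module.finrank_fin_fun,
    finrank_bot]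
  simp only [mu_plane, finrank_plane, Finset.sum_const, Finset.card_univ, Fintype.card_fin]
  simp only [map_one, map_neg, eq_intCast]
  push_cast
  ring

end H3

/-! ### The theorem -/

open Polynomial in
theorem theorem3p4 {K : Type*} [Field K] [CharZero K] (ζ : K) (hζ : IsPrimitiveRoot ζ 5) :
    ∃ A : Arrangement K (Fin 3 → K),
      (A.planes : Set (Submodule K (Fin 3 → K))) = H3.rootPlanes ζ ∪ H3.orbitPlanes ζ ∧
      (H3.rootPlanes ζ).ncard = 15 ∧ (H3.orbitPlanes ζ).ncard = 12 ∧ A.planes.card = 27 ∧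
      A.IsFree ∧ A.HasExponents {1, 11, 15} ∧
      A.charPoly = (X - 1) * (X - 11) * (X - 15) ∧
      ¬ Arrangement.RecursivelyFree K (Fin 3 → K) A ∧
      (∀ H ∈ A.planes, ¬ A.CompatibleTriple H) ∧
      (∀ (H : Submodule K (Fin 3 → K)) (hH : IsHyperplane H), H ∉ A.planes →
        ¬ (A.add H hH).CompatibleTriple H) := by
  have hmem : ∀ H ∈ (H3.arrangement hζ).planes, ¬ (H3.arrangement hζ).CompatibleTriple H :=
    fun H hH => H3.not_compatibleTriple_of_mem hζ hH (H3.card_restrict_le hζ hH).1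
      (H3.card_restrict_le hζ hH).2
  have hnot : ∀ (H : Submodule K (Fin 3 → K)) (hH : IsHyperplane H),
      H ∉ (H3.arrangement hζ).planes → ¬ ((H3.arrangement hζ).add H hH).CompatibleTriple H :=
    fun H hH hHA => H3.not_compatibleTriple_of_notMem hζ hH hHA
      (H3.le_card_restrict_add hζ hH hHA)
  refine ⟨H3.arrangement hζ, H3.coe_planes hζ, H3.ncard_rootPlanes hζ, H3.ncard_orbitPlanes hζ,
    H3.card_planes hζ, (H3.hasExponents hζ).isFree, H3.hasExponents hζ,
    H3.charPoly_arrangement hζ, fun h => ?_, hmem, hnot⟩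
  rcases h.exists_compatibleTriple with h | ⟨H, hH, h⟩ | ⟨H, hH, hHA, h⟩
  · have := H3.card_planes hζ
    rw [h, Finset.card_empty] at this
    omega
  · exact hmem H hH h
  · exact hnot H hH hHA h
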